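/- Let $X$ be a topological space and $\mathcal R$ a sheaf of commutative rings on $X$. A prestack on $X$ is a pseudofunctor from the opposite of the category of open subsets of $X$ to categories; it is separated if for all objects $p',p$ over an open $U$ the presheaf $V\mapsto \mathrm{Hom}(p'|_V,p|_V)$ on $U$ is a sheaf $\mathcal Hom(p',p)$, and a stack if moreover descent data for objects are effective. It is an $\mathcal R$-prestack if these presheaves are $\mathcal R|_U$-modules, compatibly with restriction and with (bilinear) composition. An $\mathcal R$-algebroid is an $\mathcal R$-linear stack which is locally non-empty and in which any two objects over the same open set are locally isomorphic; a gerbe is a stack of groupoids with the same two properties. Let $\mathcal R\text{-}\mathfrak{Alg}$ be the stack of sheaves of (not necessarily commutative) $\mathcal R$-algebras. An $\mathcal R$-algebroid data is a triple $(\mathcal P,\Phi,\ell)$ where $\mathcal P$ is a gerbe on $X$, $\Phi\colon\mathcal P\to\mathcal R\text{-}\mathfrak{Alg}$ is a functor of prestacks, and $\ell$ is a family, compatible with restrictions, of group homomorphisms $\ell_p\colon\mathcal End_{\mathcal P}(p)\to\Phi(p)^\times$ (for $U\subset X$ open, $p\in\mathcal P(U)$) such that $\Phi(\phi)=\mathrm{Ad}(\ell_p(\phi))$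 for $\phi\in\mathcal End_{\mathcal P}(p)$, and $\ell_p(g\phi'g^{-1})=\Phi(g)(\ell_{p'}(\phi'))$ for $g\colon p'\to p$ and $\phi'\in\mathcal End_{\mathcal P}(p')$. **Proposition.** Let $(\mathcal P,\Phi,\ell)$ be an $\mathcal R$-algebroid data. Then the following description defines a separated $\mathcal R$-prestack $\mathcal A_0$ on $X$. (i) The objects of $\mathcal A_0(U)$ are those of $\mathcal P(U)$. (ii) For $p',p\in\mathcal P(U)$, the sheaf of morphisms is $\mathcal Hom_{\mathcal A_0}(p',p)=\Phi(p)\times^{\mathcal End_{\mathcal P}(p)}\mathcal Hom_{\mathcal P}(p',p)$. That is, pairs $(a,g)$ with $a\in\Phi(p)$ and $g\colon p'\to p$ in $\mathcal P$ define morphisms $[a,g]\colon p'\to p$; two pairs over the same open set define the same morphism if and only if they are equivalent for the equivalence relation generated by $(a,\phi g)\sim(a\,\ell_p(\phi),g)$, $\phi\in\mathcal End_{\mathcal P}(p)$; and every section of the sheaf of morphisms is locally of the form $[a,g]$. (iii) $[a,g]\circ[a',g']=[a\,\Phi(g)(a'),\,g g']$ for $[a,g]\colon p'\to p$ and $[a',g']\colon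 p''\to p'$. (iv) $r[a,g]=[ra,g]$ and $[a,g]+[a',g']=[a+a'\,\ell_p(g'g^{-1}),\,g]$ for $r\in\mathcal R$ and $[a,g],[a',g']\colon p'\to p$. (v) The restrictions of objects are those of $\mathcal P$, and $[a,g]|_V=[a|_V,g|_V]$. Moreover $g\mapsto[1,g]$ defines a functor of prestacks $J_0\colon\mathcal P\to\mathcal A_0$ which is the identity on objects. There is a stack $\mathcal A$ associated with $\mathcal A_0$, i.e. a stack with a functor $i\colon\mathcal A_0\to\mathcal A$ such that for every stack $\mathcal C$ composition with $i$ is an equivalence from the category of functors $\mathcal A\to\mathcal C$ to the category of functors $\mathcal A_0\to\mathcal C$; the stack $\mathcal A$ has a structure of $\mathcal R$-algebroid for which $i$ is $\mathcal R$-linear; and the functor $J=i\circ J_0\colon\mathcal P\to\mathcal A$ is such that for every open $U\subset X$ and every $p\in\mathcal P(U)$ there is an isomorphism of $\mathcal R|_U$-algebras $\Phi(p)\simeq\mathcal End_{\mathcal A}(J(p))$, given on sections over $U$ by $a\mapsto i([a,\mathrm{id}_p])$. -/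

import Mathlib

open CategoryTheory Opposite TopologicalSpace Bicategory
open scoped Pseudofunctor.StrongTrans

universe u

noncomputable section

namespace AlgebroidStacks

variable {X : Type u} [TopologicalSpace X]

/-- A prestack on `X`: a pseudofunctor from the opposite of the category of open subsets of `X`
to categories. -/
abbrev Prestack (X : Type u) [TopologicalSpace X] :=
  LocallyDiscrete (Opens X)ᵒᵖ ⥤ᵖ Cat.{u, u + 1}

/-- The category of objects of a prestack over an open subset. -/
abbrev Prestack.fib (F : Prestack X) (U : Opens X) : Type (u + 1) := F.obj (.mk (op U))

/-- The restriction functors of a prestack. -/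
abbrev Prestack.res (F : Prestack X) {U V : Opens X} (f : V ⟶ U) : F.fib U ⥤ F.fib V :=
  (F.map f.op.toLoc).toFunctor

/-- The functor over an open subset `U` of a functor of prestacks. -/
abbrev onFib {F G : Prestack X} (η : F ⟶ G) (U : Opens X) : F.fib U ⥤ G.fib U :=
  (η.app (.mk (op U))).toFunctor

/-- Compatibility of a functor of prestacks with restrictions: `η (p|_V) ≅ (η p)|_V`. -/
def resIso {F G : Prestack X} (η : F ⟶ G) {U V : Opens X} (f : V ⟶ U) (p : F.fib U) :
    (onFib η V).obj ((F.res f).obj p) ≅ (G.res f).obj ((onFib η U).obj p) :=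
  (Cat.Hom.toNatIso (η.naturality f.op.toLoc)).app p

/-- The prestack is separated: the presheaves of morphisms are sheaves. -/
abbrev Prestack.IsSeparated (F : Prestack X) : Prop :=
  F.IsPrestack (Opens.grothendieckTopology X)

/-- The prestack is a stack. -/
abbrev Prestack.IsStackOn (F : Prestack X) : Prop :=
  F.IsStack (Opens.grothendieckTopology X)

/-- Every point has a neighbourhood over which there is an object. -/
def Prestack.LocallyNonempty (F : Prestack X) : Prop :=
  ∀ x : X, ∃ U : Opens X, x ∈ U ∧ Nonempty (F.fib U)

/-- Any two objects over the same open subset are locally isomorphic. -/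
def Prestack.LocallyConnected (F : Prestack X) : Prop :=
  ∀ (U : Opens X) (p q : F.fib U), ∀ x ∈ U, ∃ (V : Opens X) (f : V ⟶ U), x ∈ V ∧
    Nonempty ((F.res f).obj p ≅ (F.res f).obj q)

/-- A gerbe: a stack of groupoids which is locally non empty and locally connected. -/
structure Prestack.IsGerbe (F : Prestack X) : Prop where
  isStack : F.IsStackOn
  isIso : ∀ (U : Opens X) (p q : F.fib U) (g : p ⟶ q), IsIso g
  locallyNonempty : F.LocallyNonempty
  locallyConnected : F.LocallyConnected

/-- `i : F ⟶ A` exhibits `A` as the stack associated with the prestack `F`: `A` is a stack, and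
for any stack `C`, composition with `i` is an equivalence from the category of functors `A ⟶ C`
to the category of functors `F ⟶ C`. -/
structure IsAssociatedStack {F A : Prestack X} (i : F ⟶ A) : Prop where
  isStack : A.IsStackOn
  isEquivalence : ∀ C : Prestack X, C.IsStackOn → (precomp C i).IsEquivalence

/-! ### The stack of sheaves of `R`-algebras -/

/-- Sheaves of commutative rings on `X`. -/
abbrev RingSheaf (X : Type u) [TopologicalSpace X] :=
  Sheaf (Opens.grothendieckTopology X) CommRingCat.{u}

variable (R : RingSheaf X)

/-- Sections over `U` of the sheaf of rings `R`. -/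
abbrev sec (U : Opens X) : Type u := R.obj.obj (op U)

variable {R} in
/-- Restriction of sections of `R`. -/
abbrev secRes {U V : Opens X} (f : V ⟶ U) : sec R U →+* sec R V :=
  (R.obj.map f.op).hom

/-- A (not necessarily commutative) `R|_U`-algebra: a sheaf of rings on `U`, with a central
morphism from `R|_U`. An object `T` of `Over U` is an open subset `T.left` of `U`. -/
structure AlgSheaf (U : Opens X) where
  /-- the underlying sheaf of rings on `U` -/
  ring : Sheaf ((Opens.grothendieckTopology X).over U) RingCat.{u}
  /-- the structural morphism -/
  str (T : Over U) : sec R T.left →+* ring.obj.obj (op T)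
  str_res {T T' : Over U} (k : T' ⟶ T) (r : sec R T.left) :
    (ring.obj.map k.op).hom (str T r) = str T' (secRes k.left r)
  central (T : Over U) (r : sec R T.left) (a : ring.obj.obj (op T)) :
    str T r * a = a * str T r

namespace AlgSheaf

variable {R} {U V W : Opens X}

/-- Homomorphisms of `R|_U`-algebras. -/
@[ext]
structure Hom (A B : AlgSheaf R U) where
  /-- the underlying morphism of sheaves of rings -/
  hom : A.ring ⟶ B.ring
  hom_str (T : Over U) (r : sec R T.left) : (hom.hom.app (op T)).hom (A.str T r) = B.str T r

instance : Category (AlgSheaf R U) where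
  Hom := Hom
  id A := { hom := 𝟙 _, hom_str := fun _ _ => rfl }
  comp {A B C} f g :=
    { hom := f.hom ≫ g.hom
      hom_str := fun T r => by
        change (g.hom.hom.app (op T)).hom ((f.hom.hom.app (op T)).hom (A.str T r)) = _
        rw [f.hom_str, g.hom_str] }

@[ext]
lemma hom_ext {A B : AlgSheaf R U} {f g : A ⟶ B} (h : f.hom = g.hom) : f = g := Hom.ext h

@[simp] lemma id_hom (A : AlgSheaf R U) : Hom.hom (𝟙 A) = 𝟙 A.ring := rfl

@[simp] lemma comp_hom {A B C : AlgSheaf R U} (f : A ⟶ B) (g : B ⟶ C) :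
    (f ≫ g).hom = f.hom ≫ g.hom := rfl

lemma eqToHom_hom {A B : AlgSheaf R U} (h : A = B) :
    (eqToHom h).hom = eqToHom (by rw [h]) := by subst h; rfl

/-- An isomorphism of sheaves of rings compatible with the structural morphisms. -/
def isoMk {A B : AlgSheaf R U} (e : A.ring ≅ B.ring)
    (h : ∀ (T : Over U) (r : sec R T.left), (e.hom.hom.app (op T)).hom (A.str T r) = B.str T r) :
    A ≅ B where
  hom := { hom := e.hom, hom_str := h }
  inv :=
    { hom := e.inv
      hom_str := fun T r => by
        rw [← h]
        have := congrArg (fun k => (k.hom.app (op T)).hom (A.str T r)) e.hom_inv_id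
        exact this }
  hom_inv_id := by ext1; exact e.hom_inv_id
  inv_hom_id := by ext1; exact e.inv_hom_id

/-- Restriction of an `R|_U`-algebra to an open subset `V` of `U`. -/
def restrict (f : V ⟶ U) : AlgSheaf R U ⥤ AlgSheaf R V where
  obj A :=
    { ring := ((Opens.grothendieckTopology X).overMapPullback RingCat f).obj A.ring
      str := fun T => A.str ((Over.map f).obj T)
      str_res := fun k r => A.str_res ((Over.map f).map k) r
      central := fun T => A.central ((Over.map f).obj T) }
  map φ :=
    { hom := ((Opens.grothendieckTopology X).overMapPullback RingCat f).map φ.hom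
      hom_str := fun T => φ.hom_str ((Over.map f).obj T) }
  map_id _ := rfl
  map_comp _ _ := rfl

/-- The algebra of sections over `U`. -/
abbrev Γ (A : AlgSheaf R U) : Type u := A.ring.obj.obj (op (Over.mk (𝟙 U)))

/-- The action on sections over `U` of a homomorphism of algebras. -/
def Γmap {A B : AlgSheaf R U} (φ : A ⟶ B) : A.Γ →+* B.Γ := (φ.hom.hom.app _).hom

/-- The structural morphism on sections over `U`. -/
def Γstr (A : AlgSheaf R U) : sec R U →+* A.Γ := A.str (Over.mk (𝟙 U))

/-- Restriction of sections from `U` to `V`. -/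
def Γres (A : AlgSheaf R U) (f : V ⟶ U) : A.Γ →+* ((restrict f).obj A).Γ :=
  (A.ring.obj.map
    (Over.homMk f : (Over.map f).obj (Over.mk (𝟙 V)) ⟶ Over.mk (𝟙 U)).op).hom

end AlgSheaf

lemma secRes_self {U : Opens X} (f : U ⟶ U) (r : sec R U) : secRes f r = r := by
  obtain rfl : f = 𝟙 U := Subsingleton.elim _ _
  change (R.obj.map (𝟙 (op U))).hom r = r
  simp

/-- Restriction along the identity. -/
def AlgSheaf.restrictId (U : Opens X) :
    AlgSheaf.restrict (R := R) (𝟙 U) ≅ 𝟭 (AlgSheaf R U) :=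
  NatIso.ofComponents
    (fun A => AlgSheaf.isoMk
      (((Opens.grothendieckTopology X).overMapPullbackId RingCat U).app A.ring)
      (fun T r => (A.str_res ((Over.mapId U).inv.app T) r).trans
        (congrArg (A.str T) (secRes_self R _ r))))
    (fun φ => AlgSheaf.hom_ext
      (((Opens.grothendieckTopology X).overMapPullbackId RingCat U).hom.naturality φ.hom))

/-- Restriction along a composition. -/
def AlgSheaf.restrictComp {U V W : Opens X} (f : V ⟶ U) (g : W ⟶ V) :
    AlgSheaf.restrict (R := R) (g ≫ f) ≅ AlgSheaf.restrict f ⋙ AlgSheaf.restrict g :=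
  NatIso.ofComponents
    (fun A => AlgSheaf.isoMk
      (((Opens.grothendieckTopology X).overMapPullbackComp RingCat g f).symm.app A.ring)
      (fun T r => (A.str_res ((Over.mapComp g f).inv.app T) r).trans
        (congrArg (A.str _) (secRes_self R _ r))))
    (fun φ => AlgSheaf.hom_ext
      (((Opens.grothendieckTopology X).overMapPullbackComp RingCat g f).inv.naturality φ.hom))

/-- The stack of `R`-algebras: its objects over `U` are the `R|_U`-algebras, its morphisms the
homomorphisms of `R|_U`-algebras. -/
def algStack : Prestack X :=
  LocallyDiscrete.mkPseudofunctor
    (fun U => Cat.of (AlgSheaf R U.unop))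
    (fun f => (AlgSheaf.restrict f.unop).toCatHom)
    (fun U => Cat.Hom.isoMk (AlgSheaf.restrictId R U.unop))
    (fun f g => Cat.Hom.isoMk (AlgSheaf.restrictComp R f.unop g.unop))
    (fun f g h => by
      ext A
      apply AlgSheaf.hom_ext
      have := NatTrans.congr_app ((Opens.grothendieckTopology X).overMapPullback_assoc
        RingCat h.unop g.unop f.unop) A.ring
      simp only [eqToHom_refl,
        GrothendieckTopology.overMapPullbackCongr_eq_eqToIso] at this ⊢
      exact this)
    (fun f => by
      ext A
      apply AlgSheaf.hom_ext
      have := NatTrans.congr_app ((Opens.grothendieckTopology X).overMapPullback_comp_id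
        RingCat f.unop) A.ring
      simp only [Cat.Hom₂.eqToHom_toNatTrans, eqToHom_app,
        GrothendieckTopology.overMapPullbackCongr_eq_eqToIso, eqToIso.hom] at this ⊢
      exact this)
    (fun f => by
      ext A
      apply AlgSheaf.hom_ext
      have := NatTrans.congr_app ((Opens.grothendieckTopology X).overMapPullback_id_comp
        RingCat f.unop) A.ring
      simp only [Cat.Hom₂.eqToHom_toNatTrans, eqToHom_app,
        GrothendieckTopology.overMapPullbackCongr_eq_eqToIso, eqToIso.hom] at this ⊢
      exact this)

/-! ### Linear prestacks -/

/-- An `R`-linear prestack: the morphisms of its category over `U` form `R(U)`-modules, such that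
composition is bilinear, and restriction to `V` is compatible with the module structures; in other
words, the presheaves of morphisms on `U` are modules over `R|_U`, compatibly with composition and
restriction. -/
structure LinearPrestack where
  /-- the underlying prestack -/
  carrier : Prestack X
  [preadditive (U : Opens X) : Preadditive (carrier.fib U)]
  [linear (U : Opens X) : Linear (sec R U) (carrier.fib U)]
  res_add {U V : Opens X} (f : V ⟶ U) {p q : carrier.fib U} (s t : p ⟶ q) :
    (carrier.res f).map (s + t) = (carrier.res f).map s + (carrier.res f).map t
  res_smul {U V : Opens X} (f : V ⟶ U) {p q : carrier.fib U} (r : sec R U) (s : p ⟶ q) :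
    (carrier.res f).map (r • s) = secRes f r • (carrier.res f).map s

attribute [instance] LinearPrestack.preadditive LinearPrestack.linear

variable {R}

namespace LinearPrestack

/-- An `R`-algebroid: an `R`-linear stack which is locally non empty and locally connected by
isomorphisms. -/
structure IsAlgebroid (A : LinearPrestack R) : Prop where
  isStack : A.carrier.IsStackOn
  locallyNonempty : A.carrier.LocallyNonempty
  locallyConnected : A.carrier.LocallyConnected

/-- `R`-linear functors of `R`-linear prestacks. -/
structure IsLinear {A B : LinearPrestack R} (i : A.carrier ⟶ B.carrier) : Prop where
  map_add : ∀ (U : Opens X) (p q : A.carrier.fib U) (s t : p ⟶ q),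
    (onFib i U).map (s + t) = (onFib i U).map s + (onFib i U).map t
  map_smul : ∀ (U : Opens X) (p q : A.carrier.fib U) (r : sec R U) (s : p ⟶ q),
    (onFib i U).map (r • s) = r • (onFib i U).map s

/-- Restriction of endomorphisms of `q`: for `T' ⊆ T ⊆ U`, the ring homomorphism
`End (q|_T) → End (q|_{T'})`. -/
def endRes (A : LinearPrestack R) {U : Opens X} (q : A.carrier.fib U) {T T' : Over U}
    (k : T' ⟶ T) :
    End ((A.carrier.res T.hom).obj q) →+* End ((A.carrier.res T'.hom).obj q) where
  toFun s := Pseudofunctor.LocallyDiscreteOpToCat.pullHom s k.left T'.hom T'.hom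
    (Over.w k) (Over.w k)
  map_one' := by
    simp [Pseudofunctor.LocallyDiscreteOpToCat.pullHom, End.one_def, ← Cat.Hom₂.comp_app]
  map_mul' s t := by
    simp [Pseudofunctor.LocallyDiscreteOpToCat.pullHom, End.mul_def,
      ← reassoc_of% Cat.Hom₂.comp_app]
  map_zero' := by
    have h := A.res_add k.left (0 : (A.carrier.res T.hom).obj q ⟶ (A.carrier.res T.hom).obj q) 0
    rw [add_zero, left_eq_add] at h
    change _ ≫ (A.carrier.res k.left).map 0 ≫ _ = _
    rw [h]; simp
  map_add' s t := by
    change _ ≫ (A.carrier.res k.left).map (_ + _) ≫ _ = _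
    rw [A.res_add]
    simp only [Preadditive.add_comp, Preadditive.comp_add]
    rfl

/-- The `R|_U`-algebra of endomorphisms of an object `q` over `U` of a separated `R`-prestack: its
sections on `T ⊆ U` are the endomorphisms of `q|_T`. -/
def endAlg (A : LinearPrestack R) (hA : A.carrier.IsSeparated) {U : Opens X}
    (q : A.carrier.fib U) : AlgSheaf R U where
  ring :=
    { obj :=
        { obj := fun T => RingCat.of (End ((A.carrier.res T.unop.hom).obj q))
          map := fun k => RingCat.ofHom (A.endRes q k.unop)
          map_id := fun T => by
            ext s
            exact ConcreteCategory.congr_hom ((A.carrier.presheafHom q q).map_id T) s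
          map_comp := fun k l => by
            ext s
            exact ConcreteCategory.congr_hom ((A.carrier.presheafHom q q).map_comp k l) s }
      property := by
        rw [Presheaf.isSheaf_iff_isSheaf_forget _ _ (forget RingCat)]
        exact hA.isSheaf q q }
  str T :=
    { toFun := fun r => (r • 𝟙 ((A.carrier.res T.hom).obj q) : _ ⟶ _)
      map_one' := one_smul _ _
      map_mul' := fun r s => by
        change _ = _ ≫ _
        simp [mul_smul]
      map_zero' := zero_smul _ _
      map_add' := fun r s => add_smul _ _ _ }
  str_res := fun {T T'} k r => by
    change _ ≫ (A.carrier.res k.left).map (r • 𝟙 ((A.carrier.res T.hom).obj q)) ≫ _ = secRes k.left r • 𝟙 ((A.carrier.res T'.hom).obj q)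
    rw [A.res_smul]
    simp [← Cat.Hom₂.comp_app]
  central := fun T r a => by
    change a ≫ (r • 𝟙 _) = (r • 𝟙 _) ≫ a
    simp

/-- The section over `U` of the sheaf of endomorphisms of `q` given by an endomorphism of `q`. -/
def endSec (A : LinearPrestack R) (hA : A.carrier.IsSeparated) {U : Opens X} {q : A.carrier.fib U}
    (s : q ⟶ q) : (A.endAlg hA q).Γ :=
  ((A.carrier.res (𝟙 U)).map s : (A.carrier.res (𝟙 U)).obj q ⟶ (A.carrier.res (𝟙 U)).obj q)

end LinearPrestack

/-! ### Algebroid data -/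

section

variable {P : Prestack X} (Φ : P ⟶ algStack R)

/-- The `R|_U`-algebra `Φ(p)`, for `p` an object of `P` over `U`. -/
abbrev algOf {U : Opens X} (p : P.fib U) : AlgSheaf R U := (onFib Φ U).obj p

/-- The sections of `Φ(p)` over `U`, for `p` an object of `P` over `U`. The sections of `Φ(p)` over
an open subset `V` of `U` are those of `Φ(p|_V)`. -/
abbrev algSec {U : Opens X} (p : P.fib U) : Type u := (algOf Φ p).Γ

/-- The ring homomorphism `Φ(g)` on sections over `U`, for `g : p' ⟶ p` over `U`. -/
def algMap {U : Opens X} {p' p : P.fib U} (g : p' ⟶ p) : algSec Φ p' →+* algSec Φ p :=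
  AlgSheaf.Γmap ((onFib Φ U).map g)

/-- Restriction of sections of `Φ(p)` to `V`, through `Φ(p)|_V ≅ Φ(p|_V)`. -/
def algRes {U V : Opens X} (f : V ⟶ U) (p : P.fib U) :
    algSec Φ p →+* algSec Φ ((P.res f).obj p) :=
  (AlgSheaf.Γmap (B := algOf Φ ((P.res f).obj p)) (resIso Φ f p).inv).comp
    ((algOf Φ p).Γres f)

end

variable (R) in
/-- `R`-algebroid data: a gerbe `P`, a functor `Φ` of prestacks from `P` to the stack of
`R`-algebras, and a compatible family of liftings `lift p` of the action of the automorphisms of `p`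
on `Φ(p)` to invertible elements of `Φ(p)`. The multiplication of `End p` is
`φ * ψ = ψ ≫ φ`. The morphism of sheaves `End(p) → Φ(p)ˣ` is given on `V ⊆ U` by
`lift (p|_V)`. -/
structure AlgebroidData where
  /-- the gerbe -/
  P : Prestack X
  isGerbe : P.IsGerbe
  /-- the algebra-valued functor -/
  Φ : P ⟶ algStack R
  /-- the liftings of automorphisms to units -/
  lift {U : Opens X} (p : P.fib U) : End p →* (algSec Φ p)ˣ
  lift_res {U V : Opens X} (f : V ⟶ U) (p : P.fib U) (φ : p ⟶ p) :
    (lift ((P.res f).obj p) ((P.res f).map φ) : algSec Φ ((P.res f).obj p)) =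
      algRes Φ f p (lift p φ)
  map_eq_conj {U : Opens X} (p : P.fib U) (φ : p ⟶ p) (a : algSec Φ p) :
    algMap Φ φ a = (lift p φ : algSec Φ p) * a * ((lift p φ)⁻¹ : (algSec Φ p)ˣ)
  lift_conj {U : Opens X} {p' p : P.fib U} (g : p' ≅ p) (φ' : p' ⟶ p') :
    (lift p (g.inv ≫ φ' ≫ g.hom) : algSec Φ p) = algMap Φ g.hom (lift p' φ')

namespace AlgebroidData

variable (D : AlgebroidData R)

/-- The relation `(a, φ g) ∼ (a ℓ_p(φ), g)` on the pairs of a section `a` of `Φ(p)` and a morphism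
`g : p' ⟶ p`. -/
inductive Rel {U : Opens X} (p' p : D.P.fib U) :
    algSec D.Φ p × (p' ⟶ p) → algSec D.Φ p × (p' ⟶ p) → Prop
  | mk (a : algSec D.Φ p) (g : p' ⟶ p) (φ : p ⟶ p) :
      Rel p' p (a, g ≫ φ) (a * (D.lift p φ : algSec D.Φ p), g)

/-- The `R`-linear prestack `A₀` has the explicit description attached to the algebroid data `D`. -/
structure Description (A₀ : LinearPrestack R) where
  /-- The functor which is the identity on objects and sends `g` to `[1, g]`. It also expresses that
  the restrictions of objects in `A₀` are those in `P`. -/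
  J₀ : D.P ⟶ A₀.carrier
  /-- The objects of `A₀` over `U` are those of `P`. -/
  bijective_obj (U : Opens X) : Function.Bijective (onFib J₀ U).obj
  /-- The morphism `[a, g]`. -/
  cls {U : Opens X} {p' p : D.P.fib U} (a : algSec D.Φ p) (g : p' ⟶ p) :
    (onFib J₀ U).obj p' ⟶ (onFib J₀ U).obj p
  J₀_map {U : Opens X} {p' p : D.P.fib U} (g : p' ⟶ p) : (onFib J₀ U).map g = cls 1 g
  /-- `[a, g]` is the class of `(a, g)` for the equivalence relation generated by `Rel`. -/
  cls_eq_iff {U : Opens X} {p' p : D.P.fib U} (a b : algSec D.Φ p) (g h : p' ⟶ p) :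
    cls a g = cls b h ↔ Relation.EqvGen (D.Rel p' p) (a, g) (b, h)
  /-- Any morphism is locally of the form `[a, g]`. -/
  locally_cls {U : Opens X} {p' p : D.P.fib U}
    (s : (onFib J₀ U).obj p' ⟶ (onFib J₀ U).obj p) (x : X) (hx : x ∈ U) :
    ∃ (V : Opens X) (f : V ⟶ U) (a : algSec D.Φ ((D.P.res f).obj p))
      (g : (D.P.res f).obj p' ⟶ (D.P.res f).obj p), x ∈ V ∧
      (A₀.carrier.res f).map s = (resIso J₀ f p').inv ≫ cls a g ≫ (resIso J₀ f p).hom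
  /-- Restriction: `[a, g]|_V = [a|_V, g|_V]`. -/
  res_cls {U V : Opens X} (f : V ⟶ U) {p' p : D.P.fib U} (a : algSec D.Φ p) (g : p' ⟶ p) :
    (A₀.carrier.res f).map (cls a g) =
      (resIso J₀ f p').inv ≫ cls (algRes D.Φ f p a) ((D.P.res f).map g) ≫ (resIso J₀ f p).hom
  /-- Composition: `[a, g] ∘ [a', g'] = [a g(a'), g g']`. -/
  cls_comp {U : Opens X} {p'' p' p : D.P.fib U} (a : algSec D.Φ p) (g : p' ⟶ p)
    (a' : algSec D.Φ p') (g' : p'' ⟶ p') :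
    cls a' g' ≫ cls a g = cls (a * algMap D.Φ g a') (g' ≫ g)
  /-- `r [a, g] = [r a, g]`. -/
  smul_cls {U : Opens X} {p' p : D.P.fib U} (r : sec R U) (a : algSec D.Φ p) (g : p' ⟶ p) :
    r • cls a g = cls ((algOf D.Φ p).Γstr r * a) g
  /-- `[a, g] + [a', g'] = [a + a' ℓ_p(g' g⁻¹), g]`. -/
  cls_add {U : Opens X} {p' p : D.P.fib U} (a : algSec D.Φ p) (g : p' ≅ p)
    (a' : algSec D.Φ p) (g' : p' ⟶ p) :
    cls a g.hom + cls a' g' = cls (a + a' * (D.lift p (g.inv ≫ g') : algSec D.Φ p)) g.hom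

end AlgebroidData

end AlgebroidStacks

end

open AlgebroidStacks

/-!
The proof works with strict prestacks. In a strict prestack (`StrictPrestack`) every object has a
domain of definition, two objects have morphisms over each open subset of both domains, and only
the morphisms are restricted. There is no coherence to check for objects. Every prestack `F` is
presented by a strict one, whose morphisms over `W` from `x` to `y` are those from `x|_W` to `y|_W`
(`Prestack.strict`, `Prestack.pres`). Conversely a choice of restrictions of objects (`Cleavage`)
turns a strict prestack into a pseudofunctor, and a map of strict prestacks gives a functor of
prestacks (`mkTrans`). Being separated and being a stack are read on the strict side
(`Presentation.isSeparated`, `Presentation.isStackOn`).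

*The prestack `A₀`.* A section of the contracted product of `Φ(p)` and `Hom(p', p)` under `End(p)` is
an equivariant function `s` on `Hom(p', p)` with values in `Φ(p)`, that is
`s(φ g) ℓ(φ) = s(g)`, and `[a, g]` is the function with value `a` at `g` (`AlgData.Tw`, `Tw.cls`).
Such functions glue, so no sheafification is needed. A function is determined by its value at one
morphism (`Tw.eq_cls`), and morphisms exist locally in a gerbe, so that every section is locally of
the form `[a, g]`, and `[a, g] = [b, h]` exactly when `a = b ℓ(h g⁻¹)` (`Tw.cls_eq_iff`). The
composition is characterized by `(s s')(g h) = s(g) Φ(g)(s'(h))`. It does not depend on the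
factorization (`Tw.comp_indep`), and exists because two objects are locally isomorphic
(`Tw.exists_comp`).

*The associated stack.* The objects of the associated stack of a separated strict prestack are its
descent data (`Desc`), and the morphisms are the compatible families of local expressions
(`stackify`). The map to the associated stack is fully faithful, and locally essentially surjective
because a descent datum is isomorphic to each of its members (`stackifyIso`). These two properties
imply the universal property (`isAssociatedStack_of_locallySurjective`): a functor to a stack is
extended to an object by gluing its values on local trivializations (`Map.Triv`).

*The algebra of endomorphisms.* Equivariant functions on `End(p)` with values in `Φ(p)` are
determined by their value at the identity, so `a ↦ [a, id]` is an isomorphism from `Φ(p)` to the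
endomorphisms of `p` in `A₀`, hence in the associated stack (`AlgData.endEquiv`).
-/

set_option linter.unusedVariables false

noncomputable section

namespace AlgebroidStacks

variable {X : Type u} [TopologicalSpace X]

/-! ### Strict prestacks and gluing of morphisms -/

/-- An object whose domain of definition contains `W`, seen over `W`. -/
structure At {Ob : Type (u + 1)} (dom : Ob → Opens X) (W : Opens X) where
  /-- the object -/
  ob : Ob
  /-- it is defined over `W` -/
  le : W ≤ dom ob

/-- A prestack in which restriction is strictly functorial: every object `x` has a domain of
definition `dom x`, and two objects have morphisms over any open subset of both domains.
Restricting an object does not change it, so that no coherence isomorphism is needed. -/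
structure StrictPrestack (X : Type u) [TopologicalSpace X] where
  /-- the objects, over all open subsets -/
  Ob : Type (u + 1)
  /-- the domain of definition of an object -/
  dom : Ob → Opens X
  /-- the category of objects over `W` -/
  [cat : ∀ W, Category.{u} (At dom W)]
  /-- restriction of morphisms -/
  res {W W' : Opens X} (h : W' ≤ W) {x y : Ob} {hx : W ≤ dom x} {hy : W ≤ dom y}
    (f : (⟨x, hx⟩ : At dom W) ⟶ ⟨y, hy⟩) :
    (⟨x, h.trans hx⟩ : At dom W') ⟶ ⟨y, h.trans hy⟩
  res_self {W : Opens X} (h : W ≤ W) {x y : Ob} {hx : W ≤ dom x} {hy : W ≤ dom y}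
    (f : (⟨x, hx⟩ : At dom W) ⟶ ⟨y, hy⟩) : res h f = f
  res_res {W W' W'' : Opens X} (h : W' ≤ W) (h' : W'' ≤ W') {x y : Ob} {hx : W ≤ dom x}
    {hy : W ≤ dom y} (f : (⟨x, hx⟩ : At dom W) ⟶ ⟨y, hy⟩) :
    res h' (res h f) = res (h'.trans h) f
  res_id {W W' : Opens X} (h : W' ≤ W) {x : Ob} (hx : W ≤ dom x) :
    res h (𝟙 (⟨x, hx⟩ : At dom W)) = 𝟙 _
  res_comp {W W' : Opens X} (h : W' ≤ W) {x y z : Ob} {hx : W ≤ dom x} {hy : W ≤ dom y}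
    {hz : W ≤ dom z} (f : (⟨x, hx⟩ : At dom W) ⟶ ⟨y, hy⟩) (g : (⟨y, hy⟩ : At dom W) ⟶ ⟨z, hz⟩) :
    res h (f ≫ g) = res h f ≫ res h g

attribute [instance] StrictPrestack.cat
attribute [simp] StrictPrestack.res_self StrictPrestack.res_res StrictPrestack.res_id
  StrictPrestack.res_comp

/-- A covering sieve of `W`, as a family of open subsets of `W`. -/
structure Cov (W : Opens X) where
  /-- the open subsets in the sieve -/
  mem : Opens X → Prop
  le {V : Opens X} : mem V → V ≤ W
  down {V V' : Opens X} : V' ≤ V → mem V → mem V'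
  cov (p : X) : p ∈ W → ∃ V, mem V ∧ p ∈ V

namespace StrictPrestack

variable (E : StrictPrestack X)

/-- Restriction of isomorphisms. -/
@[simps]
def resIso {W W' : Opens X} (h : W' ≤ W) {x y : E.Ob} {hx : W ≤ E.dom x} {hy : W ≤ E.dom y}
    (f : (⟨x, hx⟩ : At E.dom W) ≅ ⟨y, hy⟩) :
    (⟨x, h.trans hx⟩ : At E.dom W') ≅ ⟨y, h.trans hy⟩ where
  hom := E.res h f.hom
  inv := E.res h f.inv
  hom_inv_id := by rw [← res_comp, f.hom_inv_id, res_id]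
  inv_hom_id := by rw [← res_comp, f.inv_hom_id, res_id]

section

variable {E} {W W' : Opens X} (h : W' ≤ W) {x y : E.Ob} {hx : W ≤ E.dom x} {hy : W ≤ E.dom y}
    (f : (⟨x, hx⟩ : At E.dom W) ≅ ⟨y, hy⟩)

@[simp]
lemma res_hom_inv : E.res h f.hom ≫ E.res h f.inv = 𝟙 _ := (E.resIso h f).hom_inv_id

@[simp]
lemma res_inv_hom : E.res h f.inv ≫ E.res h f.hom = 𝟙 _ := (E.resIso h f).inv_hom_id

@[simp]
lemma res_hom_inv_assoc {z : At E.dom W'} (g : (⟨x, h.trans hx⟩ : At E.dom W') ⟶ z) :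
    E.res h f.hom ≫ E.res h f.inv ≫ g = g := (E.resIso h f).hom_inv_id_assoc g

@[simp]
lemma res_inv_hom_assoc {z : At E.dom W'} (g : (⟨y, h.trans hy⟩ : At E.dom W') ⟶ z) :
    E.res h f.inv ≫ E.res h f.hom ≫ g = g := (E.resIso h f).inv_hom_id_assoc g

end

/-- The morphisms from `x` to `y` over `W` glue uniquely for the covering sieve `S`. -/
def Glues {W : Opens X} {x y : E.Ob} (hx : W ≤ E.dom x) (hy : W ≤ E.dom y) (S : Cov W) : Prop :=
  ∀ (s : ∀ V (hV : S.mem V), (⟨x, (S.le hV).trans hx⟩ : At E.dom V) ⟶ ⟨y, (S.le hV).trans hy⟩),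
    (∀ V V' (h : V' ≤ V) (hV : S.mem V), E.res h (s V hV) = s V' (S.down h hV)) →
    ∃! t : (⟨x, hx⟩ : At E.dom W) ⟶ ⟨y, hy⟩, ∀ V (hV : S.mem V), E.res (S.le hV) t = s V hV

/-- Morphisms of a strict prestack glue uniquely. -/
def IsSep : Prop :=
  ∀ ⦃W : Opens X⦄ ⦃x y : E.Ob⦄ (hx : W ≤ E.dom x) (hy : W ≤ E.dom y) (S : Cov W),
    E.Glues hx hy S

variable {E}

lemma Glues.of_iso {W : Opens X} {x x' y y' : E.Ob} {hx : W ≤ E.dom x} {hx' : W ≤ E.dom x'}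
    {hy : W ≤ E.dom y} {hy' : W ≤ E.dom y'} {S : Cov W} (h : E.Glues hx hy S)
    (e : (⟨x, hx⟩ : At E.dom W) ≅ ⟨x', hx'⟩) (e' : (⟨y, hy⟩ : At E.dom W) ≅ ⟨y', hy'⟩) :
    E.Glues hx' hy' S := by
  intro s hs
  obtain ⟨t, ht, ht'⟩ := h
    (fun V hV => E.res (S.le hV) e.hom ≫ s V hV ≫ E.res (S.le hV) e'.inv)
    (fun V V' h hV => by simp [← hs V V' h hV])
  refine ⟨e.inv ≫ t ≫ e'.hom, fun V hV => by simp [ht V hV], fun t₁ ht₁ => ?_⟩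
  rw [← ht' (e.hom ≫ t₁ ≫ e'.inv) (fun V hV => by simp [← ht₁ V hV])]
  simp

lemma IsSep.ext (hE : E.IsSep) {W : Opens X} {x y : E.Ob} {hx : W ≤ E.dom x} {hy : W ≤ E.dom y}
    {s t : (⟨x, hx⟩ : At E.dom W) ⟶ ⟨y, hy⟩}
    (h : ∀ p ∈ W, ∃ (V : Opens X) (hV : V ≤ W), p ∈ V ∧ E.res hV s = E.res hV t) : s = t := by
  let S : Cov W :=
    { mem := fun V => ∃ hV : V ≤ W, E.res hV s = E.res hV t
      le := fun ⟨h, _⟩ => h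
      down := fun {V V'} h ⟨hV, e⟩ => ⟨h.trans hV, by
        rw [← E.res_res hV h, e, E.res_res]⟩
      cov := fun p hp => by
        obtain ⟨V, hV, hpV, e⟩ := h p hp
        exact ⟨V, ⟨hV, e⟩, hpV⟩ }
  exact (hE hx hy S (fun V hV => E.res (S.le hV) t) (fun V V' h hV => E.res_res _ _ _)).unique
    (fun V hV => hV.2) (fun V hV => rfl)

end StrictPrestack

/-! ### Presentations of prestacks by strict prestacks -/

/-- A presentation of a prestack `F` by a strict prestack `E`: the categories `F.fib U` are
fully embedded in `E`, in such a way that restrictions in `F` are isomorphic, in `E`, to restrictions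
in `E`. The coherence isomorphisms of `F` are determined by the isomorphisms `can`. -/
structure Presentation (F : Prestack X) (E : StrictPrestack X) where
  /-- the object of `E` attached to an object of `F` -/
  ι {U : Opens X} (x : F.fib U) : E.Ob
  le {U : Opens X} (x : F.fib U) : U ≤ E.dom (ι x)
  /-- the morphism of `E` attached to a morphism of `F` -/
  emb {U : Opens X} {x y : F.fib U} :
    (x ⟶ y) ≃ ((⟨ι x, le x⟩ : At E.dom U) ⟶ ⟨ι y, le y⟩)
  emb_id {U : Opens X} (x : F.fib U) : emb (𝟙 x) = 𝟙 _
  emb_comp {U : Opens X} {x y z : F.fib U} (f : x ⟶ y) (g : y ⟶ z) :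
    emb (f ≫ g) = emb f ≫ emb g
  /-- the restriction in `F` of an object is isomorphic to this object -/
  can {U V : Opens X} (f : V ⟶ U) (x : F.fib U) :
    (⟨ι ((F.res f).obj x), le _⟩ : At E.dom V) ≅ ⟨ι x, f.le.trans (le x)⟩
  emb_res {U V : Opens X} (f : V ⟶ U) {x y : F.fib U} (g : x ⟶ y) :
    emb ((F.res f).map g) ≫ (can f y).hom = (can f x).hom ≫ E.res f.le (emb g)
  can_id {U : Opens X} (x : F.fib U) :
    (can (𝟙 U) x).hom = emb ((F.mapId (.mk (op U))).hom.toNatTrans.app x)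
  can_comp {U V W : Opens X} (f : V ⟶ U) (g : W ⟶ V) (h : W ⟶ U) (x : F.fib U) :
    (can h x).hom =
      emb ((F.mapComp' f.op.toLoc g.op.toLoc h.op.toLoc
        (by rw [← Quiver.Hom.comp_toLoc]; congr 1)).hom.toNatTrans.app x) ≫
      (can g ((F.res f).obj x)).hom ≫ E.res g.le (can f x).hom

section canonical

open Pseudofunctor.LocallyDiscreteOpToCat

variable (F : Prestack X)

lemma pullHom_comp {F : Prestack X} {U₁ U₂ U₃ V W : Opens X} {x : F.fib U₁} {y : F.fib U₂}
    {z : F.fib U₃} (f₁ : V ⟶ U₁) (f₂ : V ⟶ U₂) (f₃ : V ⟶ U₃) (g : W ⟶ V)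
    (s : (F.res f₁).obj x ⟶ (F.res f₂).obj y) (t : (F.res f₂).obj y ⟶ (F.res f₃).obj z)
    (g₁ : W ⟶ U₁) (g₂ : W ⟶ U₂) (g₃ : W ⟶ U₃) :
    pullHom (s ≫ t) g g₁ g₃ rfl rfl = pullHom s g g₁ g₂ rfl rfl ≫ pullHom t g g₂ g₃ rfl rfl := by
  simp [pullHom, ← reassoc_of% Cat.Hom₂.comp_app]

lemma pullHom_one {F : Prestack X} {U V W : Opens X} (x : F.fib U)
    (f : V ⟶ U) (g : W ⟶ V) (h : W ⟶ U) :
    pullHom (𝟙 ((F.res f).obj x)) g h h rfl rfl = 𝟙 _ := by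
  simp [pullHom, ← Cat.Hom₂.comp_app]

/-- The strict prestack attached to a prestack `F`: its objects are those of `F`, and the
morphisms over `W` from `x` to `y` are the morphisms from `x|_W` to `y|_W`. -/
def Prestack.strict : StrictPrestack X where
  Ob := Σ U : Opens X, F.fib U
  dom x := x.1
  cat W :=
    { Hom := fun a b => (F.res (homOfLE a.le)).obj a.ob.2 ⟶ (F.res (homOfLE b.le)).obj b.ob.2
      id := fun a => 𝟙 ((F.res (homOfLE a.le)).obj a.ob.2)
      comp := fun {a b c} f g => CategoryStruct.comp (obj := F.fib W) f g
      id_comp := fun f => Category.id_comp (obj := F.fib W) f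
      comp_id := fun f => Category.comp_id (obj := F.fib W) f
      assoc := fun f g h => Category.assoc (obj := F.fib W) f g h }
  res {W W'} h {x y hx hy} f :=
    pullHom (F := F) (M₁ := x.2) (M₂ := y.2) (f₁ := homOfLE hx) (f₂ := homOfLE hy) f (homOfLE h)
      (homOfLE (h.trans hx)) (homOfLE (h.trans hy)) rfl rfl
  res_self {W} h {x y hx hy} f := pullHom_id (F := F) (f₁ := homOfLE hx) (f₂ := homOfLE hy) f
  res_res {W W' W''} h h' {x y hx hy} f :=
    pullHom_pullHom (F := F) (f₁ := homOfLE hx) (f₂ := homOfLE hy) f _ _ _ _ _ _ rfl rfl rfl rfl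
  res_id {W W'} h {x} hx := pullHom_one (F := F) x.2 _ _ _
  res_comp {W W'} h {x y z hx hy hz} f g :=
    pullHom_comp (F := F) (homOfLE hx) (homOfLE hy) (homOfLE hz) _ f g _ _ _

/-- The component of `F.mapId` at `x`. -/
abbrev Prestack.mapIdApp {U : Opens X} (x : F.fib U) : (F.res (𝟙 U)).obj x ≅ x :=
  (Cat.Hom.toNatIso (F.mapId (.mk (op U)))).app x

lemma Prestack.mapIdApp_naturality {U : Opens X} {x y : F.fib U} (g : x ⟶ y) :
    (F.res (𝟙 U)).map g ≫ (F.mapIdApp y).hom = (F.mapIdApp x).hom ≫ g :=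
  (Cat.Hom.toNatIso (F.mapId (.mk (op U)))).hom.naturality g

lemma Prestack.mapIdApp_hom_naturality' {U : Opens X} (x : F.fib U) :
    (F.res (𝟙 U)).map (F.mapIdApp x).hom = (F.mapIdApp ((F.res (𝟙 U)).obj x)).hom := by
  rw [← cancel_mono (F.mapIdApp x).hom]
  exact F.mapIdApp_naturality _

lemma Prestack.map_conj_mapIdApp {U : Opens X} {x y : F.fib U}
    (g : (F.res (𝟙 U)).obj x ⟶ (F.res (𝟙 U)).obj y) :
    (F.res (𝟙 U)).map ((F.mapIdApp x).inv ≫ g ≫ (F.mapIdApp y).hom) = g := by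
  rw [Functor.map_comp, Functor.map_comp, F.mapIdApp_hom_naturality', ← cancel_epi
    ((F.res (𝟙 U)).map (F.mapIdApp x).hom), ← Functor.map_comp_assoc, Iso.hom_inv_id,
    CategoryTheory.Functor.map_id, Category.id_comp, F.mapIdApp_naturality,
    F.mapIdApp_hom_naturality']

lemma pullHom_map {U V : Opens X} (f : V ⟶ U) {x y : F.fib U} (g : x ⟶ y) :
    pullHom ((F.res (𝟙 U)).map g) f f f rfl rfl = (F.res f).map g := by
  exact F.mapComp'_naturality_2 (𝟙 _) f.op.toLoc f.op.toLoc (Category.id_comp _) g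

lemma pullHom_mapIdApp {U V W : Opens X} (f : V ⟶ U) (g : W ⟶ V) (h : W ⟶ U) (x : F.fib U) :
    pullHom (F.mapIdApp ((F.res f).obj x)).hom g g h rfl rfl =
      (F.mapComp' f.op.toLoc g.op.toLoc h.op.toLoc
        (by rw [← Quiver.Hom.comp_toLoc]; congr 1)).inv.toNatTrans.app x := by
  have h₁ := F.mapComp'_id_comp_hom_app g.op.toLoc ((F.res f).obj x)
  have h₂ : (F.res g).map (F.mapIdApp ((F.res f).obj x)).inv ≫
      (F.res g).map (F.mapIdApp ((F.res f).obj x)).hom = 𝟙 _ := by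
    rw [← Functor.map_comp, Iso.inv_hom_id, CategoryTheory.Functor.map_id]
  refine (congrArg (fun k => k ≫ _ ≫ _) h₁).trans ?_
  refine (reassoc_of% h₂) _

/-- A prestack is presented by its strict prestack. -/
def Prestack.pres : Presentation F F.strict where
  ι {U} x := ⟨U, x⟩
  le _ := le_rfl
  emb {U x y} :=
    { toFun := fun g => (F.res (𝟙 U)).map g
      invFun := fun g => (F.mapIdApp x).inv ≫ g ≫ (F.mapIdApp y).hom
      left_inv := fun g => by
        change _ ≫ (F.res (𝟙 U)).map g ≫ _ = g
        rw [F.mapIdApp_naturality, Iso.inv_hom_id_assoc]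
      right_inv := fun g => by
        exact F.map_conj_mapIdApp g }
  emb_id _ := (F.res _).map_id _
  emb_comp _ _ := (F.res _).map_comp _ _
  can f x := 
    { hom := (F.mapIdApp ((F.res f).obj x)).hom
      inv := (F.mapIdApp ((F.res f).obj x)).inv
      hom_inv_id := (F.mapIdApp ((F.res f).obj x)).hom_inv_id
      inv_hom_id := (F.mapIdApp ((F.res f).obj x)).inv_hom_id }
  emb_res {U V} f {x y} g := by
    refine (F.mapIdApp_naturality _).trans ?_
    exact congrArg (fun k => (F.mapIdApp ((F.res f).obj x)).hom ≫ k) (pullHom_map F f g).symm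
  can_id x := (F.mapIdApp_hom_naturality' x).symm
  can_comp {U V W} f g h x := by
    refine ((Category.comp_id _).symm.trans ?_ : (F.mapIdApp ((F.res h).obj x)).hom = _)
    let a := (Cat.Hom.toNatIso (F.mapComp' f.op.toLoc g.op.toLoc h.op.toLoc
        (by rw [← Quiver.Hom.comp_toLoc]; congr 1))).app x
    let k : (F.res h).obj x ⟶ (F.res g).obj ((F.res f).obj x) := a.hom
    let l : (F.res g).obj ((F.res f).obj x) ⟶ (F.res h).obj x := a.inv
    have h₁ : k ≫ l = 𝟙 _ := a.hom_inv_id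
    have h₂ := F.mapIdApp_naturality k
    rw [← h₁]
    refine ((reassoc_of% h₂) l).symm.trans ?_
    exact congrArg (fun m => (F.res (𝟙 W)).map k ≫
      (F.mapIdApp ((F.res g).obj ((F.res f).obj x))).hom ≫ m) (pullHom_mapIdApp F f g h x).symm

end canonical

namespace Presentation

open Pseudofunctor.LocallyDiscreteOpToCat

variable {F : Prestack X} {E : StrictPrestack X} (P : Presentation F E)

/-- Morphisms from `x|_V` to `y|_V` in `F` are the morphisms from `x` to `y` over `V` in `E`. -/
def conj {U U' V : Opens X} {x : F.fib U} {y : F.fib U'} (f : V ⟶ U) (f' : V ⟶ U') :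
    ((F.res f).obj x ⟶ (F.res f').obj y) ≃
      ((⟨P.ι x, f.le.trans (P.le x)⟩ : At E.dom V) ⟶ ⟨P.ι y, f'.le.trans (P.le y)⟩) :=
  P.emb.trans ((P.can f x).homCongr (P.can f' y))

lemma conj_apply {U U' V : Opens X} {x : F.fib U} {y : F.fib U'} (f : V ⟶ U) (f' : V ⟶ U')
    (φ : (F.res f).obj x ⟶ (F.res f').obj y) :
    P.conj f f' φ = (P.can f x).inv ≫ P.emb φ ≫ (P.can f' y).hom := rfl

lemma conj_id {U V : Opens X} {x : F.fib U} (f : V ⟶ U) :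
    P.conj f f (𝟙 ((F.res f).obj x)) = 𝟙 _ := by
  simp [conj_apply, P.emb_id]

lemma conj_comp {U U' U'' V : Opens X} {x : F.fib U} {y : F.fib U'} {z : F.fib U''} (f : V ⟶ U)
    (f' : V ⟶ U') (f'' : V ⟶ U'') (φ : (F.res f).obj x ⟶ (F.res f').obj y)
    (ψ : (F.res f').obj y ⟶ (F.res f'').obj z) :
    P.conj f f'' (φ ≫ ψ) = P.conj f f' φ ≫ P.conj f' f'' ψ := by
  simp [conj_apply, P.emb_comp]

lemma conj_map {U V : Opens X} {x y : F.fib U} (f : V ⟶ U) (g : x ⟶ y) :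
    P.conj f f ((F.res f).map g) = E.res f.le (P.emb g) := by
  rw [conj_apply, P.emb_res, Iso.inv_hom_id_assoc]

/-- The isomorphisms of `F` coming from isomorphisms of `E`. -/
def isoOfEmb {U : Opens X} {x y : F.fib U}
    (e : (⟨P.ι x, P.le x⟩ : At E.dom U) ≅ ⟨P.ι y, P.le y⟩) : x ≅ y where
  hom := P.emb.symm e.hom
  inv := P.emb.symm e.inv
  hom_inv_id := P.emb.injective (by simp [P.emb_comp, P.emb_id])
  inv_hom_id := P.emb.injective (by simp [P.emb_comp, P.emb_id])

/-- The isomorphisms of `E` coming from isomorphisms of `F`. -/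
@[simps]
def embIso {U : Opens X} {x y : F.fib U} (e : x ≅ y) :
    (⟨P.ι x, P.le x⟩ : At E.dom U) ≅ ⟨P.ι y, P.le y⟩ where
  hom := P.emb e.hom
  inv := P.emb e.inv
  hom_inv_id := by rw [← P.emb_comp, Iso.hom_inv_id, P.emb_id]
  inv_hom_id := by rw [← P.emb_comp, Iso.inv_hom_id, P.emb_id]

lemma conj_pullHom {U U' V W : Opens X} {x : F.fib U} {y : F.fib U'} (f : V ⟶ U) (f' : V ⟶ U')
    (φ : (F.res f).obj x ⟶ (F.res f').obj y) (g : W ⟶ V) (h : W ⟶ U) (h' : W ⟶ U') :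
    P.conj h h' (pullHom φ g h h' rfl rfl) = E.res g.le (P.conj f f' φ) := by
  have e₁ := P.can_comp f g h x
  have e₂ := P.can_comp f' g h' y
  let a := (Cat.Hom.toNatIso (F.mapComp' f.op.toLoc g.op.toLoc h.op.toLoc
        (by rw [← Quiver.Hom.comp_toLoc]; congr 1))).app x
  let b := (Cat.Hom.toNatIso (F.mapComp' f'.op.toLoc g.op.toLoc h'.op.toLoc
        (by rw [← Quiver.Hom.comp_toLoc]; congr 1))).app y
  let k : (F.res h).obj x ≅ (F.res g).obj ((F.res f).obj x) := a
  let l : (F.res h').obj y ≅ (F.res g).obj ((F.res f').obj y) := b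
  have e : pullHom φ g h h' rfl rfl = k.hom ≫ (F.res g).map φ ≫ l.inv := rfl
  replace e₁ : P.can h x = P.embIso k ≪≫ P.can g ((F.res f).obj x) ≪≫ E.resIso g.le (P.can f x) :=
    Iso.ext e₁
  replace e₂ : (P.can h' y).hom =
    P.emb l.hom ≫ (P.can g ((F.res f').obj y)).hom ≫ E.res g.le (P.can f' y).hom := e₂
  have e₃ := P.emb_res g φ
  have e₄ : P.emb l.inv ≫ P.emb l.hom = 𝟙 _ := (P.embIso l).inv_hom_id
  have e₅ : P.emb k.inv ≫ P.emb k.hom = 𝟙 _ := (P.embIso k).inv_hom_id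
  rw [conj_apply, e, e₁, e₂, P.emb_comp, P.emb_comp]
  simp only [Iso.trans_inv, StrictPrestack.resIso_inv, embIso_inv, Category.assoc]
  rw [reassoc_of% e₄, reassoc_of% e₅, reassoc_of% e₃, Iso.inv_hom_id_assoc, conj_apply,
    E.res_comp, E.res_comp]

end Presentation

/-! ### Cleavages -/

/-- A choice of restrictions for a family of objects of a strict prestack. -/
structure Cleavage (E : StrictPrestack X) where
  /-- the objects over `U` -/
  B : Opens X → Type (u + 1)
  /-- the underlying object -/
  ι {U : Opens X} : B U → E.Ob
  le {U : Opens X} (b : B U) : U ≤ E.dom (ι b)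
  /-- the chosen restriction -/
  r {U V : Opens X} (h : V ≤ U) : B U → B V
  /-- the chosen restriction is isomorphic to the given object -/
  c {U V : Opens X} (h : V ≤ U) (b : B U) :
    (⟨ι (r h b), le _⟩ : At E.dom V) ≅ ⟨ι b, h.trans (le b)⟩

namespace Cleavage

variable {E : StrictPrestack X} (K : Cleavage E)

/-- The category of objects over `U`. -/
def Fib (U : Opens X) : Type (u + 1) := K.B U

instance (U : Opens X) : Category.{u} (K.Fib U) where
  Hom b b' := (⟨K.ι (U := U) b, K.le (U := U) b⟩ : At E.dom U) ⟶
    ⟨K.ι (U := U) b', K.le (U := U) b'⟩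
  id b := 𝟙 (⟨K.ι (U := U) b, K.le (U := U) b⟩ : At E.dom U)
  comp {_ _ _} f g := CategoryStruct.comp (obj := At E.dom U) f g
  id_comp f := Category.id_comp (obj := At E.dom U) f
  comp_id f := Category.comp_id (obj := At E.dom U) f
  assoc f g h := Category.assoc (obj := At E.dom U) f g h

/-- An isomorphism of the category of objects over `U`. -/
def fibIso {U : Opens X} {b b' : K.B U} (e : (⟨K.ι b, K.le b⟩ : At E.dom U) ≅ ⟨K.ι b', K.le b'⟩) :
    Iso (C := K.Fib U) b b' where
  hom := e.hom
  inv := e.inv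
  hom_inv_id := e.hom_inv_id
  inv_hom_id := e.inv_hom_id

/-- Restriction of morphisms. -/
def resHom {U V : Opens X} (h : V ≤ U) {b b' : K.B U}
    (g : (⟨K.ι b, K.le b⟩ : At E.dom U) ⟶ ⟨K.ι b', K.le b'⟩) :
    (⟨K.ι (K.r h b), K.le _⟩ : At E.dom V) ⟶ ⟨K.ι (K.r h b'), K.le _⟩ :=
  (K.c h b).hom ≫ E.res h g ≫ (K.c h b').inv

/-- The chosen restrictions, as a functor. -/
def res {U V : Opens X} (h : V ≤ U) : K.Fib U ⥤ K.Fib V where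
  obj b := K.r h b
  map {b b'} g := K.resHom (b := b) (b' := b') h g
  map_id b := by
    change K.resHom (b := b) (b' := b) h (𝟙 _) = 𝟙 _
    simp [resHom]
  map_comp {b b' b''} f g := by
    change K.resHom (b := b) (b' := b'') h (CategoryStruct.comp (obj := At E.dom U) f g) =
      K.resHom (b := b) (b' := b') h f ≫ K.resHom (b := b') (b' := b'') h g
    simp only [resHom, StrictPrestack.res_comp, Category.assoc, Iso.inv_hom_id_assoc]

/-- The comparison of iterated restrictions. -/
def compIso {U V W : Opens X} (h : V ≤ U) (h' : W ≤ V) (b : K.B U) :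
    (⟨K.ι (K.r (h'.trans h) b), K.le _⟩ : At E.dom W) ≅ ⟨K.ι (K.r h' (K.r h b)), K.le _⟩ :=
  K.c (h'.trans h) b ≪≫ (E.resIso h' (K.c h b)).symm ≪≫ (K.c h' (K.r h b)).symm

lemma compIso_naturality {U V W : Opens X} (h : V ≤ U) (h' : W ≤ V) {b b' : K.B U}
    (g : (⟨K.ι b, K.le b⟩ : At E.dom U) ⟶ ⟨K.ι b', K.le b'⟩) :
    K.resHom (h'.trans h) g ≫ (K.compIso h h' b').hom =
      (K.compIso h h' b).hom ≫ K.resHom h' (K.resHom h g) := by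
  simp [resHom, compIso]

/-- The prestack defined by a cleavage. -/
def prestack : Prestack X :=
  LocallyDiscrete.mkPseudofunctor
    (fun U => Cat.of (K.Fib U.unop))
    (fun f => (K.res f.unop.le).toCatHom)
    (fun U => Cat.Hom.isoMk (NatIso.ofComponents (fun b => K.fibIso (K.c le_rfl b))
      (fun {b b'} g => by
        change K.resHom (b := b) (b' := b') le_rfl g ≫ (K.c le_rfl b').hom =
          (K.c le_rfl b).hom ≫ g
        simp [resHom])))
    (fun f g => Cat.Hom.isoMk (NatIso.ofComponents
      (fun b => K.fibIso (K.compIso f.unop.le g.unop.le b))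
      (fun {b b'} k => K.compIso_naturality f.unop.le g.unop.le (b := b) (b' := b') k)))
    (fun {U V W T} f g h => by
      ext b
      change _ = ((eqToHom (C := Cat.of (K.Fib U.unop) ⟶ Cat.of (K.Fib T.unop)) rfl).toNatTrans.app b)
      rw [eqToHom_refl]
      change ((K.compIso (f ≫ g).unop.le h.unop.le b).hom ≫
        K.resHom h.unop.le (K.compIso f.unop.le g.unop.le b).hom ≫ 𝟙 _ ≫
        (K.compIso g.unop.le h.unop.le (K.r f.unop.le b)).inv ≫
        (K.compIso f.unop.le (g ≫ h).unop.le b).inv) = 𝟙 _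
      simp [compIso, resHom])
    (fun {U V} f => by
      ext b
      change _ = ((eqToHom (C := Cat.of (K.Fib U.unop) ⟶ Cat.of (K.Fib V.unop)) rfl).toNatTrans.app b)
      rw [eqToHom_refl]
      change (K.compIso (𝟙 U : U ⟶ U).unop.le f.unop.le b).hom ≫
        K.resHom f.unop.le (K.c le_rfl b).hom ≫ 𝟙 _ = 𝟙 _
      simp [compIso, resHom])
    (fun {U V} f => by
      ext b
      change _ = ((eqToHom (C := Cat.of (K.Fib U.unop) ⟶ Cat.of (K.Fib V.unop)) rfl).toNatTrans.app b)
      rw [eqToHom_refl]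
      change (K.compIso f.unop.le (𝟙 V : V ⟶ V).unop.le b).hom ≫
        (K.c le_rfl (K.r f.unop.le b)).hom ≫ 𝟙 _ = 𝟙 _
      simp [compIso])

/-- The prestack defined by a cleavage is presented by the strict prestack. -/
def pres : Presentation K.prestack E where
  ι {U} b := K.ι (U := U) b
  le {U} b := K.le (U := U) b
  emb := Equiv.refl _
  emb_id _ := rfl
  emb_comp _ _ := rfl
  can {U V} f b := K.c (U := U) f.le b
  emb_res {U V} f b b' g := by
    change K.resHom (b := b) (b' := b') f.le g ≫ (K.c f.le b').hom = (K.c f.le b).hom ≫ E.res f.le g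
    simp [resHom]
  can_id _ := rfl
  can_comp {U V W} f g h b := by
    obtain rfl : h = g ≫ f := Subsingleton.elim _ _
    have e : (K.prestack.mapComp' f.op.toLoc g.op.toLoc (g ≫ f).op.toLoc rfl).hom.toNatTrans.app b =
      (K.compIso f.le g.le b).hom :=
      congrArg (fun a => a.hom.toNatTrans.app b)
        (K.prestack.mapComp'_eq_mapComp f.op.toLoc g.op.toLoc)
    refine Eq.trans ?_ (congrArg (fun k => CategoryStruct.comp (obj := At E.dom W) k _) e.symm)
    change (K.c (g ≫ f).le b).hom = (K.compIso f.le g.le b).hom ≫ (K.c g.le (K.r f.le b)).hom ≫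
      E.res g.le (K.c f.le b).hom
    simp [compIso]

end Cleavage

/-! ### Separatedness and effective descent through a presentation -/

/-- The covering sieve attached to a covering sieve for the Grothendieck topology. -/
def Cov.ofSieve {U : Opens X} (S : Sieve U) (hS : S ∈ Opens.grothendieckTopology X U) : Cov U where
  mem V := ∃ h : V ≤ U, S (homOfLE h)
  le := fun ⟨h, _⟩ => h
  down := fun h ⟨h', hV⟩ => ⟨h.trans h', S.downward_closed hV (homOfLE h)⟩
  cov p hp := by
    obtain ⟨V, f, hf, hpV⟩ := hS p hp
    exact ⟨V, ⟨f.le, hf⟩, hpV⟩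

/-- A covering sieve, as a sieve for the Grothendieck topology. -/
def Cov.sieve {U : Opens X} (S : Cov U) : Sieve U where
  arrows V _ := S.mem V
  downward_closed h g := S.down g.le h

lemma Cov.sieve_mem {U : Opens X} (S : Cov U) : S.sieve ∈ Opens.grothendieckTopology X U := by
  intro p hp
  obtain ⟨V, hV, hpV⟩ := S.cov p hp
  exact ⟨V, homOfLE (S.le hV), hV, hpV⟩

namespace Presentation

open Pseudofunctor.LocallyDiscreteOpToCat

variable {F : Prestack X} {E : StrictPrestack X} (P : Presentation F E)

lemma isSheafFor_iff_glues {U : Opens X} (M N : F.fib U) (S : Sieve U) (S' : Cov U)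
    (h : ∀ V (f : V ⟶ U), S f ↔ S'.mem V) :
    Presieve.IsSheafFor (F.presheafHom M N)
        ((Sieve.overEquiv (Over.mk (𝟙 U))).symm S).arrows ↔
      E.Glues (P.le M) (P.le N) S' := by
  have key (T : Over U) (f : T ⟶ Over.mk (𝟙 U)) :
      (Sieve.overEquiv (Over.mk (𝟙 U))).symm S f ↔ S'.mem T.left := h _ f.left
  constructor
  · intro H s hs
    let fam : Presieve.FamilyOfElements (F.presheafHom M N)
        ((Sieve.overEquiv (Over.mk (𝟙 U))).symm S).arrows :=
      fun T f hf => (P.conj T.hom T.hom).symm (s T.left ((key T f).1 hf))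
    have hfam : fam.Compatible := by
      rw [Presieve.compatible_iff_sieveCompatible]
      intro T T' f g hf
      apply (P.conj T'.hom T'.hom).injective
      refine Eq.trans ?_ (P.conj_pullHom T.hom T.hom (fam f hf) g.left T'.hom T'.hom).symm
      dsimp only [fam]
      rw [Equiv.apply_symm_apply, Equiv.apply_symm_apply, hs]
    obtain ⟨t, ht, ht'⟩ := H fam hfam
    refine ⟨P.conj (𝟙 U) (𝟙 U) t, fun V hV => ?_, fun t₁ ht₁ => ?_⟩
    · have := ht (Y := Over.mk (homOfLE (S'.le hV))) (Over.homMk (homOfLE (S'.le hV)))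
        ((key _ _).2 hV)
      have e := P.conj_pullHom (𝟙 U) (𝟙 U) t (homOfLE (S'.le hV)) (homOfLE (S'.le hV))
        (homOfLE (S'.le hV))
      refine e.symm.trans ((congrArg (P.conj _ _) this).trans ?_)
      exact Equiv.apply_symm_apply _ _
    · rw [← Equiv.symm_apply_eq]
      apply ht'
      intro T f hf
      apply (P.conj T.hom T.hom).injective
      refine (P.conj_pullHom (𝟙 U) (𝟙 U) _ f.left T.hom T.hom).trans ?_
      rw [Equiv.apply_symm_apply]
      exact (ht₁ _ _).trans (Equiv.apply_symm_apply _ _).symm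
  · intro H fam hfam
    rw [Presieve.compatible_iff_sieveCompatible] at hfam
    let fam' (V : Opens X) (hV : S'.mem V) := fam (Y := Over.mk (homOfLE (S'.le hV)))
      (Over.homMk (homOfLE (S'.le hV))) ((key _ _).2 hV)
    have hfam' (T : Over U) (f : T ⟶ Over.mk (𝟙 U)) (hf) :
      fam f hf = fam' T.left ((key T f).1 hf) := rfl
    obtain ⟨t, ht, ht'⟩ := H (fun V hV => P.conj _ _ (fam' V hV)) (fun V V' h hV => by
      refine (P.conj_pullHom _ _ _ (homOfLE h) _ _).symm.trans (congrArg _ ?_)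
      exact (hfam (Y := Over.mk (homOfLE (S'.le hV))) (Z := Over.mk (homOfLE (h.trans (S'.le hV))))
        (Over.homMk (homOfLE (S'.le hV))) (Over.homMk (homOfLE h)) ((key _ _).2 hV)).symm)
    refine ⟨(P.conj (𝟙 U) (𝟙 U)).symm t, ?_, ?_⟩
    · intro T f hf
      apply (P.conj T.hom T.hom).injective
      refine (P.conj_pullHom (𝟙 U) (𝟙 U) _ f.left T.hom T.hom).trans ?_
      rw [Equiv.apply_symm_apply]
      exact ht _ ((key T f).1 hf)
    · intro t₁ ht₁
      rw [Equiv.eq_symm_apply]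
      apply ht'
      intro V hV
      refine (P.conj_pullHom (𝟙 U) (𝟙 U) _ (homOfLE (S'.le hV)) _ _).symm.trans (congrArg _ ?_)
      exact ht₁ (Y := Over.mk (homOfLE (S'.le hV))) (Over.homMk (homOfLE (S'.le hV)))
        ((key _ _).2 hV)

lemma glues_of_isSeparated (hF : F.IsSeparated) {U : Opens X} (M N : F.fib U) (S : Cov U) :
    E.Glues (P.le M) (P.le N) S := by
  have := F.isPrestackFor' S.sieve S.sieve_mem
  rw [Pseudofunctor.isPrestackFor_iff_isSheafFor] at this
  exact (P.isSheafFor_iff_glues M N S.sieve S (fun _ _ => Iff.rfl)).1 (this M N)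

/-- A prestack presented by a strict prestack whose morphisms glue is separated. -/
lemma isSeparated (P : Presentation F E) (hE : E.IsSep) : F.IsSeparated := by
  apply Pseudofunctor.IsPrestack.of_isPrestackFor
  intro U S hS
  rw [Pseudofunctor.isPrestackFor_iff_isSheafFor]
  intro M N
  exact (P.isSheafFor_iff_glues M N S (.ofSieve S hS)
    (fun V f => ⟨fun h => ⟨f.le, h⟩, fun ⟨_, h⟩ => h⟩)).2 (hE _ _ _)

/-- Descent data for objects are effective. A descent datum is a family of objects `x i` over the
members `V i` of a covering, with isomorphisms `t i j` over each open subset of `V i` and `V j`. -/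
def Effective : Prop :=
  ∀ ⦃I : Type u⦄ ⦃U : Opens X⦄ ⦃V : I → Opens X⦄ (hV : ∀ i, V i ≤ U)
    (_ : ∀ p ∈ U, ∃ i, p ∈ V i) (x : ∀ i, F.fib (V i))
    (t : ∀ i j W (hi : W ≤ V i) (hj : W ≤ V j),
      (⟨P.ι (x i), hi.trans (P.le _)⟩ : At E.dom W) ⟶ ⟨P.ι (x j), hj.trans (P.le _)⟩)
    (_ : ∀ i j W W' (h : W' ≤ W) hi hj,
      E.res h (t i j W hi hj) = t i j W' (h.trans hi) (h.trans hj))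
    (_ : ∀ i W hi, t i i W hi hi = 𝟙 _)
    (_ : ∀ i j k W hi hj hk, t i j W hi hj ≫ t j k W hj hk = t i k W hi hk),
    ∃ (y : F.fib U) (s : ∀ i, (⟨P.ι (x i), P.le _⟩ : At E.dom (V i)) ≅
      ⟨P.ι y, (hV i).trans (P.le y)⟩),
      ∀ i j W hi hj, t i j W hi hj ≫ E.res hj (s j).hom = E.res hi (s i).hom

lemma conj_ofObj {U V V' W : Opens X} (M : F.fib U) (f : V ⟶ U) (f' : V' ⟶ U) (g : W ⟶ V)
    (g' : W ⟶ V') (q : W ⟶ U) :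
    P.conj g g' ((F.mapComp' f.op.toLoc g.op.toLoc q.op.toLoc
      (by rw [← Quiver.Hom.comp_toLoc]; congr 1)).inv.toNatTrans.app M ≫
      (F.mapComp' f'.op.toLoc g'.op.toLoc q.op.toLoc
      (by rw [← Quiver.Hom.comp_toLoc]; congr 1)).hom.toNatTrans.app M) =
    E.res g.le (P.can f M).hom ≫ E.res g'.le (P.can f' M).inv := by
  have e₁ := P.can_comp f g q M
  have e₂ := P.can_comp f' g' q M
  let a := (Cat.Hom.toNatIso (F.mapComp' f.op.toLoc g.op.toLoc q.op.toLoc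
        (by rw [← Quiver.Hom.comp_toLoc]; congr 1))).app M
  let b := (Cat.Hom.toNatIso (F.mapComp' f'.op.toLoc g'.op.toLoc q.op.toLoc
        (by rw [← Quiver.Hom.comp_toLoc]; congr 1))).app M
  let k : (F.res q).obj M ≅ (F.res g).obj ((F.res f).obj M) := a
  let l : (F.res q).obj M ≅ (F.res g').obj ((F.res f').obj M) := b
  replace e₁ : (P.can q M).hom =
    (P.embIso k).hom ≫ (P.can g ((F.res f).obj M)).hom ≫ E.res g.le (P.can f M).hom := e₁
  replace e₂ : (P.can q M).hom =
    (P.embIso l).hom ≫ (P.can g' ((F.res f').obj M)).hom ≫ E.res g'.le (P.can f' M).hom := e₂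
  change P.conj g g' (k.inv ≫ l.hom) = _
  rw [e₁] at e₂
  rw [conj_apply, P.emb_comp]
  change _ ≫ ((P.embIso k).inv ≫ (P.embIso l).hom) ≫ _ = _
  rw [Iso.inv_comp_eq, Category.assoc, Iso.inv_comp_eq, reassoc_of% e₂]
  simp

lemma effective_of_isStackOn (hF : F.IsStackOn) : P.Effective := by
  intro I U V hV cov x t t_res t_self t_comp
  let f (i : I) : V i ⟶ U := homOfLE (hV i)
  have hf : Sieve.ofArrows _ f ∈ Opens.grothendieckTopology X U := by
    intro p hp
    obtain ⟨i, hi⟩ := cov p hp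
    exact ⟨V i, f i, ⟨V i, 𝟙 _, f i, ⟨i⟩, Category.id_comp _⟩, hi⟩
  have := F.isEquivalence_toDescentData f hf
  let D : F.DescentData f :=
    { obj := x
      hom := fun W q i j f₁ f₂ _ _ => (P.conj f₁ f₂).symm (t i j W f₁.le f₂.le)
      pullHom_hom := by
        rintro W' W g q q' hq i j f₁ f₂ hf₁ hf₂ _ _ rfl rfl
        apply (P.conj _ _).injective
        rw [Equiv.apply_symm_apply]
        refine (P.conj_pullHom f₁ f₂ _ g _ _).trans ?_
        rw [Equiv.apply_symm_apply, t_res]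
      hom_self := by
        intro W q i g _
        apply (P.conj _ _).injective
        rw [Equiv.apply_symm_apply, conj_id, t_self]
      hom_comp := by
        intro W q i j k f₁ f₂ f₃ _ _ _
        apply (P.conj _ _).injective
        refine (P.conj_comp f₁ f₂ f₃ _ _).trans ?_
        rw [Equiv.apply_symm_apply, Equiv.apply_symm_apply, Equiv.apply_symm_apply, t_comp] }
  let y := (F.toDescentData f).objPreimage D
  let e : (F.toDescentData f).obj y ≅ D := (F.toDescentData f).objObjPreimageIso D
  let e' (i : I) : (F.res (f i)).obj y ≅ x i :=
    { hom := e.hom.hom i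
      inv := e.inv.hom i
      hom_inv_id := congrArg (fun k => k.hom i) e.hom_inv_id
      inv_hom_id := congrArg (fun k => k.hom i) e.inv_hom_id }
  refine ⟨y, fun i => (P.embIso (e' i)).symm ≪≫ P.can (f i) y, fun i j W hi hj => ?_⟩
  have h₁ := e.hom.comm (homOfLE (hi.trans (hV i))) (homOfLE hi) (homOfLE hj) rfl rfl
  have h₂ := congrArg (P.conj (homOfLE hi) (homOfLE hj)) h₁
  have h₃ := (P.conj_comp _ (homOfLE hi) _ _ _).symm.trans
    (h₂.trans (P.conj_comp _ (homOfLE hj) _ _ _))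
  have h₄ : P.conj (homOfLE hi) (homOfLE hj) (D.hom (homOfLE (hi.trans (hV i))) (homOfLE hi)
    (homOfLE hj) rfl rfl) = t i j W hi hj := Equiv.apply_symm_apply _ _
  have h₅ := P.conj_ofObj y (f i) (f j) (homOfLE hi) (homOfLE hj) (homOfLE (hi.trans (hV i)))
  have h₆ := P.conj_map (homOfLE hi) (e' i).hom
  have h₇ := P.conj_map (homOfLE hj) (e' j).hom
  have h₈ : E.res hi (P.emb (e' i).hom) ≫ t i j W hi hj =
      (E.res hi (P.can (f i) y).hom ≫ E.res hj (P.can (f j) y).inv) ≫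
        E.res hj (P.emb (e' j).hom) := by
    rw [← h₄]
    erw [← h₅, ← h₆, ← h₇]
    exact h₃
  have h₉ : t i j W hi hj = E.res hi (P.embIso (e' i)).inv ≫
      (E.res hi (P.can (f i) y).hom ≫ E.res hj (P.can (f j) y).inv) ≫
        E.res hj (P.embIso (e' j)).hom := by
    rw [embIso_hom, ← h₈, ← embIso_hom, StrictPrestack.res_inv_hom_assoc]
  rw [h₉]
  simp only [Iso.trans_hom, Iso.symm_hom, StrictPrestack.res_comp, Category.assoc,
    StrictPrestack.res_hom_inv_assoc, StrictPrestack.res_inv_hom, Category.comp_id]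

lemma emb_isoOfEmb (P : Presentation F E) {U : Opens X} {x y : F.fib U}
    (e : (⟨P.ι x, P.le x⟩ : At E.dom U) ≅ ⟨P.ι y, P.le y⟩) :
    P.emb (P.isoOfEmb e).hom = e.hom := Equiv.apply_symm_apply _ _

lemma isStackOn (P : Presentation F E) (hE : E.IsSep) (hP : P.Effective) : F.IsStackOn where
  toIsPrestack := P.isSeparated hE
  essSurj_of_sieve := by
    intro U S hS
    let I := S.arrows.category
    let f : ∀ i : I, i.obj.left ⟶ U := fun i => i.obj.hom
    refine ⟨fun D => ?_⟩
    obtain ⟨y, s, hs⟩ := hP (I := I) (U := U) (V := fun i => i.obj.left) (fun i => (f i).le)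
      (fun p hp => by
        obtain ⟨V, g, hg, hpV⟩ := hS p hp
        exact ⟨⟨Over.mk g, hg⟩, hpV⟩)
      D.obj (fun i j W hi hj => P.conj (homOfLE hi) (homOfLE hj)
        (D.hom (homOfLE (hi.trans (f i).le)) (homOfLE hi) (homOfLE hj) rfl rfl))
      (fun i j W W' h hi hj => (P.conj_pullHom (homOfLE hi) (homOfLE hj) _ (homOfLE h) _ _).symm.trans
        (congrArg (P.conj _ _) (D.pullHom_hom (homOfLE h) (homOfLE (hi.trans (f i).le)) _ rfl
          (homOfLE hi) (homOfLE hj) rfl rfl _ _ rfl rfl)))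
      (fun i W hi => (congrArg (P.conj _ _) (D.hom_self _ (homOfLE hi) rfl)).trans (P.conj_id _))
      (fun i j k W hi hj hk => (P.conj_comp _ _ _ _ _).symm.trans
        (congrArg (P.conj _ _) (D.hom_comp _ (homOfLE hi) (homOfLE hj) (homOfLE hk) rfl rfl rfl)))
    refine ⟨y, ⟨Pseudofunctor.DescentData.isoMk
      (fun i => P.isoOfEmb (P.can (f i) y ≪≫ (s i).symm)) ?_⟩⟩
    intro W q i j f₁ f₂ hf₁ hf₂
    apply (P.conj f₁ f₂).injective
    refine (P.conj_comp f₁ f₁ f₂ _ _).trans (Eq.trans ?_ (P.conj_comp f₁ f₂ f₂ _ _).symm)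
    have h₁ := hs i j W f₁.le f₂.le
    have h₅ := P.conj_ofObj y (f i) (f j) f₁ f₂ q
    have h₆ := P.conj_map f₁ (P.isoOfEmb (P.can (f i) y ≪≫ (s i).symm)).hom
    have h₇ := P.conj_map f₂ (P.isoOfEmb (P.can (f j) y ≪≫ (s j).symm)).hom
    rw [P.emb_isoOfEmb] at h₆ h₇
    have h₈ : P.conj f₁ f₂ (D.hom q f₁ f₂ hf₁ hf₂) =
        E.res f₁.le (s i).hom ≫ E.res f₂.le (s j).inv := by
      refine Eq.trans ?_ (congrArg (fun k => k ≫ E.res f₂.le (s j).inv) h₁)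
      refine Eq.trans ?_ (Category.assoc _ _ _).symm
      rw [StrictPrestack.res_hom_inv, Category.comp_id]
      rfl
    refine (congrArg₂ (fun a b => a ≫ b) h₆ h₈).trans (Eq.trans ?_
      (congrArg₂ (fun a b => a ≫ b) h₅ h₇).symm)
    simp

end Presentation

/-- Morphisms of the strict prestack of a separated prestack glue. -/
lemma Prestack.strict_isSep {F : Prestack X} (hF : F.IsSeparated) : F.strict.IsSep := by
  intro W x y hx hy S
  exact (F.pres.glues_of_isSeparated hF ((F.res (homOfLE hx)).obj x.2)
    ((F.res (homOfLE hy)).obj y.2) S).of_iso (F.pres.can _ _) (F.pres.can _ _)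

/-! ### Functors of prestacks and maps of strict prestacks -/

/-- A map of strict prestacks, strictly compatible with restriction. -/
structure StrictPrestack.Map (E E' : StrictPrestack X) where
  /-- the action on objects -/
  ob : E.Ob → E'.Ob
  le (x : E.Ob) : E.dom x ≤ E'.dom (ob x)
  /-- the action on morphisms -/
  map {W : Opens X} {x y : E.Ob} {hx : W ≤ E.dom x} {hy : W ≤ E.dom y}
    (f : (⟨x, hx⟩ : At E.dom W) ⟶ ⟨y, hy⟩) :
    (⟨ob x, hx.trans (le x)⟩ : At E'.dom W) ⟶ ⟨ob y, hy.trans (le y)⟩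
  map_id {W : Opens X} {x : E.Ob} (hx : W ≤ E.dom x) : map (𝟙 (⟨x, hx⟩ : At E.dom W)) = 𝟙 _
  map_comp {W : Opens X} {x y z : E.Ob} {hx : W ≤ E.dom x} {hy : W ≤ E.dom y} {hz : W ≤ E.dom z}
    (f : (⟨x, hx⟩ : At E.dom W) ⟶ ⟨y, hy⟩) (g : (⟨y, hy⟩ : At E.dom W) ⟶ ⟨z, hz⟩) :
    map (f ≫ g) = map f ≫ map g
  map_res {W W' : Opens X} (h : W' ≤ W) {x y : E.Ob} {hx : W ≤ E.dom x} {hy : W ≤ E.dom y}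
    (f : (⟨x, hx⟩ : At E.dom W) ⟶ ⟨y, hy⟩) : map (E.res h f) = E'.res h (map f)

namespace StrictPrestack.Map

variable {E E' : StrictPrestack X} (T : E.Map E')

/-- The action on isomorphisms. -/
@[simps]
def mapIso {W : Opens X} {x y : E.Ob} {hx : W ≤ E.dom x} {hy : W ≤ E.dom y}
    (f : (⟨x, hx⟩ : At E.dom W) ≅ ⟨y, hy⟩) :
    (⟨T.ob x, hx.trans (T.le x)⟩ : At E'.dom W) ≅ ⟨T.ob y, hy.trans (T.le y)⟩ where
  hom := T.map f.hom
  inv := T.map f.inv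
  hom_inv_id := by rw [← map_comp, f.hom_inv_id, map_id]
  inv_hom_id := by rw [← map_comp, f.inv_hom_id, map_id]

end StrictPrestack.Map

lemma Presentation.can_comp' {F : Prestack X} {E : StrictPrestack X} (P : Presentation F E)
    {U V W : Opens X} (f : V ⟶ U) (g : W ⟶ V) (x : F.fib U) :
    (P.can (g ≫ f) x).hom =
      P.emb ((F.mapComp f.op.toLoc g.op.toLoc).hom.toNatTrans.app x) ≫
      (P.can g ((F.res f).obj x)).hom ≫ E.res g.le (P.can f x).hom := by
  refine (P.can_comp f g (g ≫ f) x).trans ?_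
  exact congrArg (fun a => P.emb (a.hom.toNatTrans.app x) ≫
      (P.can g ((F.res f).obj x)).hom ≫ E.res g.le (P.can f x).hom)
    (F.mapComp'_eq_mapComp f.op.toLoc g.op.toLoc)

/-- Constructor for functors of prestacks. -/
def Prestack.homMk {F G : Prestack X} (φ : ∀ U : Opens X, F.fib U ⥤ G.fib U)
    (ν : ∀ {U V : Opens X} (f : V ⟶ U) (x : F.fib U),
      (φ V).obj ((F.res f).obj x) ≅ (G.res f).obj ((φ U).obj x))
    (ν_nat : ∀ {U V : Opens X} (f : V ⟶ U) {x y : F.fib U} (g : x ⟶ y),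
      (φ V).map ((F.res f).map g) ≫ (ν f y).hom = (ν f x).hom ≫ (G.res f).map ((φ U).map g))
    (ν_id : ∀ {U : Opens X} (x : F.fib U),
      (ν (𝟙 U) x).hom ≫ (G.mapIdApp ((φ U).obj x)).hom = (φ U).map (F.mapIdApp x).hom)
    (ν_comp : ∀ {U V W : Opens X} (f : V ⟶ U) (g : W ⟶ V) (x : F.fib U),
      (ν (g ≫ f) x).hom ≫
        (G.mapComp f.op.toLoc g.op.toLoc).hom.toNatTrans.app ((φ U).obj x) =
      (φ W).map ((F.mapComp f.op.toLoc g.op.toLoc).hom.toNatTrans.app x) ≫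
        (ν g ((F.res f).obj x)).hom ≫ (G.res g).map (ν f x).hom) : F ⟶ G where
  app a := (φ a.as.unop).toCatHom
  naturality {a b} f := Cat.Hom.isoMk (NatIso.ofComponents
    (fun x => ν f.as.unop x) (fun {x y} g => ν_nat f.as.unop g))
  naturality_naturality {a b f g} η := by
    obtain rfl := obj_ext_of_isDiscrete η
    obtain rfl : η = 𝟙 _ := Subsingleton.elim _ _
    rw [PrelaxFunctor.map₂_id, PrelaxFunctor.map₂_id]
    exact ((congrArg (fun k => k ≫ _) (Bicategory.id_whiskerRight _ _)).trans
      (Category.id_comp _)).trans ((congrArg (fun k => _ ≫ k)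
        (Bicategory.whiskerLeft_id _ _)).trans (Category.comp_id _)).symm
  naturality_id a := by
    ext x
    refine (ν_id x).trans ?_
    symm
    refine (congrArg (fun k => _ ≫ k) (Category.comp_id _)).trans (Category.comp_id _)
  naturality_comp {a b c} f g := by
    ext x
    refine (ν_comp f.as.unop g.as.unop x).trans ?_
    symm
    refine congrArg (fun k => _ ≫ k) ?_
    refine (Category.id_comp _).trans (congrArg (fun k => _ ≫ k) ?_)
    exact (Category.id_comp _).trans (Category.comp_id _)

section mkTrans

variable {F G : Prestack X} {E E' : StrictPrestack X} (P : Presentation F E)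
  (Q : Presentation G E') (T : E.Map E') (β : ∀ {U : Opens X}, F.fib U → G.fib U)
  (d : ∀ {U : Opens X} (x : F.fib U), (⟨Q.ι (β x), Q.le (β x)⟩ : At E'.dom U) ≅
    ⟨T.ob (P.ι x), (P.le x).trans (T.le _)⟩)

/-- The action on morphisms of the functor attached to a map of strict prestacks. -/
def mkTransMap {U : Opens X} {x y : F.fib U} (g : x ⟶ y) : β x ⟶ β y :=
  Q.emb.symm ((d x).hom ≫ T.map (P.emb g) ≫ (d y).inv)

lemma emb_mkTransMap {U : Opens X} {x y : F.fib U} (g : x ⟶ y) :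
    Q.emb (mkTransMap P Q T β d g) = (d x).hom ≫ T.map (P.emb g) ≫ (d y).inv :=
  Equiv.apply_symm_apply _ _

/-- The compatibility with restrictions of the functor attached to a map of strict prestacks. -/
def mkTransIso {U V : Opens X} (f : V ⟶ U) (x : F.fib U) :
    β ((F.res f).obj x) ≅ (G.res f).obj (β x) :=
  Q.isoOfEmb (d ((F.res f).obj x) ≪≫ T.mapIso (P.can f x) ≪≫ (E'.resIso f.le (d x)).symm ≪≫
    (Q.can f (β x)).symm)

lemma emb_mkTransIso {U V : Opens X} (f : V ⟶ U) (x : F.fib U) :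
    Q.emb (mkTransIso P Q T β d f x).hom = (d ((F.res f).obj x)).hom ≫ T.map (P.can f x).hom ≫
      E'.res f.le (d x).inv ≫ (Q.can f (β x)).inv :=
  (Q.emb_isoOfEmb _).trans (by simp)

lemma mkTransIso_naturality {U V : Opens X} (f : V ⟶ U) {x y : F.fib U} (g : x ⟶ y) :
    mkTransMap P Q T β d ((F.res f).map g) ≫ (mkTransIso P Q T β d f y).hom =
      (mkTransIso P Q T β d f x).hom ≫ (G.res f).map (mkTransMap P Q T β d g) := by
  apply Q.emb.injective
  rw [Q.emb_comp, Q.emb_comp, emb_mkTransIso, emb_mkTransIso, emb_mkTransMap,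
    ← cancel_mono (Q.can f (β y)).hom]
  have e := Q.emb_res f (mkTransMap P Q T β d g)
  rw [emb_mkTransMap] at e
  have e' := congrArg T.map (P.emb_res f g)
  rw [T.map_comp, T.map_comp, T.map_res] at e'
  simp [e, reassoc_of% e']

lemma mkTransIso_id {U : Opens X} (x : F.fib U) :
    (mkTransIso P Q T β d (𝟙 U) x).hom ≫ (G.mapIdApp (β x)).hom =
      mkTransMap P Q T β d (F.mapIdApp x).hom := by
  apply Q.emb.injective
  have e : Q.emb (G.mapIdApp (β x)).hom = _ := (Q.can_id (β x)).symm
  have e' : P.emb (F.mapIdApp x).hom = _ := (P.can_id x).symm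
  rw [Q.emb_comp, emb_mkTransIso, emb_mkTransMap, e, e']
  simp

lemma mkTransIso_comp {U V W : Opens X} (f : V ⟶ U) (g : W ⟶ V) (x : F.fib U) :
    (mkTransIso P Q T β d (g ≫ f) x).hom ≫
      (G.mapComp f.op.toLoc g.op.toLoc).hom.toNatTrans.app (β x) =
    mkTransMap P Q T β d ((F.mapComp f.op.toLoc g.op.toLoc).hom.toNatTrans.app x) ≫
      (mkTransIso P Q T β d g ((F.res f).obj x)).hom ≫
      (G.res g).map (mkTransIso P Q T β d f x).hom := by
  have e := Q.emb_res g (mkTransIso P Q T β d f x).hom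
  rw [emb_mkTransIso] at e
  have e₁ := Q.can_comp' f g (β x)
  have e₂ := congrArg T.map (P.can_comp' f g x)
  rw [T.map_comp, T.map_comp, T.map_res] at e₂
  let m : (G.res (g ≫ f)).obj (β x) ⟶ (G.res g).obj ((G.res f).obj (β x)) :=
    (G.mapComp f.op.toLoc g.op.toLoc).hom.toNatTrans.app (β x)
  let n : (F.res (g ≫ f)).obj x ⟶ (F.res g).obj ((F.res f).obj x) :=
    (F.mapComp f.op.toLoc g.op.toLoc).hom.toNatTrans.app x
  replace e₁ : (Q.can (g ≫ f) (β x)).hom = Q.emb m ≫ _ := e₁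
  replace e₂ : T.map (P.can (g ≫ f) x).hom = T.map (P.emb n) ≫ _ := e₂
  change (mkTransIso P Q T β d (g ≫ f) x).hom ≫ m = mkTransMap P Q T β d n ≫ _
  apply Q.emb.injective
  have e₃ : (Q.can (g ≫ f) (β x)).inv ≫ Q.emb m =
      E'.res g.le (Q.can f (β x)).inv ≫ (Q.can g ((G.res f).obj (β x))).inv := by
    rw [Iso.inv_comp_eq, e₁]
    simp
  rw [← cancel_mono (Q.can g ((G.res f).obj (β x))).hom]
  simp only [Q.emb_comp, emb_mkTransIso, emb_mkTransMap, Category.assoc, e, e₂]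
  rw [reassoc_of% e₃]
  simp

/-- The functor of prestacks attached to a map of strict prestacks. -/
def mkTrans : F ⟶ G :=
  Prestack.homMk
    (fun U =>
      { obj := fun x => β x
        map := fun {x y} g => mkTransMap P Q T β d g
        map_id := fun x => Q.emb.injective (by simp [P.emb_id, Q.emb_id, T.map_id, emb_mkTransMap])
        map_comp := fun f g => Q.emb.injective
          (by simp [P.emb_comp, Q.emb_comp, T.map_comp, emb_mkTransMap]) })
    (fun f x => mkTransIso P Q T β d f x)
    (fun f _ _ g => mkTransIso_naturality P Q T β d f g)
    (fun x => mkTransIso_id P Q T β d x)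
    (fun f g x => mkTransIso_comp P Q T β d f g x)

end mkTrans

/-! ### The map of strict prestacks attached to a functor -/

section resIso

variable {F G H : Prestack X} (η : F ⟶ G)

lemma resIso_naturality {U V : Opens X} (f : V ⟶ U) {x y : F.fib U} (g : x ⟶ y) :
    (onFib η V).map ((F.res f).map g) ≫ (resIso η f y).hom =
      (resIso η f x).hom ≫ (G.res f).map ((onFib η U).map g) :=
  (Cat.Hom.toNatIso (η.naturality f.op.toLoc)).hom.naturality g

lemma resIso_id {U : Opens X} (x : F.fib U) :
    (resIso η (𝟙 U) x).hom ≫ (G.mapIdApp ((onFib η U).obj x)).hom =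
      (onFib η U).map (F.mapIdApp x).hom := by
  refine (congrArg (fun k => k.toNatTrans.app x) (η.naturality_id (.mk (op U)))).trans ?_
  refine (congrArg (fun k => _ ≫ k) (Category.comp_id _)).trans (Category.comp_id _)

lemma resIso_comp {U V W : Opens X} (f : V ⟶ U) (g : W ⟶ V) (x : F.fib U) :
    (resIso η (g ≫ f) x).hom ≫
      (G.mapComp f.op.toLoc g.op.toLoc).hom.toNatTrans.app ((onFib η U).obj x) =
    (onFib η W).map ((F.mapComp f.op.toLoc g.op.toLoc).hom.toNatTrans.app x) ≫
      (resIso η g ((F.res f).obj x)).hom ≫ (G.res g).map (resIso η f x).hom := by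
  refine (congrArg (fun k => k.toNatTrans.app x)
    (η.naturality_comp f.op.toLoc g.op.toLoc)).trans ?_
  refine congrArg (fun k => _ ≫ k) ?_
  refine (Category.id_comp _).trans (congrArg (fun k => _ ≫ k) ?_)
  exact (Category.id_comp _).trans (Category.comp_id _)

lemma resIso_comp' {U V W : Opens X} (f : V ⟶ U) (g : W ⟶ V) (h : W ⟶ U) (x : F.fib U) :
    (resIso η h x).hom ≫
      (G.mapComp' f.op.toLoc g.op.toLoc h.op.toLoc
        (by rw [← Quiver.Hom.comp_toLoc]; congr 1)).hom.toNatTrans.app ((onFib η U).obj x) =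
    (onFib η W).map ((F.mapComp' f.op.toLoc g.op.toLoc h.op.toLoc
        (by rw [← Quiver.Hom.comp_toLoc]; congr 1)).hom.toNatTrans.app x) ≫
      (resIso η g ((F.res f).obj x)).hom ≫ (G.res g).map (resIso η f x).hom := by
  obtain rfl : h = g ≫ f := Subsingleton.elim _ _
  refine (congrArg (fun k => _ ≫ k.hom.toNatTrans.app ((onFib η U).obj x))
    (G.mapComp'_eq_mapComp f.op.toLoc g.op.toLoc)).trans ((resIso_comp η f g x).trans ?_)
  exact congrArg (fun k => (onFib η W).map (k.hom.toNatTrans.app x) ≫ _)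
    (F.mapComp'_eq_mapComp f.op.toLoc g.op.toLoc).symm

lemma resIso_vcomp (θ : G ⟶ H) {U V : Opens X} (f : V ⟶ U) (x : F.fib U) :
    (resIso (η ≫ θ) f x).hom =
      (onFib θ V).map (resIso η f x).hom ≫ (resIso θ f ((onFib η U).obj x)).hom := by
  refine (Category.id_comp _).trans (congrArg (fun k => _ ≫ k) ?_)
  exact (Category.id_comp _).trans (Category.comp_id _)

end resIso

section toStrict

open Pseudofunctor.LocallyDiscreteOpToCat

variable {F G H : Prestack X} (η : F ⟶ G)

/-- The action of a functor of prestacks on a morphism from `x|_V` to `y|_V`. -/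
def onHom {U U' V : Opens X} {x : F.fib U} {y : F.fib U'} (f : V ⟶ U) (f' : V ⟶ U')
    (g : (F.res f).obj x ⟶ (F.res f').obj y) :
    (G.res f).obj ((onFib η U).obj x) ⟶ (G.res f').obj ((onFib η U').obj y) :=
  (resIso η f x).inv ≫ (onFib η V).map g ≫ (resIso η f' y).hom

lemma onHom_pullHom {U U' V W : Opens X} {x : F.fib U} {y : F.fib U'} (f : V ⟶ U) (f' : V ⟶ U')
    (g : (F.res f).obj x ⟶ (F.res f').obj y) (k : W ⟶ V) (h : W ⟶ U) (h' : W ⟶ U') :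
    onHom η h h' (pullHom g k h h' rfl rfl) = pullHom (onHom η f f' g) k h h' rfl rfl := by
  have e₁ := resIso_comp' η f k h x
  have e₂ := resIso_comp' η f' k h' y
  let a : (F.res h).obj x ≅ (F.res k).obj ((F.res f).obj x) :=
    (Cat.Hom.toNatIso (F.mapComp' f.op.toLoc k.op.toLoc h.op.toLoc
      (by rw [← Quiver.Hom.comp_toLoc]; congr 1))).app x
  let b : (F.res h').obj y ≅ (F.res k).obj ((F.res f').obj y) :=
    (Cat.Hom.toNatIso (F.mapComp' f'.op.toLoc k.op.toLoc h'.op.toLoc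
      (by rw [← Quiver.Hom.comp_toLoc]; congr 1))).app y
  let a' : (G.res h).obj ((onFib η U).obj x) ≅ (G.res k).obj ((G.res f).obj ((onFib η U).obj x)) :=
    (Cat.Hom.toNatIso (G.mapComp' f.op.toLoc k.op.toLoc h.op.toLoc
      (by rw [← Quiver.Hom.comp_toLoc]; congr 1))).app _
  let b' : (G.res h').obj ((onFib η U').obj y) ≅
      (G.res k).obj ((G.res f').obj ((onFib η U').obj y)) :=
    (Cat.Hom.toNatIso (G.mapComp' f'.op.toLoc k.op.toLoc h'.op.toLoc
      (by rw [← Quiver.Hom.comp_toLoc]; congr 1))).app _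
  change onHom η h h' (a.hom ≫ (F.res k).map g ≫ b.inv) =
    a'.hom ≫ (G.res k).map (onHom η f f' g) ≫ b'.inv
  replace e₁ : (resIso η h x).hom ≫ a'.hom = (onFib η W).map a.hom ≫ _ := e₁
  replace e₂ : (resIso η h' y).hom ≫ b'.hom = (onFib η W).map b.hom ≫ _ := e₂
  rw [← cancel_mono b'.hom, ← cancel_epi (resIso η h x).hom]
  simp only [onHom, Category.assoc, Iso.hom_inv_id_assoc, Functor.map_comp, Iso.inv_hom_id,
    Category.comp_id, e₂]
  rw [reassoc_of% e₁]
  simp only [Iso.map_hom_inv_id_assoc, Iso.map_inv_hom_id_assoc]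
  rw [reassoc_of% (resIso_naturality η k g)]

/-- A functor of prestacks acts on the associated strict prestacks. -/
def toStrict : F.strict.Map G.strict where
  ob x := ⟨x.1, (onFib η x.1).obj x.2⟩
  le _ := le_rfl
  map {W x y hx hy} f := onHom η (homOfLE hx) (homOfLE hy) f
  map_id {W x} hx := by
    refine (congrArg (fun k => _ ≫ k ≫ _) (CategoryTheory.Functor.map_id _ _)).trans ?_
    refine (congrArg (fun k => _ ≫ k) (Category.id_comp _)).trans (Iso.inv_hom_id _)
  map_comp {W x y z hx hy hz} f g := by
    refine (congrArg (fun k => _ ≫ k ≫ _) (Functor.map_comp _ _ _)).trans ?_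
    symm
    refine (Category.assoc _ _ _).trans (congrArg (fun k => _ ≫ k) ?_)
    refine (Category.assoc _ _ _).trans ((congrArg (fun k => _ ≫ k) ?_).trans
      (Category.assoc _ _ _).symm)
    exact Iso.hom_inv_id_assoc _ _
  map_res {W W'} h {x y hx hy} f := onHom_pullHom η (homOfLE hx) (homOfLE hy) f _ _ _

lemma toStrict_emb {U : Opens X} {x y : F.fib U} (g : x ⟶ y) :
    (toStrict η).map (F.pres.emb g) = G.pres.emb ((onFib η U).map g) := by
  refine (Iso.inv_comp_eq _).2 ?_
  exact resIso_naturality η (𝟙 U) g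

lemma toStrict_can {U V : Opens X} (f : V ⟶ U) (x : F.fib U) :
    (toStrict η).map (F.pres.can f x).hom =
      G.pres.emb (resIso η f x).hom ≫ (G.pres.can f ((onFib η U).obj x)).hom := by
  refine ((Iso.inv_comp_eq _).2 ?_).trans (G.mapIdApp_naturality (resIso η f x).hom).symm
  exact ((Category.assoc _ _ _).symm.trans
    (congrArg (fun k => k ≫ (resIso η f x).hom) (resIso_id η ((F.res f).obj x)))).symm

/-- Morphisms over `W` of the strict prestack of `F`, in terms of the presentation of `F`. -/
lemma Prestack.strict_hom_eq {W : Opens X} {x y : F.strict.Ob} {hx : W ≤ F.strict.dom x}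
    {hy : W ≤ F.strict.dom y} (f : (⟨x, hx⟩ : At F.strict.dom W) ⟶ ⟨y, hy⟩) :
    f = (F.pres.can (homOfLE hx) x.2).inv ≫
      F.pres.emb (show (F.res (homOfLE hx)).obj x.2 ⟶ (F.res (homOfLE hy)).obj y.2 from f) ≫
      (F.pres.can (homOfLE hy) y.2).hom := by
  refine ((Iso.inv_comp_eq _).2 ?_).symm
  exact F.mapIdApp_naturality _

lemma StrictPrestack.Map.map_strict_eq {E : StrictPrestack X} (T : F.strict.Map E) {W : Opens X}
    {x y : F.strict.Ob} {hx : W ≤ F.strict.dom x} {hy : W ≤ F.strict.dom y}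
    (f : (⟨x, hx⟩ : At F.strict.dom W) ⟶ ⟨y, hy⟩) :
    T.map f = T.map (F.pres.can (homOfLE hx) x.2).inv ≫
      T.map (F.pres.emb (show (F.res (homOfLE hx)).obj x.2 ⟶ (F.res (homOfLE hy)).obj y.2 from f)) ≫
      T.map (F.pres.can (homOfLE hy) y.2).hom :=
  (congrArg T.map (F.strict_hom_eq f)).trans ((T.map_comp _ _).trans
    (congrArg (fun k => _ ≫ k) (T.map_comp _ _)))

/-- An identity for a pasting of isomorphisms.
Stated in an abstract category, so as to apply to morphisms whose types agree only after
unfolding. -/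
lemma comp_eq_conj_comp {C : Type*} [Category* C] {a b c d e f : C} (i : a ≅ b) (j : b ≅ c)
    (k : a ⟶ d) (l : d ⟶ e) (m : e ⟶ f) :
    k ≫ l ≫ m = (i.hom ≫ j.hom) ≫ j.inv ≫ (i.inv ≫ k ≫ l) ≫ m := by
  simp

lemma onHom_vcomp (θ : G ⟶ H) {U U' V : Opens X} {x : F.fib U} {y : F.fib U'} (f : V ⟶ U)
    (f' : V ⟶ U') (g : (F.res f).obj x ⟶ (F.res f').obj y) :
    onHom (η ≫ θ) f f' g = onHom θ f f' (onHom η f f' g) := by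
  have e := resIso_vcomp η θ f x
  have e' := resIso_vcomp η θ f' y
  refine (Iso.inv_comp_eq _).2 ?_
  refine (congrArg (fun k => _ ≫ k) e').trans (Eq.trans ?_ (congrArg (fun k => k ≫ _) e).symm)
  have e₂ : onHom θ f f' (onHom η f f' g) = (resIso θ f _).inv ≫
      ((onFib θ V).map (resIso η f x).inv ≫ (onFib θ V).map ((onFib η V).map g) ≫
        (onFib θ V).map (resIso η f' y).hom) ≫ (resIso θ f' _).hom := by
    simp [onHom]
  rw [e₂]
  exact comp_eq_conj_comp ((onFib θ V).mapIso (resIso η f x)) (resIso θ f _) _ _ _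

lemma toStrict_vcomp (θ : G ⟶ H) {W : Opens X} {x y : F.strict.Ob} {hx : W ≤ F.strict.dom x}
    {hy : W ≤ F.strict.dom y} (f : (⟨x, hx⟩ : At F.strict.dom W) ⟶ ⟨y, hy⟩) :
    (toStrict (η ≫ θ)).map f = (toStrict θ).map ((toStrict η).map f) :=
  onHom_vcomp η θ (homOfLE hx) (homOfLE hy) f

end toStrict

/-! ### Modifications, in terms of strict prestacks -/

section modification

/-- Transport of an equality along a commutative square.
Stated in an abstract category, so as to apply to morphisms whose types agree only after
unfolding. -/
lemma comp_eq_comp_iff_of_square {C : Type*} [Category* C] {a a' b b' c c' : C} {r : a ⟶ b}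
    {k : b ⟶ c} {s : c ⟶ c'} {n : a ⟶ a'} {r' : a' ⟶ b'} {k' : b' ⟶ c'} {t : b ⟶ b'} [Mono k']
    (h : t ≫ k' = k ≫ s) : (r ≫ k) ≫ s = n ≫ r' ≫ k' ↔ n ≫ r' = r ≫ t := by
  rw [← cancel_mono k', Category.assoc, Category.assoc, Category.assoc, h]
  exact eq_comm

/-- Pasting of three commutative squares, the first one being inverted.
Stated in an abstract category, so as to apply to morphisms whose types agree only after
unfolding. -/
lemma square_conj {C : Type*} [Category* C] {a a' b b' c c' d d' : C} (e : b ≅ a) (g : b ⟶ c)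
    (k : c ⟶ d) (e' : b' ≅ a') (g' : b' ⟶ c') (k' : c' ⟶ d') (n : a ⟶ a') (n₁ : b ⟶ b')
    (n₂ : c ⟶ c') (n₃ : d ⟶ d') (h₁ : e.hom ≫ n = n₁ ≫ e'.hom) (h₂ : g ≫ n₂ = n₁ ≫ g')
    (h₃ : k ≫ n₃ = n₂ ≫ k') : (e.inv ≫ g ≫ k) ≫ n₃ = n ≫ e'.inv ≫ g' ≫ k' := by
  rw [Category.assoc, Iso.inv_comp_eq, Category.assoc, h₃, reassoc_of% h₂, reassoc_of% h₁,
    Iso.hom_inv_id_assoc]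

variable {F G : Prestack X} {η θ : F ⟶ G}

/-- Compatibility of a family of morphisms with those of the strict prestack. -/
def StrictNatural (n : ∀ {U : Opens X} (x : F.fib U), (onFib η U).obj x ⟶ (onFib θ U).obj x) :
    Prop :=
  ∀ {W : Opens X} {x y : F.strict.Ob} {hx : W ≤ F.strict.dom x} {hy : W ≤ F.strict.dom y}
      (f : (⟨x, hx⟩ : At F.strict.dom W) ⟶ ⟨y, hy⟩),
      (toStrict η).map f ≫ G.strict.res hy (G.pres.emb (n y.2)) =
        G.strict.res hx (G.pres.emb (n x.2)) ≫ (toStrict θ).map f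

variable {n : ∀ {U : Opens X} (x : F.fib U), (onFib η U).obj x ⟶ (onFib θ U).obj x}

lemma StrictNatural.naturality (hn : StrictNatural n) {U : Opens X} {x y : F.fib U} (g : x ⟶ y) :
    (onFib η U).map g ≫ n y = n x ≫ (onFib θ U).map g := by
  apply G.pres.emb.injective
  rw [G.pres.emb_comp, G.pres.emb_comp, ← toStrict_emb, ← toStrict_emb]
  refine (congrArg (fun k => _ ≫ k) (G.strict.res_self le_rfl _)).symm.trans
    ((hn (F.pres.emb g)).trans ?_)
  exact congrArg (fun k => k ≫ _) (G.strict.res_self le_rfl _)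

lemma StrictNatural.restrict (hn : StrictNatural n) {U V : Opens X} (f : V ⟶ U) (x : F.fib U) :
    n ((F.res f).obj x) ≫ (resIso θ f x).hom = (resIso η f x).hom ≫ (G.res f).map (n x) := by
  apply G.pres.emb.injective
  have e := hn (F.pres.can f x).hom
  have e₁ : (toStrict η).map (F.pres.can f x).hom ≫ G.strict.res f.le (G.pres.emb (n x)) =
      G.pres.emb (n ((F.res f).obj x)) ≫ (toStrict θ).map (F.pres.can f x).hom :=
    e.trans (congrArg (fun k => k ≫ _) (G.strict.res_self le_rfl _))
  rw [toStrict_can, toStrict_can] at e₁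
  rw [G.pres.emb_comp, G.pres.emb_comp]
  exact (comp_eq_comp_iff_of_square (G.pres.emb_res f (n x))).1 e₁

/-- A modification, from a family of morphisms which is natural for the morphisms of the strict
prestack. -/
def modOfStrict (hn : StrictNatural n) : η ⟶ θ where
  as :=
    { app := fun a => NatTrans.toCatHom₂
        { app := fun x => n (U := a.as.unop) x
          naturality := fun x y g => hn.naturality g }
      naturality := fun {a b} f => by
        ext x
        exact hn.restrict f.as.unop x }

/-- The component at `x` of a modification. -/
def modApp (m : η ⟶ θ) {U : Opens X} (x : F.fib U) : (onFib η U).obj x ⟶ (onFib θ U).obj x :=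
  (m.as.app (.mk (op U))).toNatTrans.app x

lemma mod_ext {m m' : η ⟶ θ} (h : ∀ {U : Opens X} (x : F.fib U), modApp m x = modApp m' x) :
    m = m' := by
  ext a x
  exact h (U := a.as.unop) x

lemma modApp_strictNatural (m : η ⟶ θ) : StrictNatural (modApp m) := by
  intro W x y hx hy f
  have h₁ {U V : Opens X} (f : V ⟶ U) (x : F.fib U) :
    modApp m ((F.res f).obj x) ≫ (resIso θ f x).hom = (resIso η f x).hom ≫
      (G.res f).map (modApp m x) :=
    congrArg (fun k => k.toNatTrans.app x) (m.as.naturality f.op.toLoc)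
  have h₂ {U : Opens X} {x y : F.fib U} (g : x ⟶ y) :
      (onFib η U).map g ≫ modApp m y = modApp m x ≫ (onFib θ U).map g :=
    (m.as.app (.mk (op U))).toNatTrans.naturality g
  have h₃ {U V : Opens X} (f : V ⟶ U) (x : F.fib U) :
      (toStrict η).map (F.pres.can f x).hom ≫ G.strict.res f.le (G.pres.emb (modApp m x)) =
      G.pres.emb (modApp m ((F.res f).obj x)) ≫ (toStrict θ).map (F.pres.can f x).hom := by
    rw [toStrict_can, toStrict_can]
    refine (comp_eq_comp_iff_of_square (G.pres.emb_res f (modApp m x))).2 ?_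
    exact (G.pres.emb_comp _ _).symm.trans ((congrArg _ (h₁ f x)).trans (G.pres.emb_comp _ _))
  have h₄ {U : Opens X} {x y : F.fib U} (g : x ⟶ y) :
      (toStrict η).map (F.pres.emb g) ≫ G.pres.emb (modApp m y) =
        G.pres.emb (modApp m x) ≫ (toStrict θ).map (F.pres.emb g) := by
    rw [toStrict_emb, toStrict_emb]
    exact (G.pres.emb_comp _ _).symm.trans ((congrArg _ (h₂ g)).trans (G.pres.emb_comp _ _))
  refine (congrArg (fun k => k ≫ _) ((toStrict η).map_strict_eq f)).trans (Eq.trans ?_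
    (congrArg (fun k => _ ≫ k) ((toStrict θ).map_strict_eq f)).symm)
  exact square_conj ((toStrict η).mapIso (F.pres.can (homOfLE hx) x.2)) _ _
    ((toStrict θ).mapIso (F.pres.can (homOfLE hx) x.2)) _ _ _ _ _ _ (h₃ _ _) (h₄ _) (h₃ _ _)

end modification

/-! ### Extension of functors along a local equivalence -/

namespace StrictPrestack

/-- Descent data for objects of a strict prestack are effective. -/
def Effective (E : StrictPrestack X) : Prop :=
  ∀ ⦃J : Type u⦄ ⦃U : Opens X⦄ ⦃V : J → Opens X⦄ (hV : ∀ j, V j ≤ U)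
    (_ : ∀ p ∈ U, ∃ j, p ∈ V j) (x : J → E.Ob) (hx : ∀ j, V j ≤ E.dom (x j))
    (t : ∀ i j W (hi : W ≤ V i) (hj : W ≤ V j),
      (⟨x i, hi.trans (hx i)⟩ : At E.dom W) ⟶ ⟨x j, hj.trans (hx j)⟩)
    (_ : ∀ i j W W' (h : W' ≤ W) hi hj,
      E.res h (t i j W hi hj) = t i j W' (h.trans hi) (h.trans hj))
    (_ : ∀ i W hi, t i i W hi hi = 𝟙 _)
    (_ : ∀ i j k W hi hj hk, t i j W hi hj ≫ t j k W hj hk = t i k W hi hk),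
    ∃ (y : E.Ob) (hy : U ≤ E.dom y) (s : ∀ i, (⟨x i, hx i⟩ : At E.dom (V i)) ≅
      ⟨y, (hV i).trans hy⟩),
      ∀ i j W hi hj, t i j W hi hj ≫ E.res hj (s j).hom = E.res hi (s i).hom

namespace Map

variable {EF EA EC : StrictPrestack X} (I : EF.Map EA)

/-- The map is bijective on morphisms. -/
def FullyFaithful : Prop :=
  ∀ ⦃W : Opens X⦄ ⦃x y : EF.Ob⦄ (hx : W ≤ EF.dom x) (hy : W ≤ EF.dom y),
    Function.Bijective (I.map : ((⟨x, hx⟩ : At EF.dom W) ⟶ ⟨y, hy⟩) → _)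

/-- Every object is locally isomorphic to an object in the image. -/
def LocallySurjective : Prop :=
  ∀ (a : EA.Ob), ∀ x ∈ EA.dom a, ∃ (V : Opens X) (ha : V ≤ EA.dom a) (p : EF.Ob)
    (hp : V ≤ EF.dom p), x ∈ V ∧
      Nonempty ((⟨a, ha⟩ : At EA.dom V) ≅ ⟨I.ob p, hp.trans (I.le p)⟩)

section preim

variable {I} (hI : I.FullyFaithful) {W : Opens X} {x y z : EF.Ob} {hx : W ≤ EF.dom x}
  {hy : W ≤ EF.dom y} {hz : W ≤ EF.dom z}

/-- The preimage of a morphism. -/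
def preim (f : (⟨I.ob x, hx.trans (I.le x)⟩ : At EA.dom W) ⟶ ⟨I.ob y, hy.trans (I.le y)⟩) :
    (⟨x, hx⟩ : At EF.dom W) ⟶ ⟨y, hy⟩ :=
  ((hI hx hy).2 f).choose

lemma map_preim (f : (⟨I.ob x, hx.trans (I.le x)⟩ : At EA.dom W) ⟶ ⟨I.ob y, hy.trans (I.le y)⟩) :
    I.map (preim hI (hx := hx) (hy := hy) f) = f :=
  ((hI hx hy).2 f).choose_spec

lemma preim_map (f : (⟨x, hx⟩ : At EF.dom W) ⟶ ⟨y, hy⟩) : preim hI (I.map f) = f :=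
  (hI hx hy).1 (map_preim hI _)

lemma preim_id : preim hI (hx := hx) (hy := hx)
    (𝟙 (⟨I.ob x, hx.trans (I.le x)⟩ : At EA.dom W)) = 𝟙 (⟨x, hx⟩ : At EF.dom W) := by
  rw [← I.map_id, preim_map]

lemma preim_comp
    (f : (⟨I.ob x, hx.trans (I.le x)⟩ : At EA.dom W) ⟶ ⟨I.ob y, hy.trans (I.le y)⟩)
    (g : (⟨I.ob y, hy.trans (I.le y)⟩ : At EA.dom W) ⟶ ⟨I.ob z, hz.trans (I.le z)⟩) :
    preim hI (hx := hx) (hy := hz) (f ≫ g) =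
      preim hI (hx := hx) (hy := hy) f ≫ preim hI (hx := hy) (hy := hz) g :=
  (hI hx hz).1 (by rw [I.map_comp, map_preim, map_preim, map_preim])

lemma res_preim {W' : Opens X} (h : W' ≤ W)
    (f : (⟨I.ob x, hx.trans (I.le x)⟩ : At EA.dom W) ⟶ ⟨I.ob y, hy.trans (I.le y)⟩) :
    EF.res h (preim hI (hx := hx) (hy := hy) f) =
      preim hI (hx := h.trans hx) (hy := h.trans hy) (EA.res h f) :=
  (hI _ _).1 (by rw [I.map_res, map_preim, map_preim])

end preim

variable {I} (hI : I.FullyFaithful) (N : EF.Map EC)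

/-- An extension of `N` to the object `a` of `EA`, over `U`: the object `a` is trivialized over the
members of a covering, and the object `c` is obtained by gluing the corresponding values of `N`. -/
structure Triv (a : EA.Ob) (U : Opens X) where
  /-- the index set of the covering -/
  J : Type u
  /-- the members of the covering -/
  V : J → Opens X
  le_dom : U ≤ EA.dom a
  le (j : J) : V j ≤ U
  cov (x : X) : x ∈ U → ∃ j, x ∈ V j
  /-- the objects of `EF` which are locally isomorphic to `a` -/
  p : J → EF.Ob
  hp (j : J) : V j ≤ EF.dom (p j)
  /-- the trivializations of `a` -/
  t (j : J) : (⟨a, (le j).trans le_dom⟩ : At EA.dom (V j)) ≅ ⟨I.ob (p j), (hp j).trans (I.le _)⟩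
  /-- the value at `a` of the extension -/
  c : EC.Ob
  hc : U ≤ EC.dom c
  /-- the trivializations of `c` -/
  s (j : J) : (⟨N.ob (p j), (hp j).trans (N.le _)⟩ : At EC.dom (V j)) ≅ ⟨c, (le j).trans hc⟩
  compat (j k : J) (W : Opens X) (hj : W ≤ V j) (hk : W ≤ V k) :
    EC.res hj (s j).hom =
      N.map (preim hI (hx := hj.trans (hp j)) (hy := hk.trans (hp k))
        (EA.res hj (t j).inv ≫ EA.res hk (t k).hom)) ≫ EC.res hk (s k).hom

namespace Triv

variable {hI N} {a a' a'' : EA.Ob} {U U' U'' : Opens X} (T : Triv hI N a U) (T' : Triv hI N a' U')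
  (T'' : Triv hI N a'' U'')

/-- The local expression of the action of the extension on a morphism `m : a ⟶ a'`. -/
def loc {V : Opens X} {ha : V ≤ EA.dom a} {ha' : V ≤ EA.dom a'} (j : T.J) (k : T'.J)
    (hj : V ≤ T.V j) (hk : V ≤ T'.V k) (m : (⟨a, ha⟩ : At EA.dom V) ⟶ ⟨a', ha'⟩) :
    (⟨T.c, (hj.trans (T.le j)).trans T.hc⟩ : At EC.dom V) ⟶
      ⟨T'.c, (hk.trans (T'.le k)).trans T'.hc⟩ :=
  EC.res hj (T.s j).inv ≫ N.map (preim hI (hx := hj.trans (T.hp j)) (hy := hk.trans (T'.hp k))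
    (EA.res hj (T.t j).inv ≫ m ≫ EA.res hk (T'.t k).hom)) ≫ EC.res hk (T'.s k).hom

lemma loc_res {V V' : Opens X} (h : V' ≤ V) {ha : V ≤ EA.dom a} {ha' : V ≤ EA.dom a'} (j : T.J)
    (k : T'.J) (hj : V ≤ T.V j) (hk : V ≤ T'.V k) (m : (⟨a, ha⟩ : At EA.dom V) ⟶ ⟨a', ha'⟩) :
    EC.res h (T.loc T' j k hj hk m) =
      T.loc T' j k (h.trans hj) (h.trans hk) (EA.res h m) := by
  simp only [loc, res_comp, res_res, ← N.map_res, res_preim]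

lemma loc_comp {V : Opens X} {ha : V ≤ EA.dom a} {ha' : V ≤ EA.dom a'} {ha'' : V ≤ EA.dom a''}
    (j : T.J) (k : T'.J) (l : T''.J) (hj : V ≤ T.V j) (hk : V ≤ T'.V k) (hl : V ≤ T''.V l)
    (m : (⟨a, ha⟩ : At EA.dom V) ⟶ ⟨a', ha'⟩) (m' : (⟨a', ha'⟩ : At EA.dom V) ⟶ ⟨a'', ha''⟩) :
    T.loc T' j k hj hk m ≫ T'.loc T'' k l hk hl m' = T.loc T'' j l hj hl (m ≫ m') := by
  simp only [loc, Category.assoc, res_hom_inv_assoc]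
  congr 1
  rw [← Category.assoc, ← N.map_comp, ← preim_comp]
  simp

lemma loc_id {V : Opens X} {ha : V ≤ EA.dom a} (j k : T.J) (hj : V ≤ T.V j) (hk : V ≤ T.V k) :
    T.loc T j k hj hk (𝟙 (⟨a, ha⟩ : At EA.dom V)) = 𝟙 _ := by
  have := T.compat j k V hj hk
  rw [loc, Category.id_comp, ← this]
  simp

/-- The local expression does not depend on the trivializations: the change of trivialization is
the local expression of the identity. -/
lemma loc_eq {V : Opens X} {ha : V ≤ EA.dom a} {ha' : V ≤ EA.dom a'} (j j' : T.J) (k k' : T'.J)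
    (hj : V ≤ T.V j) (hk : V ≤ T'.V k) (hj' : V ≤ T.V j') (hk' : V ≤ T'.V k')
    (m : (⟨a, ha⟩ : At EA.dom V) ⟶ ⟨a', ha'⟩) :
    T.loc T' j k hj hk m = T.loc T' j' k' hj' hk' m := by
  have h₁ := T.loc_comp T T' j' j k hj' hj hk (𝟙 _) m
  have h₂ := T.loc_comp T' T' j' k k' hj' hk hk' m (𝟙 _)
  rw [loc_id, Category.id_comp, Category.id_comp] at h₁
  rw [loc_id, Category.comp_id, Category.comp_id] at h₂
  rw [h₁, h₂]

lemma exists_cov {W : Opens X} (hW : W ≤ U) (hW' : W ≤ U') (x : X) (hx : x ∈ W) :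
    ∃ (V : Opens X) (hV : V ≤ W) (j : T.J) (k : T'.J), V ≤ T.V j ∧ V ≤ T'.V k ∧ x ∈ V := by
  obtain ⟨j, hj⟩ := T.cov x (hW hx)
  obtain ⟨k, hk⟩ := T'.cov x (hW' hx)
  exact ⟨W ⊓ T.V j ⊓ T'.V k, inf_le_left.trans inf_le_left, j, k, inf_le_left.trans inf_le_right,
    inf_le_right, ⟨hx, hj⟩, hk⟩

lemma exists_lift (hC : EC.IsSep) {W : Opens X} (hW : W ≤ U) (hW' : W ≤ U')
    (m : (⟨a, hW.trans T.le_dom⟩ : At EA.dom W) ⟶ ⟨a', hW'.trans T'.le_dom⟩) :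
    ∃ m' : (⟨T.c, hW.trans T.hc⟩ : At EC.dom W) ⟶ ⟨T'.c, hW'.trans T'.hc⟩,
      ∀ V (hV : V ≤ W) j k hj hk, EC.res hV m' = T.loc T' j k hj hk (EA.res hV m) := by
  let S : Cov W :=
    { mem := fun V => V ≤ W ∧ ∃ (j : T.J) (k : T'.J), V ≤ T.V j ∧ V ≤ T'.V k
      le := fun h => h.1
      down := fun h ⟨h₁, j, k, h₂, h₃⟩ => ⟨h.trans h₁, j, k, h.trans h₂, h.trans h₃⟩
      cov := fun x hx => by
        obtain ⟨V, hV, j, k, hj, hk, hx⟩ := T.exists_cov T' hW hW' x hx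
        exact ⟨V, ⟨hV, j, k, hj, hk⟩, hx⟩ }
  obtain ⟨m', hm', -⟩ := hC (hW.trans T.hc) (hW'.trans T'.hc) S
    (fun V hV => T.loc T' hV.2.choose hV.2.choose_spec.choose hV.2.choose_spec.choose_spec.1
      hV.2.choose_spec.choose_spec.2 (EA.res hV.1 m))
    (fun V V' h hV => by
      rw [loc_res, res_res]
      apply loc_eq)
  refine ⟨m', fun V hV j k hj hk => ?_⟩
  rw [hm' V ⟨hV, j, k, hj, hk⟩]
  apply loc_eq

/-- The action of the extension on a morphism. -/
def lift (hC : EC.IsSep) {W : Opens X} (hW : W ≤ U) (hW' : W ≤ U')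
    (m : (⟨a, hW.trans T.le_dom⟩ : At EA.dom W) ⟶ ⟨a', hW'.trans T'.le_dom⟩) :
    (⟨T.c, hW.trans T.hc⟩ : At EC.dom W) ⟶ ⟨T'.c, hW'.trans T'.hc⟩ :=
  (T.exists_lift T' hC hW hW' m).choose

lemma res_lift (hC : EC.IsSep) {W : Opens X} (hW : W ≤ U) (hW' : W ≤ U')
    (m : (⟨a, hW.trans T.le_dom⟩ : At EA.dom W) ⟶ ⟨a', hW'.trans T'.le_dom⟩)
    {V : Opens X} (hV : V ≤ W) (j : T.J) (k : T'.J) (hj : V ≤ T.V j) (hk : V ≤ T'.V k) :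
    EC.res hV (T.lift T' hC hW hW' m) = T.loc T' j k hj hk (EA.res hV m) :=
  (T.exists_lift T' hC hW hW' m).choose_spec _ _ _ _ _ _

lemma lift_id (hC : EC.IsSep) {W : Opens X} (hW : W ≤ U) :
    T.lift T hC hW hW (𝟙 _) = 𝟙 _ :=
  hC.ext fun x hx => by
    obtain ⟨V, hV, j, k, hj, hk, hxV⟩ := T.exists_cov T hW hW x hx
    exact ⟨V, hV, hxV, by rw [T.res_lift T hC hW hW _ hV j k hj hk, res_id, res_id, loc_id]⟩

lemma lift_comp (hC : EC.IsSep) {W : Opens X} (hW : W ≤ U) (hW' : W ≤ U') (hW'' : W ≤ U'')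
    (m : (⟨a, hW.trans T.le_dom⟩ : At EA.dom W) ⟶ ⟨a', hW'.trans T'.le_dom⟩)
    (m' : (⟨a', hW'.trans T'.le_dom⟩ : At EA.dom W) ⟶ ⟨a'', hW''.trans T''.le_dom⟩) :
    T.lift T'' hC hW hW'' (m ≫ m') = T.lift T' hC hW hW' m ≫ T'.lift T'' hC hW' hW'' m' :=
  hC.ext fun x hx => by
    obtain ⟨V, hV, j, k, hj, hk, hxV⟩ := T.exists_cov T' hW hW' x hx
    obtain ⟨l, hl⟩ := T''.cov x (hW'' hx)
    have hVl : V ⊓ T''.V l ≤ V := inf_le_left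
    refine ⟨V ⊓ T''.V l, hVl.trans hV, ⟨hxV, hl⟩, ?_⟩
    rw [res_comp, T.res_lift T'' hC _ _ _ _ j l (hVl.trans hj) inf_le_right,
      T.res_lift T' hC _ _ _ _ j k (hVl.trans hj) (hVl.trans hk),
      T'.res_lift T'' hC _ _ _ _ k l (hVl.trans hk) inf_le_right, loc_comp, res_comp]

lemma lift_res (hC : EC.IsSep) {W W' : Opens X} (h : W' ≤ W) (hW : W ≤ U) (hW' : W ≤ U')
    (m : (⟨a, hW.trans T.le_dom⟩ : At EA.dom W) ⟶ ⟨a', hW'.trans T'.le_dom⟩) :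
    T.lift T' hC (h.trans hW) (h.trans hW') (EA.res h m) = EC.res h (T.lift T' hC hW hW' m) :=
  hC.ext fun x hx => by
    obtain ⟨V, hV, j, k, hj, hk, hxV⟩ := T.exists_cov T' (h.trans hW) (h.trans hW') x hx
    refine ⟨V, hV, hxV, ?_⟩
    rw [res_res, T.res_lift T' hC _ _ _ _ j k hj hk, T.res_lift T' hC _ _ _ _ j k hj hk, res_res]

variable (hI N) in
/-- The extension of `N` to the objects in the image of `I`. -/
def ofImage (p : EF.Ob) : Triv hI N (I.ob p) (EF.dom p) where
  J := PUnit
  V _ := EF.dom p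
  le_dom := I.le p
  le _ := le_rfl
  cov x hx := ⟨⟨⟩, hx⟩
  p _ := p
  hp _ := le_rfl
  t _ := Iso.refl _
  c := N.ob p
  hc := N.le p
  s _ := Iso.refl _
  compat j k W hj hk := by
    have h₁ : EA.res hj (𝟙 (⟨I.ob p, I.le p⟩ : At EA.dom _)) ≫
      EA.res hk (𝟙 (⟨I.ob p, I.le p⟩ : At EA.dom _)) = 𝟙 _ := by simp
    refine Eq.trans ?_ (congrArg (fun l => N.map (preim hI (hx := hj) (hy := hk) l) ≫
      EC.res hk (𝟙 (⟨N.ob p, N.le p⟩ : At EC.dom _))) h₁).symm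
    rw [preim_id, N.map_id, Category.id_comp]
    rfl

lemma lift_ofImage (hC : EC.IsSep) {W : Opens X} {p q : EF.Ob} (hp : W ≤ EF.dom p)
    (hq : W ≤ EF.dom q) (f : (⟨p, hp⟩ : At EF.dom W) ⟶ ⟨q, hq⟩) :
    (ofImage hI N p).lift (ofImage hI N q) hC hp hq (I.map f) = N.map f := by
  have := (ofImage hI N p).res_lift (ofImage hI N q) hC hp hq (I.map f) le_rfl ⟨⟩ ⟨⟩ hp hq
  rw [res_self, res_self] at this
  rw [this]
  have h₁ : EA.res hp (𝟙 (⟨I.ob p, I.le p⟩ : At EA.dom _)) ≫ I.map f ≫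
      EA.res hq (𝟙 (⟨I.ob q, I.le q⟩ : At EA.dom _)) = I.map f := by
    simp
  refine (congrArg (fun k => EC.res hp (𝟙 (⟨N.ob p, N.le p⟩ : At EC.dom _)) ≫
    N.map (preim hI (hx := hp) (hy := hq) k) ≫
      EC.res hq (𝟙 (⟨N.ob q, N.le q⟩ : At EC.dom _))) h₁).trans ?_
  rw [preim_map]
  simp

lemma nonempty (hS : I.LocallySurjective) (hC : EC.Effective) (a : EA.Ob) :
    Nonempty (Triv hI N a (EA.dom a)) := by
  choose V ha p hp hxV t using fun x : EA.dom a => hS a x.1 x.2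
  replace t := fun x => (t x).some
  obtain ⟨c, hc, s, hs⟩ := hC (U := EA.dom a) (V := V) ha (fun x hx => ⟨⟨x, hx⟩, hxV _⟩)
    (fun x => N.ob (p x)) (fun x => (hp x).trans (N.le _))
    (fun i j W hi hj => N.map (preim hI (hx := hi.trans (hp i)) (hy := hj.trans (hp j))
        (EA.res hi (t i).inv ≫ EA.res hj (t j).hom)))
    (fun i j W W' h hi hj => by
      rw [← N.map_res, res_preim, res_comp, res_res, res_res])
    (fun i W hi => by
      rw [res_inv_hom, preim_id, N.map_id])
    (fun i j k W hi hj hk => by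
      rw [← N.map_comp, ← preim_comp]
      simp)
  exact ⟨{ J := EA.dom a, V := V, le_dom := le_rfl, le := ha, cov := fun x hx => ⟨⟨x, hx⟩, hxV _⟩
           p := p, hp := hp, t := t, c := c, hc := hc, s := s
           compat := fun j k W hj hk => (hs j k W hj hk).symm }⟩

end Triv

end Map

end StrictPrestack

namespace StrictPrestack.Map

section extend

variable {EF EA EC : StrictPrestack X} {I : EF.Map EA} (hI : I.FullyFaithful)
  (hS : I.LocallySurjective) (hC : EC.IsSep) (hC' : EC.Effective) (N : EF.Map EC)

/-- A chosen value at `a` of the extension of `N`. -/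
def triv (a : EA.Ob) : Triv hI N a (EA.dom a) := (Triv.nonempty hS hC' a).some

/-- The extension of `N` along a local equivalence `I`. -/
def extend : EA.Map EC where
  ob a := (triv hI hS hC' N a).c
  le a := (triv hI hS hC' N a).hc
  map {W x y hx hy} f := (triv hI hS hC' N x).lift (triv hI hS hC' N y) hC hx hy f
  map_id hx := Triv.lift_id _ _ _
  map_comp f g := Triv.lift_comp _ _ _ _ _ _ _ _ _
  map_res {W W'} h {x y hx hy} f := Triv.lift_res _ _ _ _ _ _ _

/-- The extension of `N` along `I` restricts to `N`. -/
def extendIso (p : EF.Ob) :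
    (⟨(extend hI hS hC hC' N).ob (I.ob p), (I.le p).trans ((extend hI hS hC hC' N).le _)⟩ :
      At EC.dom (EF.dom p)) ≅ ⟨N.ob p, N.le p⟩ where
  hom := (triv hI hS hC' N (I.ob p)).lift (Triv.ofImage hI N p) hC (W := EF.dom p) (I.le p) le_rfl
    (𝟙 _)
  inv := (Triv.ofImage hI N p).lift (triv hI hS hC' N (I.ob p)) hC (W := EF.dom p) le_rfl (I.le p)
    (𝟙 _)
  hom_inv_id := by
    refine (Triv.lift_comp _ _ _ hC _ _ _ _ _).symm.trans ?_
    rw [Category.comp_id]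
    exact Triv.lift_id _ _ _
  inv_hom_id := by
    refine (Triv.lift_comp _ _ _ hC _ _ _ _ _).symm.trans ?_
    rw [Category.comp_id]
    exact Triv.lift_id _ _ _

lemma extendIso_naturality {W : Opens X} {p q : EF.Ob} {hp : W ≤ EF.dom p} {hq : W ≤ EF.dom q}
    (f : (⟨p, hp⟩ : At EF.dom W) ⟶ ⟨q, hq⟩) :
    (extend hI hS hC hC' N).map (I.map f) ≫ EC.res hq (extendIso hI hS hC hC' N q).hom =
      EC.res hp (extendIso hI hS hC hC' N p).hom ≫ N.map f := by
  have h₁ := Triv.lift_res (triv hI hS hC' N (I.ob q)) (Triv.ofImage hI N q) hC hq (I.le q) le_rfl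
    (𝟙 _)
  have h₂ := Triv.lift_res (triv hI hS hC' N (I.ob p)) (Triv.ofImage hI N p) hC hp (I.le p) le_rfl
    (𝟙 _)
  refine (congrArg (fun k => _ ≫ k) h₁.symm).trans (Eq.trans ?_
    (congrArg₂ (fun k l => k ≫ l) h₂ (Triv.lift_ofImage hC hp hq f)))
  refine (Triv.lift_comp _ _ _ hC (hp.trans (I.le p)) _ _ _ _).symm.trans
    (Eq.trans ?_ (Triv.lift_comp _ _ _ hC (hp.trans (I.le p)) _ _ _ _))
  rw [EA.res_id, EA.res_id, Category.comp_id, Category.id_comp]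

end extend

section naturality

variable {EF EA EC : StrictPrestack X}

/-- Naturality of a family of morphisms, for maps of strict prestacks. -/
def Natural {T T' : EA.Map EC}
    (n : ∀ a, (⟨T.ob a, T.le a⟩ : At EC.dom (EA.dom a)) ⟶ ⟨T'.ob a, T'.le a⟩) : Prop :=
  ∀ ⦃W : Opens X⦄ ⦃a b : EA.Ob⦄ ⦃ha : W ≤ EA.dom a⦄ ⦃hb : W ≤ EA.dom b⦄
    (f : (⟨a, ha⟩ : At EA.dom W) ⟶ ⟨b, hb⟩),
    T.map f ≫ EC.res hb (n b) = EC.res ha (n a) ≫ T'.map f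

variable {I : EF.Map EA} {T T' : EA.Map EC}

/-- Natural families which agree on the image of a local equivalence are equal. -/
lemma Natural.ext (hS : I.LocallySurjective) (hC : EC.IsSep)
    {n n' : ∀ a, (⟨T.ob a, T.le a⟩ : At EC.dom (EA.dom a)) ⟶ ⟨T'.ob a, T'.le a⟩}
    (hn : Natural n) (hn' : Natural n')
    (h : ∀ p, EC.res (I.le p) (n (I.ob p)) = EC.res (I.le p) (n' (I.ob p))) (a : EA.Ob) :
    n a = n' a := by
  refine hC.ext fun x hx => ?_
  obtain ⟨V, ha, p, hp, hxV, ⟨t⟩⟩ := hS a x hx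
  refine ⟨V, ha, hxV, ?_⟩
  have h₁ := hn t.hom
  have h₂ := hn' t.hom
  have h₃ := congrArg (EC.res hp) (h p)
  rw [EC.res_res, EC.res_res] at h₃
  rw [h₃, h₂] at h₁
  exact ((cancel_mono (T'.mapIso t).hom).1 h₁).symm

variable (n : ∀ p, (⟨T.ob (I.ob p), (I.le p).trans (T.le _)⟩ : At EC.dom (EF.dom p)) ⟶
    ⟨T'.ob (I.ob p), (I.le p).trans (T'.le _)⟩)

/-- The local expression at `a` of the extension of a family of morphisms. -/
def locApp {V : Opens X} {a : EA.Ob} {ha : V ≤ EA.dom a} {p : EF.Ob} (hp : V ≤ EF.dom p)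
    (t : (⟨a, ha⟩ : At EA.dom V) ≅ ⟨I.ob p, hp.trans (I.le p)⟩) :
    (⟨T.ob a, ha.trans (T.le a)⟩ : At EC.dom V) ⟶ ⟨T'.ob a, ha.trans (T'.le a)⟩ :=
  T.map t.hom ≫ EC.res hp (n p) ≫ T'.map t.inv

lemma res_locApp {V V' : Opens X} (h : V' ≤ V) {a : EA.Ob} {ha : V ≤ EA.dom a} {p : EF.Ob}
    {hp : V ≤ EF.dom p} (t : (⟨a, ha⟩ : At EA.dom V) ≅ ⟨I.ob p, hp.trans (I.le p)⟩) :
    EC.res h (locApp n hp t) = locApp n (h.trans hp) (EA.resIso h t) := by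
  simp only [locApp, map_res, resIso_hom, resIso_inv, res_comp, res_res]

variable {n}

lemma locApp_naturality (hI : I.FullyFaithful)
    (hn : ∀ ⦃W : Opens X⦄ ⦃p q : EF.Ob⦄ ⦃hp : W ≤ EF.dom p⦄ ⦃hq : W ≤ EF.dom q⦄
      (f : (⟨p, hp⟩ : At EF.dom W) ⟶ ⟨q, hq⟩),
      T.map (I.map f) ≫ EC.res hq (n q) = EC.res hp (n p) ≫ T'.map (I.map f))
    {V : Opens X} {a b : EA.Ob} {ha : V ≤ EA.dom a} {hb : V ≤ EA.dom b} {p q : EF.Ob}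
    {hp : V ≤ EF.dom p} {hq : V ≤ EF.dom q}
    (t : (⟨a, ha⟩ : At EA.dom V) ≅ ⟨I.ob p, hp.trans (I.le p)⟩)
    (t' : (⟨b, hb⟩ : At EA.dom V) ≅ ⟨I.ob q, hq.trans (I.le q)⟩)
    (m : (⟨a, ha⟩ : At EA.dom V) ⟶ ⟨b, hb⟩) :
    T.map m ≫ locApp n hq t' = locApp n hp t ≫ T'.map m := by
  have h := hn (preim hI (hx := hp) (hy := hq) (t.inv ≫ m ≫ t'.hom))
  rw [map_preim] at h
  rw [← cancel_epi (T.mapIso t).inv, ← cancel_mono (T'.mapIso t').hom]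
  simp only [T.map_comp, T'.map_comp, Category.assoc] at h
  have e₁ : T'.map t'.inv ≫ T'.map t'.hom = 𝟙 _ := (T'.mapIso t').inv_hom_id
  have e₂ : T.map t.inv ≫ T.map t.hom = 𝟙 _ := (T.mapIso t).inv_hom_id
  simp only [locApp, Category.assoc, mapIso_inv, mapIso_hom, e₁, reassoc_of% e₂, Category.comp_id, h]

/-- A natural family on the image of a local equivalence extends. -/
lemma exists_natural (hI : I.FullyFaithful) (hS : I.LocallySurjective) (hC : EC.IsSep)
    (hn : ∀ ⦃W : Opens X⦄ ⦃p q : EF.Ob⦄ ⦃hp : W ≤ EF.dom p⦄ ⦃hq : W ≤ EF.dom q⦄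
      (f : (⟨p, hp⟩ : At EF.dom W) ⟶ ⟨q, hq⟩),
      T.map (I.map f) ≫ EC.res hq (n q) = EC.res hp (n p) ≫ T'.map (I.map f)) :
    ∃ m : ∀ a, (⟨T.ob a, T.le a⟩ : At EC.dom (EA.dom a)) ⟶ ⟨T'.ob a, T'.le a⟩,
      Natural m ∧ ∀ p, EC.res (I.le p) (m (I.ob p)) = n p := by
  have indep {V : Opens X} {a : EA.Ob} {ha : V ≤ EA.dom a} {p q : EF.Ob}
      {hp : V ≤ EF.dom p} {hq : V ≤ EF.dom q}
      (t : (⟨a, ha⟩ : At EA.dom V) ≅ ⟨I.ob p, hp.trans (I.le p)⟩)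
      (t' : (⟨a, ha⟩ : At EA.dom V) ≅ ⟨I.ob q, hq.trans (I.le q)⟩) :
      locApp n hp t = locApp n hq t' := by
    have := locApp_naturality hI hn (hp := hp) (hq := hq) t t' (𝟙 _)
    rw [T.map_id, T'.map_id, Category.id_comp, Category.comp_id] at this
    exact this.symm
  have key (a : EA.Ob) : ∃ m : (⟨T.ob a, T.le a⟩ : At EC.dom (EA.dom a)) ⟶ ⟨T'.ob a, T'.le a⟩,
      ∀ V (ha : V ≤ EA.dom a) p (hp : V ≤ EF.dom p)
        (t : (⟨a, ha⟩ : At EA.dom V) ≅ ⟨I.ob p, hp.trans (I.le p)⟩),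
        EC.res ha m = locApp n hp t := by
    let S : Cov (EA.dom a) :=
      { mem := fun V => ∃ (ha : V ≤ EA.dom a) (p : EF.Ob) (hp : V ≤ EF.dom p),
          Nonempty ((⟨a, ha⟩ : At EA.dom V) ≅ ⟨I.ob p, hp.trans (I.le p)⟩)
        le := fun h => h.1
        down := fun h ⟨ha, p, hp, ⟨t⟩⟩ => ⟨h.trans ha, p, h.trans hp, ⟨EA.resIso h t⟩⟩
        cov := fun x hx => by
          obtain ⟨V, ha, p, hp, hxV, ht⟩ := hS a x hx
          exact ⟨V, ⟨ha, p, hp, ht⟩, hxV⟩ }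
    obtain ⟨m, hm, -⟩ := hC (T.le a) (T'.le a) S
      (fun V hV => locApp n hV.2.choose_spec.choose hV.2.choose_spec.choose_spec.some)
      (fun V V' h hV => by
        rw [res_locApp]
        apply indep)
    refine ⟨m, fun V ha p hp t => ?_⟩
    rw [hm V ⟨ha, p, hp, ⟨t⟩⟩]
    apply indep
  choose m hm using key
  refine ⟨m, fun W a b ha hb f => ?_, fun p => ?_⟩
  · refine hC.ext fun x hx => ?_
    obtain ⟨V, hVa, p, hp, hxV, ⟨t⟩⟩ := hS a x (ha hx)
    obtain ⟨V', hVb, q, hq, hxV', ⟨t'⟩⟩ := hS b x (hb hx)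
    have h₁ : W ⊓ (V ⊓ V') ≤ V := inf_le_right.trans inf_le_left
    have h₂ : W ⊓ (V ⊓ V') ≤ V' := inf_le_right.trans inf_le_right
    refine ⟨W ⊓ (V ⊓ V'), inf_le_left, ⟨hx, hxV, hxV'⟩, ?_⟩
    rw [EC.res_comp, EC.res_comp, EC.res_res, EC.res_res,
      hm a _ _ p (h₁.trans hp) (EA.resIso h₁ t), hm b _ _ q (h₂.trans hq) (EA.resIso h₂ t'),
      ← T.map_res, ← T'.map_res]
    exact locApp_naturality hI hn _ _ _
  · rw [hm (I.ob p) _ (I.le p) p le_rfl (Iso.refl _)]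
    simp [locApp, T.map_id, T'.map_id]

end naturality

end StrictPrestack.Map

/-! ### The universal property of associated stacks -/

section conversion

open StrictPrestack

/-- Descent data for the family of objects `x` are effective. -/
def StrictPrestack.EffectiveFor (E : StrictPrestack X) {J : Type u} {U : Opens X} {V : J → Opens X}
    (hV : ∀ j, V j ≤ U) (x : J → E.Ob) (hx : ∀ j, V j ≤ E.dom (x j)) : Prop :=
  ∀ (t : ∀ i j W (hi : W ≤ V i) (hj : W ≤ V j),
      (⟨x i, hi.trans (hx i)⟩ : At E.dom W) ⟶ ⟨x j, hj.trans (hx j)⟩)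
    (_ : ∀ i j W W' (h : W' ≤ W) hi hj,
      E.res h (t i j W hi hj) = t i j W' (h.trans hi) (h.trans hj))
    (_ : ∀ i W hi, t i i W hi hi = 𝟙 _)
    (_ : ∀ i j k W hi hj hk, t i j W hi hj ≫ t j k W hj hk = t i k W hi hk),
    ∃ (y : E.Ob) (hy : U ≤ E.dom y) (s : ∀ i, (⟨x i, hx i⟩ : At E.dom (V i)) ≅
      ⟨y, (hV i).trans hy⟩),
      ∀ i j W hi hj, t i j W hi hj ≫ E.res hj (s j).hom = E.res hi (s i).hom

lemma StrictPrestack.EffectiveFor.of_iso {E : StrictPrestack X} {J : Type u} {U : Opens X}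
    {V : J → Opens X} {hV : ∀ j, V j ≤ U} {x x' : J → E.Ob} {hx : ∀ j, V j ≤ E.dom (x j)}
    {hx' : ∀ j, V j ≤ E.dom (x' j)} (h : E.EffectiveFor hV x' hx')
    (c : ∀ j, (⟨x' j, hx' j⟩ : At E.dom (V j)) ≅ ⟨x j, hx j⟩) : E.EffectiveFor hV x hx := by
  intro t t_res t_self t_comp
  obtain ⟨y, hy, s, hs⟩ := h
    (fun i j W hi hj => E.res hi (c i).hom ≫ t i j W hi hj ≫ E.res hj (c j).inv)
    (fun i j W W' h hi hj => by simp only [res_comp, res_res, t_res])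
    (fun i W hi => by simp only [t_self, Category.id_comp, res_hom_inv])
    (fun i j k W hi hj hk => by
      simp only [Category.assoc, res_inv_hom_assoc, ← t_comp i j k W hi hj hk])
  refine ⟨y, hy, fun j => (c j).symm ≪≫ s j, fun i j W hi hj => ?_⟩
  have h := hs i j W hi hj
  simp only [Category.assoc] at h
  rw [Iso.trans_hom, Iso.trans_hom, res_comp, res_comp, ← h, Iso.symm_hom, Iso.symm_hom,
    res_inv_hom_assoc]

/-- Descent is effective in the strict prestack of a stack: a family of objects may be replaced by
its restrictions to the members of the covering, which are objects of the stack over these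
members. -/
lemma Prestack.strict_effective {C : Prestack X} (hC : C.IsStackOn) : C.strict.Effective := by
  intro J U V hV cov x hx
  have h : C.strict.EffectiveFor (J := J) hV
      (fun j => C.pres.ι ((C.res (homOfLE (hx j))).obj (x j).2)) (fun j => C.pres.le _) := by
    intro t t_res t_self t_comp
    obtain ⟨y, s, hs⟩ := C.pres.effective_of_isStackOn hC hV cov _ t t_res t_self t_comp
    exact ⟨C.pres.ι y, C.pres.le _, s, hs⟩
  exact h.of_iso (fun j => C.pres.can (homOfLE (hx j)) (x j).2)

variable {F A C : Prestack X} {i : F ⟶ A}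

lemma toStrict_fullyFaithful (h : ∀ U, (onFib i U).Full) (h' : ∀ U, (onFib i U).Faithful) :
    (toStrict i).FullyFaithful := by
  intro W x y hx hy
  have e : ((toStrict i).map : ((⟨x, hx⟩ : At F.strict.dom W) ⟶ ⟨y, hy⟩) → _) =
      ((resIso i (homOfLE hx) x.2).homCongr (resIso i (homOfLE hy) y.2)) ∘
        (onFib i W).map := rfl
  have h₁ := h W
  have h₂ := h' W
  rw [e]
  exact (Equiv.bijective _).comp ⟨(onFib i W).map_injective, (onFib i W).map_surjective⟩

lemma toStrict_locallySurjective
    (h : ∀ (U : Opens X) (a : A.fib U), ∀ x ∈ U, ∃ (V : Opens X) (f : V ⟶ U) (p : F.fib V),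
      x ∈ V ∧ Nonempty ((A.res f).obj a ≅ (onFib i V).obj p)) :
    (toStrict i).LocallySurjective := by
  rintro ⟨U, a⟩ x hx
  obtain ⟨V, f, p, hxV, ⟨e⟩⟩ := h U a x hx
  exact ⟨V, f.le, ⟨V, p⟩, le_rfl, hxV, ⟨(A.pres.can f a).symm ≪≫ A.pres.embIso e⟩⟩

/-- The action on objects of `ofStrict`. -/
def ofStrictObj (T : A.strict.Map C.strict) {U : Opens X} (a : A.fib U) : C.fib U :=
  (C.res (homOfLE (T.le ⟨U, a⟩))).obj (T.ob ⟨U, a⟩).2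

/-- The object `ofStrictObj T a` is isomorphic to the object attached to `a` by `T`. -/
def ofStrictCan (T : A.strict.Map C.strict) {U : Opens X} (a : A.fib U) :
    (⟨C.pres.ι (ofStrictObj T a), C.pres.le _⟩ : At C.strict.dom U) ≅
      ⟨T.ob (A.pres.ι a), (A.pres.le a).trans (T.le _)⟩ :=
  C.pres.can (homOfLE (T.le ⟨U, a⟩)) (T.ob ⟨U, a⟩).2

/-- The functor of prestacks attached to a map between their strict prestacks. -/
def ofStrict (T : A.strict.Map C.strict) : A ⟶ C :=
  mkTrans A.pres C.pres T (ofStrictObj T) (ofStrictCan T)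

/-- The object attached by `ofStrict T` to `a` is isomorphic to the object attached by `T`. -/
def ofStrictIso (T : A.strict.Map C.strict) (a : A.strict.Ob) :
    (⟨(toStrict (ofStrict T)).ob a, (toStrict (ofStrict T)).le a⟩ :
      At C.strict.dom (A.strict.dom a)) ≅ ⟨T.ob a, T.le a⟩ :=
  C.pres.can (homOfLE (T.le a)) (T.ob a).2

/-- A conjugation, as a commutative square.
Stated in an abstract category, so as to apply to morphisms whose types agree only after
unfolding. -/
lemma square_of_eq_conj {D : Type*} [Category* D] {a b a' b' : D} {f : a ⟶ b} {g : a' ⟶ b'}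
    {e : a ≅ a'} {e' : b ≅ b'} (h : f = e.hom ≫ g ≫ e'.inv) : f ≫ e'.hom = e.hom ≫ g := by
  simp [h]

/-- Cancellation of the last morphism of a composition.
Stated in an abstract category, so as to apply to morphisms whose types agree only after
unfolding. -/
lemma conj_cancel_right {D : Type*} [Category* D] {a b c d e : D} (f : a ⟶ b) (g : b ⟶ c)
    (h : c ⟶ d) (k : d ⟶ e) {l : e ⟶ d} (w : k ≫ l = 𝟙 _) :
    (f ≫ g ≫ h ≫ k) ≫ l = f ≫ g ≫ h := by
  simp [w]

lemma ofStrictIso_naturality (T : A.strict.Map C.strict) {W : Opens X} {x y : A.strict.Ob}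
    {hx : W ≤ A.strict.dom x} {hy : W ≤ A.strict.dom y}
    (f : (⟨x, hx⟩ : At A.strict.dom W) ⟶ ⟨y, hy⟩) :
    (toStrict (ofStrict T)).map f ≫ C.strict.res hy (ofStrictIso T y).hom =
      C.strict.res hx (ofStrictIso T x).hom ≫ T.map f := by
  -- it is enough to check the claim for the morphisms `emb g` and `can`
  have h₁ {U : Opens X} {x y : A.fib U} (g : x ⟶ y) :
      (toStrict (ofStrict T)).map (A.pres.emb g) ≫ (ofStrictIso T ⟨U, y⟩).hom =
        (ofStrictIso T ⟨U, x⟩).hom ≫ T.map (A.pres.emb g) := by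
    refine square_of_eq_conj (e := ofStrictIso T ⟨U, x⟩) (e' := ofStrictIso T ⟨U, y⟩) ?_
    refine (toStrict_emb (ofStrict T) g).trans ?_
    exact emb_mkTransMap A.pres C.pres T (ofStrictObj T) (ofStrictCan T) g
  have h₂ {U V : Opens X} (f : V ⟶ U) (x : A.fib U) :
      (toStrict (ofStrict T)).map (A.pres.can f x).hom ≫
          C.strict.res f.le (ofStrictIso T ⟨U, x⟩).hom =
        (ofStrictIso T ⟨V, (A.res f).obj x⟩).hom ≫ T.map (A.pres.can f x).hom := by
    refine square_of_eq_conj (e := ofStrictIso T ⟨V, (A.res f).obj x⟩)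
      (e' := C.strict.resIso f.le (ofStrictIso T ⟨U, x⟩)) ?_
    refine (toStrict_can (ofStrict T) f x).trans ?_
    refine (congrArg (fun k => k ≫ (C.pres.can f (ofStrictObj T x)).hom)
      (emb_mkTransIso A.pres C.pres T (ofStrictObj T) (ofStrictCan T) f x)).trans ?_
    exact conj_cancel_right _ _ _ _ (Iso.inv_hom_id _)
  refine (congrArg (fun k => k ≫ _) ((toStrict (ofStrict T)).map_strict_eq f)).trans (Eq.trans ?_
    (congrArg (fun k => _ ≫ k) (T.map_strict_eq f)).symm)
  exact square_conj ((toStrict (ofStrict T)).mapIso (A.pres.can (homOfLE hx) x.2)) _ _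
    (T.mapIso (A.pres.can (homOfLE hx) x.2)) _ _ _ _ _ _ (h₂ _ _) (h₁ _) (h₂ _ _)

/-- Pasting of two commutative squares.
Stated in an abstract category, so as to apply to morphisms whose types agree only after
unfolding. -/
lemma paste_squares {D : Type*} [Category* D] {a b c a' b' c' : D} {f : a ⟶ a'} {f₁ : b ⟶ b'}
    {f₂ : c ⟶ c'} {g : a ⟶ b} {h : b ⟶ c} {g' : a' ⟶ b'} {h' : b' ⟶ c'}
    (e : f ≫ g' = g ≫ f₁) (e' : f₁ ≫ h' = h ≫ f₂) : f ≫ g' ≫ h' = (g ≫ h) ≫ f₂ := by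
  rw [reassoc_of% e, e', Category.assoc]

/-- The modification defined by a natural family at the level of the strict prestacks. -/
def modOfNatural {η θ : A ⟶ C}
    {n : ∀ a, (⟨(toStrict η).ob a, (toStrict η).le a⟩ : At C.strict.dom (A.strict.dom a)) ⟶
      ⟨(toStrict θ).ob a, (toStrict θ).le a⟩} (hn : Map.Natural n) : η ⟶ θ :=
  modOfStrict (n := fun {U} (x : A.fib U) =>
    (C.pres.emb.symm (n ⟨U, x⟩) : (onFib η U).obj x ⟶ (onFib θ U).obj x)) (by
  intro W x y hx hy f
  have e (x : A.strict.Ob) : C.pres.emb (C.pres.emb.symm (n x) :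
      (onFib η x.1).obj x.2 ⟶ (onFib θ x.1).obj x.2) = n x := Equiv.apply_symm_apply _ _
  refine (congrArg (fun k => _ ≫ C.strict.res hy k) (e y)).trans ((hn f).trans ?_)
  exact (congrArg (fun k => C.strict.res hx k ≫ _) (e x)).symm)

lemma emb_modApp_modOfNatural {η θ : A ⟶ C}
    {n : ∀ a, (⟨(toStrict η).ob a, (toStrict η).le a⟩ : At C.strict.dom (A.strict.dom a)) ⟶
      ⟨(toStrict θ).ob a, (toStrict θ).le a⟩} (hn : Map.Natural n) {U : Opens X} (x : A.fib U) :
    C.pres.emb (modApp (modOfNatural hn) x) = n ⟨U, x⟩ :=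
  Equiv.apply_symm_apply C.pres.emb (n ⟨U, x⟩)

/-- An isomorphism of functors of prestacks, from a natural family at the level of the strict
prestacks. -/
def isoOfStrictNatural {η θ : A ⟶ C}
    (n : ∀ a, (⟨(toStrict η).ob a, (toStrict η).le a⟩ : At C.strict.dom (A.strict.dom a)) ≅
      ⟨(toStrict θ).ob a, (toStrict θ).le a⟩) (hn : Map.Natural (fun a => (n a).hom)) : η ≅ θ where
  hom := modOfNatural hn
  inv := modOfNatural (n := fun a => (n a).inv)
    (fun W a b ha hb f => by
      have := hn f
      rw [← cancel_mono (C.strict.resIso hb (n b)).hom, ← cancel_epi (C.strict.resIso ha (n a)).hom]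
      simp [this])
  hom_inv_id := mod_ext fun {U} x => by
    apply C.pres.emb.injective
    refine (C.pres.emb_comp _ _).trans ((congrArg₂ (fun k l => k ≫ l)
      (emb_modApp_modOfNatural _ x) (emb_modApp_modOfNatural _ x)).trans
      ((n ⟨U, x⟩).hom_inv_id.trans (C.pres.emb_id _).symm))
  inv_hom_id := mod_ext fun {U} x => by
    apply C.pres.emb.injective
    refine (C.pres.emb_comp _ _).trans ((congrArg₂ (fun k l => k ≫ l)
      (emb_modApp_modOfNatural _ x) (emb_modApp_modOfNatural _ x)).trans
      ((n ⟨U, x⟩).inv_hom_id.trans (C.pres.emb_id _).symm))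

lemma precomp_faithful (hS : (toStrict i).LocallySurjective) (hC : C.IsStackOn) :
    (precomp C i).Faithful where
  map_injective {η θ m m'} h := mod_ext fun {U} a => by
    apply C.pres.emb.injective
    refine Map.Natural.ext (T := toStrict η) (T' := toStrict θ) hS
      (C.strict_isSep hC.toIsPrestack) (n := fun a : A.strict.Ob => C.pres.emb (modApp m a.2))
      (n' := fun a : A.strict.Ob => C.pres.emb (modApp m' a.2))
      (fun W a b ha hb f => modApp_strictNatural m f)
      (fun W a b ha hb f => modApp_strictNatural m' f) (fun p => ?_) ⟨U, a⟩
    refine congrArg (C.strict.res le_rfl) ?_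
    have := congrArg (fun k => modApp k p.2) h
    exact congrArg C.pres.emb this

lemma precomp_full (hI : (toStrict i).FullyFaithful) (hS : (toStrict i).LocallySurjective)
    (hC : C.IsStackOn) : (precomp C i).Full where
  map_surjective {η θ} m := by
    obtain ⟨M, hM, hM'⟩ := Map.exists_natural (I := toStrict i) (T := toStrict η) (T' := toStrict θ)
      (n := fun p : F.strict.Ob => C.pres.emb (modApp m p.2)) hI hS (C.strict_isSep hC.toIsPrestack)
      (fun W p q hp hq f => by
        have := modApp_strictNatural m f
        refine (congrArg (fun k => k ≫ _) (toStrict_vcomp i η f)).symm.trans (this.trans ?_)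
        exact congrArg (fun k => _ ≫ k) (toStrict_vcomp i θ f))
    refine ⟨modOfNatural hM, mod_ext fun {U} p => ?_⟩
    apply C.pres.emb.injective
    refine (emb_modApp_modOfNatural hM ((onFib i U).obj p)).trans (Eq.trans ?_ (hM' ⟨U, p⟩))
    exact (C.strict.res_self _ _).symm

lemma precomp_essSurj (hI : (toStrict i).FullyFaithful) (hS : (toStrict i).LocallySurjective)
    (hC : C.IsStackOn) : (precomp C i).EssSurj where
  mem_essImage η := by
    let T := Map.extend hI hS (C.strict_isSep hC.toIsPrestack) (C.strict_effective hC) (toStrict η)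
    let e := Map.extendIso hI hS (C.strict_isSep hC.toIsPrestack) (C.strict_effective hC)
      (toStrict η)
    refine ⟨ofStrict T, ⟨isoOfStrictNatural
      (fun p => ofStrictIso T ((toStrict i).ob p) ≪≫ e p) ?_⟩⟩
    intro W p q hp hq f
    have h₁ := ofStrictIso_naturality T ((toStrict i).map f)
    have h₂ := Map.extendIso_naturality hI hS (C.strict_isSep hC.toIsPrestack)
      (C.strict_effective hC) (toStrict η) f
    refine (congrArg₂ (fun k l => k ≫ l) (toStrict_vcomp i (ofStrict T) f)
      (C.strict.res_comp hq _ _)).trans (Eq.trans ?_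
      (congrArg (fun k => k ≫ _) (C.strict.res_comp hp _ _)).symm)
    exact paste_squares h₁ h₂

/-- A functor from a prestack to a stack which is fully faithful and locally essentially surjective
exhibits the stack as an associated stack. -/
lemma isAssociatedStack_of_locallySurjective (hA : A.IsStackOn) (h : ∀ U, (onFib i U).Full)
    (h' : ∀ U, (onFib i U).Faithful)
    (hS : ∀ (U : Opens X) (a : A.fib U), ∀ x ∈ U, ∃ (V : Opens X) (f : V ⟶ U) (p : F.fib V),
      x ∈ V ∧ Nonempty ((A.res f).obj a ≅ (onFib i V).obj p)) : IsAssociatedStack i where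
  isStack := hA
  isEquivalence C hC :=
    { faithful := precomp_faithful (toStrict_locallySurjective hS) hC
      full := precomp_full (toStrict_fullyFaithful h h') (toStrict_locallySurjective hS) hC
      essSurj := precomp_essSurj (toStrict_fullyFaithful h h') (toStrict_locallySurjective hS) hC }

end conversion

/-! ### The associated stack of a separated prestack -/

namespace StrictPrestack

section glue

variable {E : StrictPrestack X} {W : Opens X} {J : Type*} {V : J → Opens X}
  {x y : E.Ob} {hx : W ≤ E.dom x} {hy : W ≤ E.dom y}

/-- Gluing of morphisms for an open covering. -/
lemma IsSep.exists_glue (hE : E.IsSep) (cov : ∀ p ∈ W, ∃ j, p ∈ V j)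
    (φ : ∀ j T (hT : T ≤ W) (hj : T ≤ V j), (⟨x, hT.trans hx⟩ : At E.dom T) ⟶ ⟨y, hT.trans hy⟩)
    (φ_res : ∀ j T T' (h : T' ≤ T) hT hj,
      E.res h (φ j T hT hj) = φ j T' (h.trans hT) (h.trans hj))
    (indep : ∀ j k T hT hj hk, φ j T hT hj = φ k T hT hk) :
    ∃ s : (⟨x, hx⟩ : At E.dom W) ⟶ ⟨y, hy⟩, ∀ j T hT hj, E.res hT s = φ j T hT hj := by
  let S : Cov W :=
    { mem := fun T => T ≤ W ∧ ∃ j, T ≤ V j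
      le := fun h => h.1
      down := fun h ⟨h₁, j, h₂⟩ => ⟨h.trans h₁, j, h.trans h₂⟩
      cov := fun p hp => by
        obtain ⟨j, hj⟩ := cov p hp
        exact ⟨W ⊓ V j, ⟨inf_le_left, j, inf_le_right⟩, hp, hj⟩ }
  obtain ⟨s, hs, -⟩ := hE hx hy S (fun T hT => φ hT.2.choose T hT.1 hT.2.choose_spec)
    (fun T T' h hT => by
      rw [φ_res]
      apply indep)
  refine ⟨s, fun j T hT hj => ?_⟩
  rw [hs T ⟨hT, j, hj⟩]
  apply indep

lemma IsSep.ext_of_cover (hE : E.IsSep) (cov : ∀ p ∈ W, ∃ j, p ∈ V j)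
    {s t : (⟨x, hx⟩ : At E.dom W) ⟶ ⟨y, hy⟩}
    (h : ∀ j T (hT : T ≤ W) (hj : T ≤ V j), E.res hT s = E.res hT t) : s = t :=
  hE.ext fun p hp => by
    obtain ⟨j, hj⟩ := cov p hp
    exact ⟨W ⊓ V j, inf_le_left, ⟨hp, hj⟩, h j _ _ inf_le_right⟩

end glue

variable (E : StrictPrestack X)

/-- A descent datum for objects of `E`. -/
structure Desc where
  /-- the index set of the covering -/
  J : Type u
  /-- the members of the covering -/
  V : J → Opens X
  /-- the objects -/
  x : J → E.Ob
  le (j : J) : V j ≤ E.dom (x j)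
  /-- the transition morphisms -/
  t (i j : J) (W : Opens X) (hi : W ≤ V i) (hj : W ≤ V j) :
    (⟨x i, hi.trans (le i)⟩ : At E.dom W) ⟶ ⟨x j, hj.trans (le j)⟩
  t_res (i j : J) (W W' : Opens X) (h : W' ≤ W) (hi : W ≤ V i) (hj : W ≤ V j) :
    E.res h (t i j W hi hj) = t i j W' (h.trans hi) (h.trans hj)
  t_self (i : J) (W : Opens X) (hi : W ≤ V i) : t i i W hi hi = 𝟙 _
  t_comp (i j k : J) (W : Opens X) (hi : W ≤ V i) (hj : W ≤ V j) (hk : W ≤ V k) :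
    t i j W hi hj ≫ t j k W hj hk = t i k W hi hk

variable {E}

namespace Desc

/-- The open subset over which a descent datum is defined. -/
def dom (a : E.Desc) : Opens X := ⨆ j, a.V j

lemma exists_mem {a : E.Desc} {W : Opens X} (h : W ≤ a.dom) (p : X) (hp : p ∈ W) :
    ∃ j, p ∈ a.V j :=
  Opens.mem_iSup.1 (h hp)

lemma le_dom (a : E.Desc) (j : a.J) : a.V j ≤ a.dom := le_iSup a.V j

/-- Morphisms of descent data over `W`, given by their local expressions. -/
@[ext]
structure Hom (a b : E.Desc) (W : Opens X) where
  /-- the local expressions -/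
  f (i : a.J) (j : b.J) (V : Opens X) (hV : V ≤ W) (hi : V ≤ a.V i) (hj : V ≤ b.V j) :
    (⟨a.x i, hi.trans (a.le i)⟩ : At E.dom V) ⟶ ⟨b.x j, hj.trans (b.le j)⟩
  res (i : a.J) (j : b.J) (V V' : Opens X) (h : V' ≤ V) (hV : V ≤ W) (hi : V ≤ a.V i)
    (hj : V ≤ b.V j) : E.res h (f i j V hV hi hj) = f i j V' (h.trans hV) (h.trans hi) (h.trans hj)
  left (i i' : a.J) (j : b.J) (V : Opens X) (hV : V ≤ W) (hi : V ≤ a.V i) (hi' : V ≤ a.V i')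
    (hj : V ≤ b.V j) : a.t i i' V hi hi' ≫ f i' j V hV hi' hj = f i j V hV hi hj
  right (i : a.J) (j j' : b.J) (V : Opens X) (hV : V ≤ W) (hi : V ≤ a.V i) (hj : V ≤ b.V j)
    (hj' : V ≤ b.V j') : f i j V hV hi hj ≫ b.t j j' V hj hj' = f i j' V hV hi hj'

variable {a b c d : E.Desc} {W : Opens X}

/-- The identity morphism of a descent datum. -/
def Hom.id (a : E.Desc) (W : Opens X) : Hom a a W where
  f i j V _ hi hj := a.t i j V hi hj
  res i j V V' h _ hi hj := a.t_res i j V V' h hi hj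
  left i i' j V _ hi hi' hj := a.t_comp i i' j V hi hi' hj
  right i j j' V _ hi hj hj' := a.t_comp i j j' V hi hj hj'

/-- Local expressions may be compared locally. -/
lemma Hom.f_ext (hE : E.IsSep) (c : E.Desc) (hc : W ≤ c.dom) {m m' : Hom a b W} {i : a.J} {j : b.J}
    {V : Opens X} {hV : V ≤ W} {hi : V ≤ a.V i} {hj : V ≤ b.V j}
    (h : ∀ k V' (h : V' ≤ V) (_ : V' ≤ c.V k), m.f i j V' (h.trans hV) (h.trans hi) (h.trans hj) =
      m'.f i j V' (h.trans hV) (h.trans hi) (h.trans hj)) :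
    m.f i j V hV hi hj = m'.f i j V hV hi hj :=
  hE.ext_of_cover (V := c.V) (exists_mem (hV.trans hc)) fun k V' h' hk => by
    rw [Hom.res, Hom.res, h k V' h' hk]

/-- The composition of `m` and `n` is locally `m.f i j ≫ n.f j k`, which is independent of the
index `j` of `b`; the local compositions glue as `E` is separated. -/
lemma Hom.exists_comp (hE : E.IsSep) (hb : W ≤ b.dom) (m : Hom a b W) (n : Hom b c W) :
    ∃ l : Hom a c W, ∀ i k j V hV hi hk hj,
      l.f i k V hV hi hk = m.f i j V hV hi hj ≫ n.f j k V hV hj hk := by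
  have key (i : a.J) (k : c.J) (V : Opens X) (hV : V ≤ W) (hi : V ≤ a.V i) (hk : V ≤ c.V k) :=
    hE.exists_glue (V := b.V) (exists_mem (hV.trans hb)) (hx := hi.trans (a.le i))
      (hy := hk.trans (c.le k))
      (fun j V' h hj => m.f i j V' (h.trans hV) (h.trans hi) hj ≫
        n.f j k V' (h.trans hV) hj (h.trans hk))
      (fun j V' V'' h hT hj => by simp only [E.res_comp, Hom.res])
      (fun j j' V' h hj hj' => by
        rw [← m.right i j j' V' _ _ hj hj', Category.assoc, n.left])
  choose l hl using key
  refine ⟨⟨l, fun i k V V' h hV hi hk => ?_, fun i i' k V hV hi hi' hk => ?_,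
    fun i k k' V hV hi hk hk' => ?_⟩, fun i k j V hV hi hk hj => ?_⟩
  · refine hE.ext_of_cover (V := b.V) (exists_mem ((h.trans hV).trans hb)) fun j T hT hj => ?_
    rw [E.res_res, hl i k V hV hi hk j T _ hj, hl _ _ _ _ _ _ j T _ hj]
  · refine hE.ext_of_cover (V := b.V) (exists_mem (hV.trans hb)) fun j T hT hj => ?_
    rw [E.res_comp, hl _ _ _ _ _ _ j T _ hj, hl _ _ _ _ _ _ j T _ hj, a.t_res, ← Category.assoc,
      m.left]
  · refine hE.ext_of_cover (V := b.V) (exists_mem (hV.trans hb)) fun j T hT hj => ?_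
    rw [E.res_comp, hl _ _ _ _ _ _ j T _ hj, hl _ _ _ _ _ _ j T _ hj, c.t_res, Category.assoc,
      n.right]
  · have := hl i k V hV hi hk j V le_rfl hj
    rwa [E.res_self] at this

/-- Composition of morphisms of descent data. -/
def Hom.comp (hE : E.IsSep) (hb : W ≤ b.dom) (m : Hom a b W) (n : Hom b c W) : Hom a c W :=
  (m.exists_comp hE hb n).choose

lemma Hom.comp_f (hE : E.IsSep) (hb : W ≤ b.dom) (m : Hom a b W) (n : Hom b c W) (i : a.J)
    (k : c.J) (j : b.J) (V : Opens X) (hV : V ≤ W) (hi : V ≤ a.V i) (hk : V ≤ c.V k)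
    (hj : V ≤ b.V j) :
    (m.comp hE hb n).f i k V hV hi hk = m.f i j V hV hi hj ≫ n.f j k V hV hj hk :=
  (m.exists_comp hE hb n).choose_spec _ _ _ _ _ _ _ _

/-- Restriction of morphisms of descent data. -/
def Hom.restrict {W' : Opens X} (h : W' ≤ W) (m : Hom a b W) : Hom a b W' where
  f i j V hV hi hj := m.f i j V (hV.trans h) hi hj
  res i j V V' h' hV hi hj := m.res i j V V' h' (hV.trans h) hi hj
  left i i' j V hV hi hi' hj := m.left i i' j V (hV.trans h) hi hi' hj
  right i j j' V hV hi hj hj' := m.right i j j' V (hV.trans h) hi hj hj'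

end Desc

/-- The strict prestack of descent data of a separated strict prestack. A descent datum is defined
over the union of the members of its covering. -/
def stackify (hE : E.IsSep) : StrictPrestack X where
  Ob := E.Desc
  dom := Desc.dom
  cat W :=
    { Hom := fun a b => Desc.Hom a.ob b.ob W
      id := fun a => Desc.Hom.id a.ob W
      comp := fun {a b c} m n => m.comp hE b.le n
      id_comp := fun {a b} m => Desc.Hom.ext (by
        funext i j V hV hi hj
        exact (Desc.Hom.comp_f hE a.le (Desc.Hom.id a.ob W) m i j i V hV hi hj hi).trans
          (m.left _ _ _ _ _ _ _ _))
      comp_id := fun {a b} m => Desc.Hom.ext (by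
        funext i j V hV hi hj
        exact (Desc.Hom.comp_f hE b.le m (Desc.Hom.id b.ob W) i j j V hV hi hj hj).trans
          (m.right _ _ _ _ _ _ _ _))
      assoc := fun {a b c d} m n l => Desc.Hom.ext (by
        funext i j V hV hi hj
        refine Desc.Hom.f_ext hE b.ob b.le fun k V₁ h₁ hk => ?_
        refine Desc.Hom.f_ext hE c.ob c.le fun k' V₂ h₂ hk' => ?_
        rw [Desc.Hom.comp_f hE c.le _ _ _ _ k' _ _ _ _ hk', Desc.Hom.comp_f hE b.le _ _ _ _ k _ _ _
          _ (h₂.trans hk), Desc.Hom.comp_f hE b.le _ _ _ _ k _ _ _ _ (h₂.trans hk),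
          Desc.Hom.comp_f hE c.le _ _ _ _ k' _ _ _ _ hk', Category.assoc]) }
  res {W W'} h {x y hx hy} m := Desc.Hom.restrict h m
  res_self {_} _ {_ _ _ _} _ := rfl
  res_res {_ _ _} _ _ {_ _ _ _} _ := rfl
  res_id {_ _} _ {_} _ := rfl
  res_comp {W W'} h {x y z hx hy hz} m n := Desc.Hom.ext (by
    funext i j V hV hi hj
    refine Desc.Hom.f_ext (m := Desc.Hom.restrict h (m.comp hE hy n)) hE y (h.trans hy)
      fun k V₁ h₁ hk => ?_
    refine Eq.trans ?_ (Desc.Hom.comp_f hE (h.trans hy) (m.restrict h) (n.restrict h) i j k V₁ _ _ _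
      hk).symm
    exact Desc.Hom.comp_f hE hy m n i j k V₁ _ _ _ hk)


section stackify

variable (hE : E.IsSep)

lemma stackify_isSep : (stackify hE).IsSep := by
  intro W a b ha hb S s hs
  have hs' (T T' : Opens X) (h : T' ≤ T) (hT : S.mem T) (i j V) (hV : V ≤ T') (hi : V ≤ a.V i)
      (hj : V ≤ b.V j) :
      Desc.Hom.f (s T hT) i j V (hV.trans h) hi hj = Desc.Hom.f (s T' (S.down h hT)) i j V hV hi hj :=
    congrArg (fun m : Desc.Hom a b T' => m.f i j V hV hi hj) (hs T T' h hT)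
  have cov (V) (hV : V ≤ W) (p : X) (hp : p ∈ V) : ∃ T : {T // S.mem T}, p ∈ T.1 := by
    obtain ⟨T, hT, hpT⟩ := S.cov p (hV hp)
    exact ⟨⟨T, hT⟩, hpT⟩
  have key (i : a.J) (j : b.J) (V : Opens X) (hV : V ≤ W) (hi : V ≤ a.V i) (hj : V ≤ b.V j) :=
    hE.exists_glue (V := fun T : {T // S.mem T} => T.1) (cov V hV) (hx := hi.trans (a.le i))
      (hy := hj.trans (b.le j))
      (fun T V' h hT => Desc.Hom.f (s T.1 T.2) i j V' hT (h.trans hi) (h.trans hj))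
      (fun T V' V'' h hT hj => Desc.Hom.res (s T.1 T.2) _ _ _ _ _ _ _ _)
      (fun T T' V' h hT hT' => by
        rw [hs' T.1 V' hT T.2 i j V' le_rfl, hs' T'.1 V' hT' T'.2 i j V' le_rfl])
  choose l hl using key
  refine ⟨(⟨l, fun i j V V' h hV hi hj => ?_, fun i i' j V hV hi hi' hj => ?_,
    fun i j j' V hV hi hj hj' => ?_⟩ : Desc.Hom a b W), fun T hT => ?_, fun m hm => ?_⟩
  · refine hE.ext_of_cover (cov V' (h.trans hV)) fun T V'' hT hj => ?_
    rw [E.res_res, hl i j V hV hi _ T _ _ hj, hl _ _ _ _ _ _ T _ _ hj]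
  · refine hE.ext_of_cover (cov V hV) fun T V'' hT hj => ?_
    rw [E.res_comp, hl _ _ _ _ _ _ T _ _ hj, hl _ _ _ _ _ _ T _ _ hj, a.t_res]
    exact Desc.Hom.left _ _ _ _ _ _ _ _ _
  · refine hE.ext_of_cover (cov V hV) fun T V'' hT hj => ?_
    rw [E.res_comp, hl _ _ _ _ _ _ T _ _ hj, hl _ _ _ _ _ _ T _ _ hj, b.t_res]
    exact Desc.Hom.right _ _ _ _ _ _ _ _ _
  · refine Desc.Hom.ext ?_
    funext i j V hV hi hj
    refine Eq.trans ?_ (hl i j V (hV.trans (S.le hT)) hi hj ⟨T, hT⟩ V le_rfl hV)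
    exact (E.res_self _ _).symm
  · refine Desc.Hom.ext ?_
    funext i j V hV hi hj
    refine hE.ext_of_cover (cov V hV) fun T V' hT hj' => ?_
    rw [hl _ _ _ _ _ _ T _ _ hj', ← hm T.1 T.2]
    exact Desc.Hom.res m _ _ _ _ _ _ _ _

/-- The descent datum obtained from a descent datum for descent data. -/
def Desc.flatten {J : Type u} {V : J → Opens X} (x : J → E.Desc)
    (t : ∀ i j W (_ : W ≤ V i) (_ : W ≤ V j), Hom (x i) (x j) W)
    (t_res : ∀ i j W W' (h : W' ≤ W) hi hj,
      (t i j W hi hj).restrict h = t i j W' (h.trans hi) (h.trans hj))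
    (t_self : ∀ i W hi, t i i W hi hi = Hom.id _ _)
    (t_comp : ∀ i j k W hi hj hk i' j' k' (hi' : W ≤ (x i).V i') (hj' : W ≤ (x j).V j')
      (hk' : W ≤ (x k).V k'),
      (t i j W hi hj).f i' j' W le_rfl hi' hj' ≫ (t j k W hj hk).f j' k' W le_rfl hj' hk' =
        (t i k W hi hk).f i' k' W le_rfl hi' hk') : E.Desc where
  J := Σ j, (x j).J
  V j := V j.1 ⊓ (x j.1).V j.2
  x j := (x j.1).x j.2
  le j := inf_le_right.trans ((x j.1).le j.2)
  t i j W hi hj := (t i.1 j.1 W (hi.trans inf_le_left) (hj.trans inf_le_left)).f i.2 j.2 W le_rfl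
    (hi.trans inf_le_right) (hj.trans inf_le_right)
  t_res i j W W' h hi hj := by
    rw [Hom.res, ← t_res _ _ W W' h]
    rfl
  t_self i W hi := by
    rw [t_self]
    exact (x i.1).t_self _ _ _
  t_comp i j k W hi hj hk := t_comp _ _ _ _ _ _ _ _ _ _ _ _ _

lemma stackify_effective : (stackify hE).Effective := by
  intro J U V hV cov x hx t t_res t_self t_comp
  have t_res' i j W W' (h : W' ≤ W) (hi : W ≤ V i) (hj : W ≤ V j) i' j' T (hT : T ≤ W')
      (hi' : T ≤ (x i).V i') (hj' : T ≤ (x j).V j') :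
      Desc.Hom.f (t i j W' (h.trans hi) (h.trans hj)) i' j' T hT hi' hj' =
        Desc.Hom.f (t i j W hi hj) i' j' T (hT.trans h) hi' hj' :=
    congrArg (fun m : Desc.Hom (x i) (x j) W' => m.f i' j' T hT hi' hj')
      (t_res i j W W' h hi hj).symm
  have t_comp' i j k W (hi : W ≤ V i) (hj : W ≤ V j) (hk : W ≤ V k) i' j' k'
      (hi' : W ≤ (x i).V i') (hj' : W ≤ (x j).V j') (hk' : W ≤ (x k).V k') :
      Desc.Hom.f (t i j W hi hj) i' j' W le_rfl hi' hj' ≫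
        Desc.Hom.f (t j k W hj hk) j' k' W le_rfl hj' hk' =
        Desc.Hom.f (t i k W hi hk) i' k' W le_rfl hi' hk' :=
    (Desc.Hom.comp_f hE _ (t i j W hi hj) (t j k W hj hk) i' k' j' W le_rfl hi' hk' hj').symm.trans
      (congrArg (fun m : Desc.Hom (x i) (x k) W => m.f i' k' W le_rfl hi' hk')
        (t_comp i j k W hi hj hk))
  let y : E.Desc := Desc.flatten x t t_res t_self t_comp'
  have hy : U ≤ y.dom := fun p hp => by
    obtain ⟨j, hj⟩ := cov p hp
    obtain ⟨k, hk⟩ := Desc.exists_mem (hx j) p hj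
    exact Opens.mem_iSup.2 ⟨⟨j, k⟩, hj, hk⟩
  let s (j : J) : Desc.Hom (x j) y (V j) :=
    { f := fun i k T hT hi hk => Desc.Hom.f (t j k.1 T hT (hk.trans inf_le_left)) i k.2 T le_rfl hi
        (hk.trans inf_le_right)
      res := fun i k T T' h hT hi hk =>
        (Desc.Hom.res _ _ _ _ _ _ _ _ _).trans (t_res' _ _ _ _ h _ _ _ _ _ le_rfl _ _).symm
      left := fun i i' k T hT hi hi' hk => Desc.Hom.left _ _ _ _ _ _ _ _ _
      right := fun i k k' T hT hi hk hk' => t_comp' _ _ _ _ _ _ _ _ _ _ _ _ _ }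
  let s' (j : J) : Desc.Hom y (x j) (V j) :=
    { f := fun k i T hT hk hi => Desc.Hom.f (t k.1 j T (hk.trans inf_le_left) hT) k.2 i T le_rfl
        (hk.trans inf_le_right) hi
      res := fun i k T T' h hT hi hk =>
        (Desc.Hom.res _ _ _ _ _ _ _ _ _).trans (t_res' _ _ _ _ h _ _ _ _ _ le_rfl _ _).symm
      left := fun k k' i T hT hi hk hk' => t_comp' _ _ _ _ _ _ _ _ _ _ _ _ _
      right := fun k i i' T hT hi hk hk' => Desc.Hom.right _ _ _ _ _ _ _ _ _ }
  refine ⟨y, hy, fun j => ⟨s j, s' j, ?_, ?_⟩, fun i j W hi hj => ?_⟩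
  · refine Desc.Hom.ext ?_
    funext i i' T hT hi hi'
    refine Desc.Hom.f_ext hE y ((hV j).trans hy) fun k T' h hk => ?_
    refine (Desc.Hom.comp_f hE ((hV j).trans hy) (s j) (s' j) i i' k T' _ _ _ hk).trans ?_
    refine (t_comp' _ _ _ _ _ _ _ _ _ _ _ _ _).trans ?_
    rw [t_self]
    rfl
  · refine Desc.Hom.ext ?_
    funext k k' T hT hk hk'
    refine Desc.Hom.f_ext hE (x j) (hx j) fun i T' h hi => ?_
    refine (Desc.Hom.comp_f hE (hx j) (s' j) (s j) k k' i T' _ _ _ hi).trans ?_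
    exact t_comp' _ _ _ _ _ _ _ _ _ _ _ _ _
  · refine Desc.Hom.ext ?_
    funext i' k T hT hi' hk
    refine Desc.Hom.f_ext hE (x j) (hj.trans (hx j)) fun j' T' h hj' => ?_
    refine (Desc.Hom.comp_f hE (hj.trans (hx j)) (t i j W hi hj) ((s j).restrict hj) i' k j' T' _ _ _
      hj').trans ?_
    refine Eq.trans ?_ (t_comp' i j k.1 T' _ ((h.trans hT).trans hj) _ i' j' k.2 _ hj' _)
    rw [t_res' i j W T' (h.trans hT) hi hj]
    rfl

variable (E) in
/-- The descent datum given by one object. -/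
def Desc.single (x : E.Ob) : E.Desc where
  J := PUnit
  V _ := E.dom x
  x _ := x
  le _ := le_rfl
  t _ _ W hi hj := 𝟙 _
  t_res _ _ W W' h hi hj := E.res_id _ _
  t_self _ _ _ := rfl
  t_comp _ _ _ _ _ _ _ := Category.comp_id _

/-- The morphism of descent data given by one morphism. -/
def Desc.singleHom {W : Opens X} {x y : E.Ob} {hx : W ≤ E.dom x} {hy : W ≤ E.dom y}
    (f : (⟨x, hx⟩ : At E.dom W) ⟶ ⟨y, hy⟩) : Desc.Hom (Desc.single E x) (Desc.single E y) W where
  f i j V hV hi hj := E.res hV f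
  res i j V V' h hV hi hj := E.res_res _ _ _
  left i i' j V hV hi hi' hj := Category.id_comp _
  right i j j' V hV hi hj hj' := Category.comp_id _

/-- A strict prestack maps to its associated stack. -/
def toStackify : E.Map (stackify hE) where
  ob := Desc.single E
  le x := (Desc.single E x).le_dom ⟨⟩
  map {W x y hx hy} f := Desc.singleHom f
  map_id {W x} hx := Desc.Hom.ext (by
    funext i j V hV hi hj
    exact E.res_id hV _)
  map_comp {W x y z hx hy hz} f g := Desc.Hom.ext (by
    funext i j V hV hi hj
    refine (E.res_comp hV f g).trans ?_
    exact (Desc.Hom.comp_f (b := Desc.single E y) hE (hy.trans ((Desc.single E y).le_dom ⟨⟩))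
      (Desc.singleHom f) (Desc.singleHom g) i j
      ⟨⟩ V hV hi hj (hV.trans hy)).symm)
  map_res {W W'} h {x y hx hy} f := Desc.Hom.ext (by
    funext i j V hV hi hj
    exact E.res_res _ _ _)

lemma toStackify_fullyFaithful : (toStackify hE).FullyFaithful := by
  intro W x y hx hy
  refine ⟨fun f g h => ?_, fun m => ⟨Desc.Hom.f m ⟨⟩ ⟨⟩ W le_rfl hx hy, ?_⟩⟩
  · have := congrArg (fun m : Desc.Hom (Desc.single E x) (Desc.single E y) W =>
      m.f ⟨⟩ ⟨⟩ W le_rfl hx hy) h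
    exact ((E.res_self le_rfl f).symm.trans this).trans (E.res_self le_rfl g)
  · refine Desc.Hom.ext ?_
    funext i j V hV hi hj
    exact Desc.Hom.res m ⟨⟩ ⟨⟩ W V hV le_rfl hx hy

/-- A descent datum is isomorphic to each of its members, where the latter is defined. -/
def stackifyIso (a : E.Desc) (k : a.J) {W : Opens X} (hk : W ≤ a.V k) :
    (⟨a, hk.trans (a.le_dom k)⟩ : At (stackify hE).dom W) ≅
      ⟨(toStackify hE).ob (a.x k), (hk.trans (a.le k)).trans ((toStackify hE).le _)⟩ where
  hom :=
    ({ f := fun i j V hV hi hj => a.t i k V hi (hV.trans hk)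
       res := fun i j V V' h hV hi hj => a.t_res _ _ _ _ _ _ _
       left := fun i i' j V hV hi hi' hj => a.t_comp _ _ _ _ _ _ _
       right := fun i j j' V hV hi hj hj' => Category.comp_id _ } :
      Desc.Hom a (Desc.single E (a.x k)) W)
  inv :=
    ({ f := fun i j V hV hi hj => a.t k j V (hV.trans hk) hj
       res := fun i j V V' h hV hi hj => a.t_res _ _ _ _ _ _ _
       left := fun i i' j V hV hi hi' hj => Category.id_comp _
       right := fun i j j' V hV hi hj hj' => a.t_comp _ _ _ _ _ _ _ } :
      Desc.Hom (Desc.single E (a.x k)) a W)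
  hom_inv_id := Desc.Hom.ext (by
    funext i j V hV hi hj
    refine (Desc.Hom.comp_f (b := Desc.single E (a.x k)) hE
      ((hk.trans (a.le k)).trans ((toStackify hE).le _)) _ _ i j ⟨⟩ V hV hi hj
      ((hV.trans hk).trans (a.le k))).trans ?_
    exact a.t_comp _ _ _ _ _ _ _)
  inv_hom_id := Desc.Hom.ext (by
    funext i j V hV hi hj
    refine (Desc.Hom.comp_f (b := a) hE (hk.trans (a.le_dom k)) _ _ i j k V hV hi hj
      (hV.trans hk)).trans ?_
    exact (a.t_comp _ _ _ _ _ _ _).trans (a.t_self _ _ _))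

end stackify

end StrictPrestack

/-! ### Linear structures -/

namespace StrictPrestack

/-- An additive structure on a strict prestack, compatible with composition and restriction. -/
class Additive (E : StrictPrestack X) where
  preadditive (W : Opens X) : Preadditive (At E.dom W)
  res_add {W W' : Opens X} (h : W' ≤ W) {x y : E.Ob} {hx : W ≤ E.dom x} {hy : W ≤ E.dom y}
    (f g : (⟨x, hx⟩ : At E.dom W) ⟶ ⟨y, hy⟩) : E.res h (f + g) = E.res h f + E.res h g

attribute [reducible, instance] Additive.preadditive

/-- A linear structure on a strict prestack, compatible with composition and restriction. -/
class IsLin (R : RingSheaf X) (E : StrictPrestack X) [Additive E] where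
  linear (W : Opens X) : Linear (sec R W) (At E.dom W)
  res_smul {W W' : Opens X} (h : W' ≤ W) {x y : E.Ob} {hx : W ≤ E.dom x} {hy : W ≤ E.dom y}
    (r : sec R W) (f : (⟨x, hx⟩ : At E.dom W) ⟶ ⟨y, hy⟩) :
    E.res h (r • f) = secRes (homOfLE h) r • E.res h f

attribute [reducible, instance] IsLin.linear

end StrictPrestack

variable (R : RingSheaf X)

variable {R} in
lemma secRes_comp {U V W : Opens X} (f : V ⟶ U) (g : W ⟶ V) (h : W ⟶ U) (r : sec R U) :
    secRes g (secRes f r) = secRes h r := by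
  obtain rfl : h = g ≫ f := Subsingleton.elim _ _
  change _ = (R.obj.map (f.op ≫ g.op)).hom r
  rw [R.obj.map_comp]
  rfl

namespace Cleavage

open StrictPrestack

variable {E : StrictPrestack X} (K : Cleavage E) [E.Additive] [IsLin R E]

instance (U : Opens X) : Preadditive (K.Fib U) where
  homGroup b b' := inferInstanceAs (AddCommGroup ((⟨K.ι (U := U) b, K.le (U := U) b⟩ : At E.dom U) ⟶
    ⟨K.ι (U := U) b', K.le (U := U) b'⟩))
  add_comp _ _ _ f f' g := Preadditive.add_comp (C := At E.dom U) _ _ _ f f' g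
  comp_add _ _ _ f g g' := Preadditive.comp_add (C := At E.dom U) _ _ _ f g g'

instance (U : Opens X) : Linear (sec R U) (K.Fib U) where
  homModule b b' := inferInstanceAs (Module (sec R U)
    ((⟨K.ι (U := U) b, K.le (U := U) b⟩ : At E.dom U) ⟶ ⟨K.ι (U := U) b', K.le (U := U) b'⟩))
  smul_comp _ _ _ r f g := Linear.smul_comp (C := At E.dom U) _ _ _ r f g
  comp_smul _ _ _ f r g := Linear.comp_smul (C := At E.dom U) _ _ _ f r g

/-- The linear prestack defined by a cleavage of a linear strict prestack. -/
def linearPrestack : LinearPrestack R where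
  carrier := K.prestack
  preadditive U := inferInstanceAs (Preadditive (K.Fib U))
  linear U := inferInstanceAs (Linear (sec R U) (K.Fib U))
  res_add {U V} f {p q} s t := by
    have h := Additive.res_add (E := E) f.le (x := K.ι (U := U) p) (y := K.ι (U := U) q) s t
    refine (congrArg (fun k => (K.c (U := U) f.le p).hom ≫ k ≫ (K.c (U := U) f.le q).inv) h).trans ?_
    rw [Preadditive.add_comp, Preadditive.comp_add]
    rfl
  res_smul {U V} f {p q} r s := by
    have h := IsLin.res_smul (E := E) f.le (x := K.ι (U := U) p) (y := K.ι (U := U) q) r s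
    refine (congrArg (fun k => (K.c (U := U) f.le p).hom ≫ k ≫ (K.c (U := U) f.le q).inv) h).trans ?_
    rw [Linear.smul_comp, Linear.comp_smul]
    rfl

end Cleavage

namespace StrictPrestack

variable {E : StrictPrestack X}

namespace Desc.Hom

variable {a b c : E.Desc} {W : Opens X}

section

variable [E.Additive]

instance : Zero (Hom a b W) where
  zero :=
    { f := fun _ _ _ _ _ _ => 0
      res := fun i j V V' h hV hi hj => by
        have := Additive.res_add h
          (0 : (⟨a.x i, hi.trans (a.le i)⟩ : At E.dom V) ⟶ ⟨b.x j, hj.trans (b.le j)⟩) 0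
        rwa [add_zero, left_eq_add] at this
      left := fun _ _ _ _ _ _ _ _ => Limits.comp_zero
      right := fun _ _ _ _ _ _ _ _ => Limits.zero_comp }

instance instAdd : Add (Hom a b W) where
  add m n :=
    { f := fun i j V hV hi hj => m.f i j V hV hi hj + n.f i j V hV hi hj
      res := fun i j V V' h hV hi hj => by rw [Additive.res_add, m.res, n.res]
      left := fun i i' j V hV hi hi' hj => by rw [Preadditive.comp_add, m.left, n.left]
      right := fun i j j' V hV hi hj hj' => by rw [Preadditive.add_comp, m.right, n.right] }

lemma add_f (m n : Hom a b W) (i j V hV hi hj) :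
    (m + n).f i j V hV hi hj = m.f i j V hV hi hj + n.f i j V hV hi hj := rfl

lemma res_neg' {E : StrictPrestack X} [E.Additive] {W W' : Opens X} (h : W' ≤ W) {x y : E.Ob}
    {hx : W ≤ E.dom x} {hy : W ≤ E.dom y} (f : (⟨x, hx⟩ : At E.dom W) ⟶ ⟨y, hy⟩) :
    E.res h (-f) = - E.res h f := by
  have h₀ := Additive.res_add h (0 : (⟨x, hx⟩ : At E.dom W) ⟶ ⟨y, hy⟩) 0
  rw [add_zero, left_eq_add] at h₀
  rw [eq_neg_iff_add_eq_zero, ← Additive.res_add, neg_add_cancel, h₀]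

instance : Neg (Hom a b W) where
  neg m :=
    { f := fun i j V hV hi hj => - m.f i j V hV hi hj
      res := fun i j V V' h hV hi hj => by rw [res_neg', m.res]
      left := fun i i' j V hV hi hi' hj => by rw [Preadditive.comp_neg, m.left]
      right := fun i j j' V hV hi hj hj' => by rw [Preadditive.neg_comp, m.right] }

instance instAddCommGroup : AddCommGroup (Hom a b W) where
  toAddGroup := AddGroup.ofLeftAxioms
    (fun m n l => Hom.ext (by funext i j V hV hi hj; exact add_assoc _ _ _))
    (fun m => Hom.ext (by funext i j V hV hi hj; exact zero_add _))
    (fun m => Hom.ext (by funext i j V hV hi hj; exact neg_add_cancel _))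
  add_comm m n := Hom.ext (by funext i j V hV hi hj; exact add_comm _ _)

end

variable {R} [E.Additive] [IsLin R E]

instance instSMul : SMul (sec R W) (Hom a b W) where
  smul r m :=
    { f := fun i j V hV hi hj => secRes (homOfLE hV) r • m.f i j V hV hi hj
      res := fun i j V V' h hV hi hj => by
        rw [IsLin.res_smul, m.res, secRes_comp _ _ (homOfLE (h.trans hV))]
      left := fun i i' j V hV hi hi' hj => by rw [Linear.comp_smul, m.left]
      right := fun i j j' V hV hi hj hj' => by rw [Linear.smul_comp, m.right] }

lemma smul_f (r : sec R W) (m : Hom a b W) (i j V hV hi hj) :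
    (r • m).f i j V hV hi hj = secRes (homOfLE hV) r • m.f i j V hV hi hj := rfl

instance instModule : Module (sec R W) (Hom a b W) where
  one_smul m := Hom.ext (by
    funext i j V hV hi hj
    rw [smul_f, map_one, one_smul])
  mul_smul r s m := Hom.ext (by
    funext i j V hV hi hj
    rw [smul_f, smul_f, smul_f, map_mul, mul_smul])
  smul_zero r := Hom.ext (by
    funext i j V hV hi hj
    exact smul_zero _)
  smul_add r m n := Hom.ext (by
    funext i j V hV hi hj
    rw [add_f, smul_f, smul_f, smul_f, add_f, smul_add])
  add_smul r s m := Hom.ext (by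
    funext i j V hV hi hj
    rw [add_f, smul_f, smul_f, smul_f, map_add, add_smul])
  zero_smul m := Hom.ext (by
    funext i j V hV hi hj
    rw [smul_f, map_zero, zero_smul]
    rfl)

end Desc.Hom

variable (hE : E.IsSep) [E.Additive]

instance stackifyAdditive : (stackify hE).Additive where
  preadditive W :=
    { homGroup := fun a b => Desc.Hom.instAddCommGroup (E := E) (a := a.ob) (b := b.ob) (W := W)
      add_comp := fun a b c m m' n => Desc.Hom.ext (by
        funext i j V hV hi hj
        refine Desc.Hom.f_ext (m := Desc.Hom.comp hE b.le (Desc.Hom.instAdd.add m m') n) hE b.ob b.le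
          fun k V' h hk => ?_
        refine (Desc.Hom.comp_f hE b.le _ n i j k V' _ _ _ hk).trans
          ((Preadditive.add_comp _ _ _ _ _ _).trans ?_)
        exact (congrArg₂ (fun k l => k + l) (Desc.Hom.comp_f hE b.le m n i j k V' _ _ _ hk)
          (Desc.Hom.comp_f hE b.le m' n i j k V' _ _ _ hk)).symm)
      comp_add := fun a b c m n n' => Desc.Hom.ext (by
        funext i j V hV hi hj
        refine Desc.Hom.f_ext (m := Desc.Hom.comp hE b.le m (Desc.Hom.instAdd.add n n')) hE b.ob b.le
          fun k V' h hk => ?_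
        refine (Desc.Hom.comp_f hE b.le m _ i j k V' _ _ _ hk).trans
          ((Preadditive.comp_add _ _ _ _ _ _).trans ?_)
        exact (congrArg₂ (fun k l => k + l) (Desc.Hom.comp_f hE b.le m n i j k V' _ _ _ hk)
          (Desc.Hom.comp_f hE b.le m n' i j k V' _ _ _ hk)).symm) }
  res_add _ _ _ _ _ _ _ := rfl

instance stackifyIsLin [IsLin R E] : IsLin R (stackify hE) where
  linear W :=
    { homModule := fun a b => Desc.Hom.instModule (E := E) (a := a.ob) (b := b.ob) (W := W)
      smul_comp := fun a b c r m n => Desc.Hom.ext (by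
        funext i j V hV hi hj
        refine Desc.Hom.f_ext (m := Desc.Hom.comp hE b.le (Desc.Hom.instSMul.smul r m) n) hE b.ob b.le
          fun k V' h hk => ?_
        refine (Desc.Hom.comp_f hE b.le _ n i j k V' _ _ _ hk).trans
          ((Linear.smul_comp _ _ _ _ _ _).trans ?_)
        exact (congrArg (fun k => _ • k) (Desc.Hom.comp_f hE b.le m n i j k V' _ _ _ hk)).symm)
      comp_smul := fun a b c m r n => Desc.Hom.ext (by
        funext i j V hV hi hj
        refine Desc.Hom.f_ext (m := Desc.Hom.comp hE b.le m (Desc.Hom.instSMul.smul r n)) hE b.ob b.le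
          fun k V' h hk => ?_
        refine (Desc.Hom.comp_f hE b.le m _ i j k V' _ _ _ hk).trans
          ((Linear.comp_smul _ _ _ _ _ _).trans ?_)
        exact (congrArg (fun k => _ • k) (Desc.Hom.comp_f hE b.le m n i j k V' _ _ _ hk)).symm) }
  res_smul h _ _ _ _ r m := Desc.Hom.ext (by
    funext i j V hV hi hj
    exact congrArg (fun s => s • _) (secRes_comp _ _ _ r).symm)

end StrictPrestack

/-! ### Twisted morphisms -/

namespace StrictPrestack

variable (R : RingSheaf X) (E : StrictPrestack X)

/-- Algebroid data over a strict prestack `E`: a sheaf of algebras `S y` for every object `y` of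
`E`, an action of the morphisms of `E` on these algebras, and elements `L φ` of `S y` for the
endomorphisms `φ` of `y`. -/
structure AlgData where
  /-- the sections over `W` of the algebra attached to an object -/
  S {W : Opens X} (y : At E.dom W) : Type u
  ring {W : Opens X} (y : At E.dom W) : Ring (S y)
  /-- restriction of sections -/
  res {W W' : Opens X} (h : W' ≤ W) {y : E.Ob} {hy : W ≤ E.dom y} :
    S (⟨y, hy⟩ : At E.dom W) →+* S (⟨y, h.trans hy⟩ : At E.dom W')
  res_self {W : Opens X} (h : W ≤ W) {y : E.Ob} {hy : W ≤ E.dom y}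
    (a : S (⟨y, hy⟩ : At E.dom W)) : res h a = a
  res_res {W W' W'' : Opens X} (h : W' ≤ W) (h' : W'' ≤ W') {y : E.Ob} {hy : W ≤ E.dom y}
    (a : S (⟨y, hy⟩ : At E.dom W)) : res h' (res h a) = res (h'.trans h) a
  glue {W : Opens X} {y : E.Ob} (hy : W ≤ E.dom y) (C : Cov W)
    (s : ∀ V (hV : C.mem V), S (⟨y, (C.le hV).trans hy⟩ : At E.dom V))
    (_ : ∀ V V' (h : V' ≤ V) (hV : C.mem V), res h (s V hV) = s V' (C.down h hV)) :
    ∃! t : S (⟨y, hy⟩ : At E.dom W), ∀ V (hV : C.mem V), res (C.le hV) t = s V hV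
  /-- the structural morphism -/
  str {W : Opens X} (y : At E.dom W) : sec R W →+* S y
  str_res {W W' : Opens X} (h : W' ≤ W) {y : E.Ob} {hy : W ≤ E.dom y} (r : sec R W) :
    res h (str ⟨y, hy⟩ r) = str ⟨y, h.trans hy⟩ (secRes (homOfLE h) r)
  central {W : Opens X} (y : At E.dom W) (r : sec R W) (a : S y) : str y r * a = a * str y r
  /-- the action of morphisms -/
  act {W : Opens X} {x y : At E.dom W} (g : x ⟶ y) : S x →+* S y
  act_id {W : Opens X} {x : At E.dom W} (a : S x) : act (𝟙 x) a = a
  act_comp {W : Opens X} {x y z : At E.dom W} (f : x ⟶ y) (g : y ⟶ z) (a : S x) :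
    act (f ≫ g) a = act g (act f a)
  act_res {W W' : Opens X} (h : W' ≤ W) {x y : E.Ob} {hx : W ≤ E.dom x} {hy : W ≤ E.dom y}
    (g : (⟨x, hx⟩ : At E.dom W) ⟶ ⟨y, hy⟩) (a : S (⟨x, hx⟩ : At E.dom W)) :
    res h (act g a) = act (E.res h g) (res h a)
  act_str {W : Opens X} {x y : At E.dom W} (g : x ⟶ y) (r : sec R W) : act g (str x r) = str y r
  /-- the elements attached to endomorphisms -/
  L {W : Opens X} {x : At E.dom W} (φ : x ⟶ x) : S x
  L_id {W : Opens X} (x : At E.dom W) : L (𝟙 x) = 1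
  L_comp {W : Opens X} {x : At E.dom W} (φ ψ : x ⟶ x) : L (φ ≫ ψ) = L ψ * L φ
  L_res {W W' : Opens X} (h : W' ≤ W) {x : E.Ob} {hx : W ≤ E.dom x}
    (φ : (⟨x, hx⟩ : At E.dom W) ⟶ ⟨x, hx⟩) : res h (L φ) = L (E.res h φ)
  act_mul_L {W : Opens X} {x : At E.dom W} (φ : x ⟶ x) (a : S x) : act φ a * L φ = L φ * a
  L_conj {W : Opens X} {x y : At E.dom W} (g : x ≅ y) (φ : x ⟶ x) :
    L (g.inv ≫ φ ≫ g.hom) = act g.hom (L φ)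

attribute [instance] AlgData.ring

/-- Any two objects are locally connected by a morphism. -/
def LocConn : Prop :=
  ∀ ⦃W : Opens X⦄ ⦃x y : E.Ob⦄ (hx : W ≤ E.dom x) (hy : W ≤ E.dom y), ∀ p ∈ W,
    ∃ (V : Opens X) (hV : V ≤ W), p ∈ V ∧
      Nonempty ((⟨x, hV.trans hx⟩ : At E.dom V) ⟶ ⟨y, hV.trans hy⟩)

variable {R E}

lemma res_inv [∀ W, IsGroupoid (At E.dom W)] {W W' : Opens X} (h : W' ≤ W) {x y : E.Ob}
    {hx : W ≤ E.dom x} {hy : W ≤ E.dom y} (f : (⟨x, hx⟩ : At E.dom W) ⟶ ⟨y, hy⟩) :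
    E.res h (inv f) = inv (E.res h f) := by
  rw [← cancel_epi (E.res h f), ← E.res_comp, IsIso.hom_inv_id, IsIso.hom_inv_id, E.res_id]

namespace AlgData

variable (D : E.AlgData R)

attribute [simp] AlgData.res_self AlgData.res_res AlgData.act_id AlgData.L_id

/-- Sections which are locally equal are equal. -/
lemma ext_loc {W : Opens X} {y : E.Ob} {hy : W ≤ E.dom y} {s t : D.S (⟨y, hy⟩ : At E.dom W)}
    (h : ∀ p ∈ W, ∃ (V : Opens X) (hV : V ≤ W), p ∈ V ∧ D.res hV s = D.res hV t) : s = t := by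
  let C : Cov W :=
    { mem := fun V => ∃ hV : V ≤ W, D.res hV s = D.res hV t
      le := fun ⟨h, _⟩ => h
      down := fun {V V'} h ⟨hV, e⟩ => ⟨h.trans hV, by rw [← D.res_res hV h, e, D.res_res]⟩
      cov := fun p hp => by
        obtain ⟨V, hV, hpV, e⟩ := h p hp
        exact ⟨V, ⟨hV, e⟩, hpV⟩ }
  exact (D.glue hy C (fun V hV => D.res (C.le hV) t) (fun V V' h hV => D.res_res _ _ _)).unique
    (fun V hV => hV.2) (fun V hV => rfl)

/-- The elements `L φ` are invertible. -/
lemma L_inv_mul [∀ W, IsGroupoid (At E.dom W)] {W : Opens X} {x : At E.dom W} (φ : x ⟶ x) :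
    D.L (inv φ) * D.L φ = 1 := by
  rw [← D.L_comp, IsIso.hom_inv_id, D.L_id]

/-- Twisted morphisms from `x` to `y` over `W`: equivariant functions on the morphisms from `x` to
`y`, with values in the algebra of `y`. They are the sections of the contracted product of the
algebra of `y` and of the morphisms from `x` to `y`: the class `[a, g]` is the equivariant function
whose value at `g` is `a`. There may be no morphism from `x` to `y` over `W`, but there are some
locally, and an equivariant function is determined by its value at one of them. -/
@[ext]
structure Tw (x y : E.Ob) (W : Opens X) (hx : W ≤ E.dom x) (hy : W ≤ E.dom y) where
  /-- the value at a morphism -/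
  val (V : Opens X) (hV : V ≤ W) (k : (⟨x, hV.trans hx⟩ : At E.dom V) ⟶ ⟨y, hV.trans hy⟩) :
    D.S (⟨y, hV.trans hy⟩ : At E.dom V)
  val_res (V V' : Opens X) (h : V' ≤ V) (hV : V ≤ W)
    (k : (⟨x, hV.trans hx⟩ : At E.dom V) ⟶ ⟨y, hV.trans hy⟩) :
    D.res h (val V hV k) = val V' (h.trans hV) (E.res h k)
  val_comp (V : Opens X) (hV : V ≤ W) (k : (⟨x, hV.trans hx⟩ : At E.dom V) ⟶ ⟨y, hV.trans hy⟩)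
    (φ : (⟨y, hV.trans hy⟩ : At E.dom V) ⟶ ⟨y, hV.trans hy⟩) :
    val V hV (k ≫ φ) * D.L φ = val V hV k

variable {D}

namespace Tw

variable {x y z w : E.Ob} {W : Opens X} {hx : W ≤ E.dom x} {hy : W ≤ E.dom y} {hz : W ≤ E.dom z}
  {hw : W ≤ E.dom w}

/-- Twisted morphisms may be compared locally, assuming the existence of a morphism from `x` to
`y`. -/
lemma ext_loc (hc : E.LocConn) (y : E.Ob) (hy : W ≤ E.dom y) {s t : D.Tw x z W hx hz}
    (h : ∀ V (hV : V ≤ W) k (m : (⟨x, hV.trans hx⟩ : At E.dom V) ⟶ ⟨y, hV.trans hy⟩),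
      s.val V hV k = t.val V hV k) : s = t := by
  ext V hV k
  refine D.ext_loc fun p hp => ?_
  obtain ⟨T, hT, hpT, ⟨m⟩⟩ := hc (hV.trans hx) (hV.trans hy) p hp
  refine ⟨T, hT, hpT, ?_⟩
  rw [s.val_res, t.val_res, h T (hT.trans hV) _ m]

/-- Restriction of twisted morphisms. -/
@[simps]
def restrict {W' : Opens X} (h : W' ≤ W) (s : D.Tw x y W hx hy) :
    D.Tw x y W' (h.trans hx) (h.trans hy) where
  val V hV k := s.val V (hV.trans h) k
  val_res V V' h' hV k := s.val_res V V' h' (hV.trans h) k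
  val_comp V hV k φ := s.val_comp V (hV.trans h) k φ

instance : Zero (D.Tw x y W hx hy) where
  zero :=
    { val := fun _ _ _ => 0
      val_res := fun _ _ _ _ _ => map_zero _
      val_comp := fun _ _ _ _ => zero_mul _ }

instance instAdd : Add (D.Tw x y W hx hy) where
  add s t :=
    { val := fun V hV k => s.val V hV k + t.val V hV k
      val_res := fun V V' h hV k => by rw [map_add, s.val_res, t.val_res]
      val_comp := fun V hV k φ => by rw [add_mul, s.val_comp, t.val_comp] }

lemma add_val (s t : D.Tw x y W hx hy) (V hV k) :
    (s + t).val V hV k = s.val V hV k + t.val V hV k := rfl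

instance : Neg (D.Tw x y W hx hy) where
  neg s :=
    { val := fun V hV k => - s.val V hV k
      val_res := fun V V' h hV k => by rw [map_neg, s.val_res]
      val_comp := fun V hV k φ => by rw [neg_mul, s.val_comp] }

instance instAddCommGroup : AddCommGroup (D.Tw x y W hx hy) where
  toAddGroup := AddGroup.ofLeftAxioms
    (fun m n l => Tw.ext (by funext V hV k; exact add_assoc _ _ _))
    (fun m => Tw.ext (by funext V hV k; exact zero_add _))
    (fun m => Tw.ext (by funext V hV k; exact neg_add_cancel _))
  add_comm m n := Tw.ext (by funext V hV k; exact add_comm _ _)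

instance instSMul : SMul (sec R W) (D.Tw x y W hx hy) where
  smul r s :=
    { val := fun V hV k => D.str _ (secRes (homOfLE hV) r) * s.val V hV k
      val_res := fun V V' h hV k => by
        rw [map_mul, s.val_res, D.str_res, secRes_comp _ _ (homOfLE (h.trans hV))]
      val_comp := fun V hV k φ => by rw [mul_assoc, s.val_comp] }

lemma smul_val (r : sec R W) (s : D.Tw x y W hx hy) (V hV k) :
    (r • s).val V hV k = D.str _ (secRes (homOfLE hV) r) * s.val V hV k := rfl

instance instModule : Module (sec R W) (D.Tw x y W hx hy) where
  one_smul s := Tw.ext (by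
    funext V hV k
    rw [smul_val, map_one, map_one, one_mul])
  mul_smul r s m := Tw.ext (by
    funext V hV k
    rw [smul_val, smul_val, smul_val, map_mul, map_mul, mul_assoc])
  smul_zero r := Tw.ext (by
    funext V hV k
    exact mul_zero _)
  smul_add r m n := Tw.ext (by
    funext V hV k
    rw [add_val, smul_val, smul_val, smul_val, add_val, mul_add])
  add_smul r s m := Tw.ext (by
    funext V hV k
    rw [add_val, smul_val, smul_val, smul_val, map_add, map_add, add_mul])
  zero_smul m := Tw.ext (by
    funext V hV k
    rw [smul_val, map_zero, map_zero, zero_mul]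
    rfl)

variable [∀ W, IsGroupoid (At E.dom W)]

variable (D) in
/-- The class of a pair: the function whose value at `g` is `a`. -/
@[simps]
def cls (a : D.S (⟨y, hy⟩ : At E.dom W)) (g : (⟨x, hx⟩ : At E.dom W) ⟶ ⟨y, hy⟩) :
    D.Tw x y W hx hy where
  val V hV k := D.res hV a * D.L (inv k ≫ E.res hV g)
  val_res V V' h hV k := by simp [D.L_res, res_inv]
  val_comp V hV k φ := by
    rw [IsIso.inv_comp, Category.assoc, D.L_comp, mul_assoc, mul_assoc, D.L_inv_mul, mul_one]

/-- The value at the precomposition of a morphism with an automorphism. -/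
lemma val_comp_left (s : D.Tw x y W hx hy) {V : Opens X} (hV : V ≤ W)
    (ψ : (⟨x, hV.trans hx⟩ : At E.dom V) ⟶ ⟨x, hV.trans hx⟩)
    (k : (⟨x, hV.trans hx⟩ : At E.dom V) ⟶ ⟨y, hV.trans hy⟩) :
    s.val V hV (ψ ≫ k) * D.act k (D.L ψ) = s.val V hV k := by
  have h := s.val_comp V hV k (inv k ≫ ψ ≫ k)
  rw [IsIso.hom_inv_id_assoc] at h
  rw [← h]
  exact congrArg (fun l => _ * l) (D.L_conj (asIso k) ψ).symm

/-- The composition does not depend on the factorization. -/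
lemma comp_indep (s' : D.Tw x y W hx hy) (s : D.Tw y z W hy hz) {V : Opens X} (hV : V ≤ W)
    (h : (⟨x, hV.trans hx⟩ : At E.dom V) ⟶ ⟨y, hV.trans hy⟩)
    (g : (⟨y, hV.trans hy⟩ : At E.dom V) ⟶ ⟨z, hV.trans hz⟩)
    (ψ : (⟨y, hV.trans hy⟩ : At E.dom V) ⟶ ⟨y, hV.trans hy⟩) :
    s.val V hV (inv ψ ≫ g) * D.act (inv ψ ≫ g) (s'.val V hV (h ≫ ψ)) =
      s.val V hV g * D.act g (s'.val V hV h) := by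
  have h₁ : D.act (inv ψ) (s'.val V hV (h ≫ ψ)) = D.L (inv ψ) * s'.val V hV h := by
    rw [← s'.val_comp V hV h ψ, ← mul_assoc, ← D.act_mul_L, mul_assoc, D.L_inv_mul, mul_one]
  rw [D.act_comp, h₁, map_mul, ← mul_assoc, s.val_comp_left]

/-- The composition of two twisted morphisms exists: its value at `k` is glued from the values at the
factorizations `k = h ≫ g`, which exist locally. -/
lemma exists_comp (hc : E.LocConn) (s' : D.Tw x y W hx hy) (s : D.Tw y z W hy hz) :
    ∃ l : D.Tw x z W hx hz, ∀ V hV (h : (⟨x, hV.trans hx⟩ : At E.dom V) ⟶ ⟨y, hV.trans hy⟩)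
      (g : (⟨y, hV.trans hy⟩ : At E.dom V) ⟶ ⟨z, hV.trans hz⟩),
      l.val V hV (h ≫ g) = s.val V hV g * D.act g (s'.val V hV h) := by
  have indep {V : Opens X} (hV : V ≤ W)
      {h h' : (⟨x, hV.trans hx⟩ : At E.dom V) ⟶ ⟨y, hV.trans hy⟩}
      {g g' : (⟨y, hV.trans hy⟩ : At E.dom V) ⟶ ⟨z, hV.trans hz⟩} (e : h ≫ g = h' ≫ g') :
      s.val V hV g * D.act g (s'.val V hV h) = s.val V hV g' * D.act g' (s'.val V hV h') := by
    have := comp_indep s' s hV h g (inv h ≫ h')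
    rw [IsIso.hom_inv_id_assoc, IsIso.inv_comp, IsIso.inv_inv, Category.assoc, e,
      IsIso.inv_hom_id_assoc] at this
    exact this.symm
  have key (V : Opens X) (hV : V ≤ W) (k : (⟨x, hV.trans hx⟩ : At E.dom V) ⟶ ⟨z, hV.trans hz⟩) :
      ∃ l : D.S (⟨z, hV.trans hz⟩ : At E.dom V), ∀ V' (hV' : V' ≤ V)
        (h : (⟨x, (hV'.trans hV).trans hx⟩ : At E.dom V') ⟶ ⟨y, (hV'.trans hV).trans hy⟩)
        (g : (⟨y, (hV'.trans hV).trans hy⟩ : At E.dom V') ⟶ ⟨z, (hV'.trans hV).trans hz⟩),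
        h ≫ g = E.res hV' k → D.res hV' l =
          s.val V' (hV'.trans hV) g * D.act g (s'.val V' (hV'.trans hV) h) := by
    let C : Cov V :=
      { mem := fun V' => ∃ hV' : V' ≤ V, Nonempty
          ((⟨x, (hV'.trans hV).trans hx⟩ : At E.dom V') ⟶ ⟨y, (hV'.trans hV).trans hy⟩)
        le := fun h => h.1
        down := fun h ⟨hV', ⟨m⟩⟩ => ⟨h.trans hV', ⟨E.res h m⟩⟩
        cov := fun p hp => by
          obtain ⟨V', hV', hpV', hm⟩ := hc (hV.trans hx) (hV.trans hy) p hp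
          exact ⟨V', ⟨hV', hm⟩, hpV'⟩ }
    obtain ⟨l, hl, -⟩ := D.glue (hV.trans hz) C
      (fun V' hV' => s.val V' (hV'.1.trans hV) (inv hV'.2.some ≫ E.res hV'.1 k) *
        D.act (inv hV'.2.some ≫ E.res hV'.1 k) (s'.val V' (hV'.1.trans hV) hV'.2.some))
      (fun V' V'' h' hV' => by
        rw [map_mul, s.val_res, D.act_res, s'.val_res]
        apply indep
        simp [res_inv])
    refine ⟨l, fun V' hV' h g e => ?_⟩
    rw [hl V' ⟨hV', ⟨h⟩⟩]
    apply indep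
    rw [IsIso.hom_inv_id_assoc, e]
  choose l hl using key
  have hl' V hV (h : (⟨x, hV.trans hx⟩ : At E.dom V) ⟶ ⟨y, hV.trans hy⟩)
      (g : (⟨y, hV.trans hy⟩ : At E.dom V) ⟶ ⟨z, hV.trans hz⟩) :
      l V hV (h ≫ g) = s.val V hV g * D.act g (s'.val V hV h) := by
    have := hl V hV (h ≫ g) V le_rfl h g (E.res_self _ _).symm
    rwa [D.res_self] at this
  refine ⟨⟨l, fun V V' h hV k => ?_, fun V hV k φ => ?_⟩, hl'⟩
  · refine D.ext_loc fun p hp => ?_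
    obtain ⟨T, hT, hpT, ⟨m⟩⟩ := hc ((h.trans hV).trans hx) ((h.trans hV).trans hy) p hp
    refine ⟨T, hT, hpT, ?_⟩
    rw [D.res_res, hl V hV k T (hT.trans h) m (inv m ≫ E.res _ k) (by simp),
      hl V' _ _ T hT m (inv m ≫ E.res (hT.trans h) k) (by simp)]
  · refine D.ext_loc fun p hp => ?_
    obtain ⟨T, hT, hpT, ⟨m⟩⟩ := hc (hV.trans hx) (hV.trans hy) p hp
    refine ⟨T, hT, hpT, ?_⟩
    have h₁ := s.val_comp T (hT.trans hV) (inv m ≫ E.res hT k) (E.res hT φ)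
    rw [Category.assoc] at h₁
    rw [map_mul, hl V hV _ T hT m (inv m ≫ E.res _ k ≫ E.res hT φ) (by simp),
      hl V hV k T _ m (inv m ≫ E.res _ k) (by simp), D.L_res, ← h₁, mul_assoc, mul_assoc,
      ← D.act_mul_L, ← D.act_comp, Category.assoc]

/-- Composition of twisted morphisms. -/
def comp (hc : E.LocConn) (s' : D.Tw x y W hx hy) (s : D.Tw y z W hy hz) : D.Tw x z W hx hz :=
  (exists_comp hc s' s).choose

lemma comp_val (hc : E.LocConn) (s' : D.Tw x y W hx hy) (s : D.Tw y z W hy hz) {V : Opens X}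
    (hV : V ≤ W) (h : (⟨x, hV.trans hx⟩ : At E.dom V) ⟶ ⟨y, hV.trans hy⟩)
    (g : (⟨y, hV.trans hy⟩ : At E.dom V) ⟶ ⟨z, hV.trans hz⟩) :
    (comp hc s' s).val V hV (h ≫ g) = s.val V hV g * D.act g (s'.val V hV h) :=
  (exists_comp hc s' s).choose_spec _ _ _ _

lemma comp_val' (hc : E.LocConn) (s' : D.Tw x y W hx hy) (s : D.Tw y z W hy hz) {V : Opens X}
    (hV : V ≤ W) (h : (⟨x, hV.trans hx⟩ : At E.dom V) ⟶ ⟨y, hV.trans hy⟩)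
    (k : (⟨x, hV.trans hx⟩ : At E.dom V) ⟶ ⟨z, hV.trans hz⟩) :
    (comp hc s' s).val V hV k =
      s.val V hV (inv h ≫ k) * D.act (inv h ≫ k) (s'.val V hV h) := by
  rw [← comp_val, IsIso.hom_inv_id_assoc]

/-- The identity twisted morphism. -/
def id (x : E.Ob) (W : Opens X) (hx : W ≤ E.dom x) : D.Tw x x W hx hx := cls D 1 (𝟙 _)

lemma restrict_cls {W' : Opens X} (h : W' ≤ W) (a : D.S (⟨y, hy⟩ : At E.dom W))
    (g : (⟨x, hx⟩ : At E.dom W) ⟶ ⟨y, hy⟩) :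
    (cls D a g).restrict h = cls D (D.res h a) (E.res h g) := by
  ext V hV k
  simp

lemma restrict_comp (hc : E.LocConn) {W' : Opens X} (h : W' ≤ W) (s' : D.Tw x y W hx hy)
    (s : D.Tw y z W hy hz) :
    (comp hc s' s).restrict h = comp hc (s'.restrict h) (s.restrict h) :=
  ext_loc hc y (h.trans hy) fun V hV k m => by
    rw [restrict_val, comp_val' hc s' s (hV.trans h) m, comp_val' hc _ _ hV m, restrict_val,
      restrict_val]

lemma id_comp (hc : E.LocConn) (s : D.Tw x y W hx hy) : comp hc (id x W hx) s = s := by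
  ext V hV k
  rw [comp_val' hc _ _ hV (𝟙 _)]
  simp [id]

lemma comp_id (hc : E.LocConn) (s : D.Tw x y W hx hy) : comp hc s (id y W hy) = s := by
  ext V hV k
  rw [comp_val' hc _ _ hV k]
  simp [id]

lemma assoc (hc : E.LocConn) (s : D.Tw x y W hx hy) (t : D.Tw y z W hy hz) (r : D.Tw z w W hz hw) :
    comp hc (comp hc s t) r = comp hc s (comp hc t r) :=
  ext_loc hc y hy fun V hV k m => by
    refine D.ext_loc fun p hp => ?_
    obtain ⟨T, hT, hpT, ⟨n⟩⟩ := hc (hV.trans hy) (hV.trans hz) p hp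
    refine ⟨T, hT, hpT, ?_⟩
    rw [val_res, val_res]
    obtain ⟨k', hk'⟩ : ∃ k', E.res hT k = E.res hT m ≫ n ≫ k' :=
      ⟨inv n ≫ inv (E.res hT m) ≫ E.res hT k, by simp⟩
    rw [hk', comp_val, comp_val, ← Category.assoc, comp_val, comp_val, map_mul, D.act_comp,
      mul_assoc]

end Tw

end AlgData

variable (D : E.AlgData R) [∀ W, IsGroupoid (At E.dom W)] (hc : E.LocConn)

/-- The strict prestack of twisted morphisms. -/
def AlgData.twist : StrictPrestack X where
  Ob := E.Ob
  dom := E.dom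
  cat W :=
    { Hom := fun a b => D.Tw a.ob b.ob W a.le b.le
      id := fun a => Tw.id a.ob W a.le
      comp := fun s t => Tw.comp hc s t
      id_comp := fun s => Tw.id_comp hc s
      comp_id := fun s => Tw.comp_id hc s
      assoc := fun s t r => Tw.assoc hc s t r }
  res {W W'} h {_ _ _ _} s := Tw.restrict h s
  res_self {_} _ {_ _ _ _} _ := rfl
  res_res {_ _ _} _ _ {_ _ _ _} _ := rfl
  res_id {W W'} h {x} hx := (Tw.restrict_cls h _ _).trans (by rw [map_one, E.res_id]; rfl)
  res_comp {W W'} h {x y z hx hy hz} s t := Tw.restrict_comp hc h s t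

namespace AlgData

namespace Tw

variable {D} {x y z : E.Ob} {W : Opens X} {hx : W ≤ E.dom x} {hy : W ≤ E.dom y} {hz : W ≤ E.dom z}

/-- Two pairs have the same class when they are related by the automorphism `inv g ≫ h`. -/
lemma cls_eq_iff (a b : D.S (⟨y, hy⟩ : At E.dom W)) (g h : (⟨x, hx⟩ : At E.dom W) ⟶ ⟨y, hy⟩) :
    cls D a g = cls D b h ↔ a = b * D.L (inv g ≫ h) := by
  constructor
  · intro e
    have := congrArg (fun s => s.val W le_rfl g) e
    simpa using this
  · rintro rfl
    ext V hV k
    rw [cls_val, cls_val, map_mul, D.L_res, mul_assoc, ← D.L_comp, E.res_comp, res_inv,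
      Category.assoc, IsIso.hom_inv_id_assoc]

/-- A twisted morphism is determined by its value at one morphism. -/
lemma eq_cls (s : D.Tw x y W hx hy) (g : (⟨x, hx⟩ : At E.dom W) ⟶ ⟨y, hy⟩) :
    s = cls D (s.val W le_rfl g) g := by
  ext V hV k
  rw [cls_val, s.val_res, ← s.val_comp V hV k (inv k ≫ E.res hV g), IsIso.hom_inv_id_assoc]

lemma comp_cls (a : D.S (⟨z, hz⟩ : At E.dom W)) (g : (⟨y, hy⟩ : At E.dom W) ⟶ ⟨z, hz⟩)
    (a' : D.S (⟨y, hy⟩ : At E.dom W)) (g' : (⟨x, hx⟩ : At E.dom W) ⟶ ⟨y, hy⟩) :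
    comp hc (cls D a' g') (cls D a g) = cls D (a * D.act g a') (g' ≫ g) := by
  rw [eq_cls (comp hc (cls D a' g') (cls D a g)) (g' ≫ g), comp_val]
  simp

lemma add_comp (s s' : D.Tw x y W hx hy) (t : D.Tw y z W hy hz) :
    comp hc (s + s') t = comp hc s t + comp hc s' t :=
  ext_loc hc y hy fun V hV k m => by
    rw [add_val, comp_val' hc _ _ hV m, comp_val' hc _ _ hV m, comp_val' hc _ _ hV m, add_val,
      map_add, mul_add]

lemma comp_add (s : D.Tw x y W hx hy) (t t' : D.Tw y z W hy hz) :
    comp hc s (t + t') = comp hc s t + comp hc s t' :=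
  ext_loc hc y hy fun V hV k m => by
    rw [add_val, comp_val' hc _ _ hV m, comp_val' hc _ _ hV m, comp_val' hc _ _ hV m, add_val,
      add_mul]

lemma smul_comp (r : sec R W) (s : D.Tw x y W hx hy) (t : D.Tw y z W hy hz) :
    comp hc (r • s) t = r • comp hc s t :=
  ext_loc hc y hy fun V hV k m => by
    rw [smul_val, comp_val' hc _ _ hV m, comp_val' hc _ _ hV m, smul_val, map_mul, D.act_str,
      ← mul_assoc, ← D.central, mul_assoc]

lemma comp_smul (r : sec R W) (s : D.Tw x y W hx hy) (t : D.Tw y z W hy hz) :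
    comp hc s (r • t) = r • comp hc s t :=
  ext_loc hc y hy fun V hV k m => by
    rw [smul_val, comp_val' hc _ _ hV m, comp_val' hc _ _ hV m, smul_val, mul_assoc]

lemma smul_cls (r : sec R W) (a : D.S (⟨y, hy⟩ : At E.dom W))
    (g : (⟨x, hx⟩ : At E.dom W) ⟶ ⟨y, hy⟩) : r • cls D a g = cls D (D.str _ r * a) g := by
  ext V hV k
  rw [smul_val, cls_val, cls_val, map_mul, D.str_res, mul_assoc]

lemma cls_add_cls (a a' : D.S (⟨y, hy⟩ : At E.dom W)) (g g' : (⟨x, hx⟩ : At E.dom W) ⟶ ⟨y, hy⟩) :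
    cls D a g + cls D a' g' = cls D (a + a' * D.L (inv g ≫ g')) g := by
  rw [eq_cls (cls D a g + cls D a' g') g, add_val]
  simp

end Tw

instance twistAdditive : (D.twist hc).Additive where
  preadditive W :=
    { homGroup := fun a b => Tw.instAddCommGroup (D := D) (x := a.ob) (y := b.ob)
      add_comp := fun a b c s s' t => Tw.add_comp hc s s' t
      comp_add := fun a b c s t t' => Tw.comp_add hc s t t' }
  res_add _ _ _ _ _ _ _ := rfl

instance twistIsLin : IsLin R (D.twist hc) where
  linear W :=
    { homModule := fun a b => Tw.instModule (D := D) (x := a.ob) (y := b.ob)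
      smul_comp := fun a b c r s t => Tw.smul_comp hc r s t
      comp_smul := fun a b c s r t => Tw.comp_smul hc r s t }
  res_smul h _ _ _ _ r s := Tw.ext (by
    funext V hV k
    exact congrArg (fun a => D.str _ a * _) (secRes_comp _ _ _ r).symm)

lemma twist_isSep : (D.twist hc).IsSep := by
  intro W (x : E.Ob) (y : E.Ob) (hx : W ≤ E.dom x) (hy : W ≤ E.dom y) C s hs
  have hs' T T' (h : T' ≤ T) (hT : C.mem T) V (hV : V ≤ T')
      (k : (⟨x, (hV.trans (h.trans (C.le hT))).trans hx⟩ : At E.dom V) ⟶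
        ⟨y, (hV.trans (h.trans (C.le hT))).trans hy⟩) :
      Tw.val (s T hT) V (hV.trans h) k = Tw.val (s T' (C.down h hT)) V hV k :=
    congrArg (fun l : D.Tw x y T' _ _ => l.val V hV k) (hs T T' h hT)
  let C' V (hV : V ≤ W) : Cov V :=
    { mem := fun V' => V' ≤ V ∧ C.mem V'
      le := fun h => h.1
      down := fun h h' => ⟨h.trans h'.1, C.down h h'.2⟩
      cov := fun p hp => by
        obtain ⟨T, hT, hpT⟩ := C.cov p (hV hp)
        exact ⟨V ⊓ T, ⟨inf_le_left, C.down inf_le_right hT⟩, hp, hpT⟩ }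
  have key V (hV : V ≤ W) (k : (⟨x, hV.trans hx⟩ : At E.dom V) ⟶ ⟨y, hV.trans hy⟩) :=
    D.glue (hV.trans hy) (C' V hV) (fun V' hV' => Tw.val (s V' hV'.2) V' le_rfl (E.res hV'.1 k))
      (fun V' V'' h hV' => by
        refine (Tw.val_res (s V' hV'.2) V' V'' h le_rfl _).trans ?_
        rw [E.res_res]
        exact hs' V' V'' h hV'.2 V'' le_rfl _)
  choose l hl _ using key
  -- an equality of sections may be checked over the members of `C`
  have loc V (hV : V ≤ W) (a b : D.S (⟨y, hV.trans hy⟩ : At E.dom V))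
      (h : ∀ T (hT : T ≤ V), C.mem T → D.res hT a = D.res hT b) : a = b :=
    D.ext_loc fun p hp => by
      obtain ⟨T, ⟨hT, hT'⟩, hpT⟩ := (C' V hV).cov p hp
      exact ⟨T, hT, hpT, h T hT hT'⟩
  refine ⟨(⟨l, fun V V' h hV k => ?_, fun V hV k φ => ?_⟩ : D.Tw x y W hx hy), fun T hT => ?_,
    fun m hm => ?_⟩
  · refine loc V' (h.trans hV) _ _ fun T hT hT' => ?_
    have h₁ := hl V hV k T ⟨hT.trans h, hT'⟩
    have h₂ := hl V' (h.trans hV) (E.res h k) T ⟨hT, hT'⟩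
    rw [E.res_res] at h₂
    rw [D.res_res]
    exact h₁.trans h₂.symm
  · refine loc V hV _ _ fun T hT hT' => ?_
    have h₁ := hl V hV k T ⟨hT, hT'⟩
    have h₂ := hl V hV (k ≫ φ) T ⟨hT, hT'⟩
    rw [E.res_comp] at h₂
    rw [map_mul, D.L_res]
    refine (congrArg (fun a => a * _) h₂).trans (Eq.trans ?_ h₁.symm)
    exact Tw.val_comp (s T hT') T le_rfl _ _
  · refine Tw.ext ?_
    funext V hV k
    have h₁ := hl V (hV.trans (C.le hT)) k V ⟨le_rfl, C.down hV hT⟩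
    rw [E.res_self, D.res_self] at h₁
    exact h₁.trans (hs' _ _ hV hT _ le_rfl k).symm
  · refine Tw.ext ?_
    funext V hV k
    refine loc V hV _ _ fun T hT hT' => ?_
    refine (Tw.val_res m V T hT hV k).trans (Eq.trans ?_ (hl V hV k T ⟨hT, hT'⟩).symm)
    exact congrArg (fun a : D.Tw x y T _ _ => a.val T le_rfl (E.res hT k)) (hm T hT')

end AlgData

end StrictPrestack

/-! ### Algebroid data over the strict prestack of a gerbe -/

namespace AlgSheaf

open Pseudofunctor.LocallyDiscreteOpToCat

variable {R : RingSheaf X} {U V W : Opens X}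

lemma over_hom_subsingleton {T T' : Over U} (k l : T ⟶ T') : k = l :=
  Over.OverMorphism.ext (Subsingleton.elim _ _)

variable (A : AlgSheaf R U)

lemma ring_map_map {T T' T'' : Over U} (k : T' ⟶ T) (l : T'' ⟶ T') (m : T'' ⟶ T)
    (a : A.ring.obj.obj (op T)) :
    (A.ring.obj.map l.op).hom ((A.ring.obj.map k.op).hom a) = (A.ring.obj.map m.op).hom a := by
  obtain rfl : m = l ≫ k := over_hom_subsingleton _ _
  rw [op_comp, A.ring.obj.map_comp]
  rfl

lemma ring_map_self {T : Over U} (k : T ⟶ T) (a : A.ring.obj.obj (op T)) :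
    (A.ring.obj.map k.op).hom a = a := by
  obtain rfl : k = 𝟙 _ := over_hom_subsingleton _ _
  rw [op_id, A.ring.obj.map_id]
  rfl

lemma Γmap_comp {A B C : AlgSheaf R U} (f : A ⟶ B) (g : B ⟶ C) (a : A.Γ) :
    Γmap (f ≫ g) a = Γmap g (Γmap f a) := rfl

lemma Γmap_id (a : A.Γ) : Γmap (𝟙 A) a = a := rfl

lemma Γmap_str {A B : AlgSheaf R U} (f : A ⟶ B) (r : sec R U) : Γmap f (A.Γstr r) = B.Γstr r :=
  f.hom_str (Over.mk (𝟙 U)) r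

/-- Naturality of the restriction of sections. -/
lemma Γmap_restrict {A B : AlgSheaf R U} (φ : A ⟶ B) (f : V ⟶ U) (a : A.Γ) :
    Γmap ((restrict f).map φ) (A.Γres f a) = B.Γres f (Γmap φ a) :=
  congrArg (fun k => k.hom a) (φ.hom.hom.naturality
    (Over.homMk f : (Over.map f).obj (Over.mk (𝟙 V)) ⟶ Over.mk (𝟙 U)).op)

/-- The coherence isomorphism of the stack of algebras, for the composition of restrictions. -/
def compIso (f : V ⟶ U) (g : W ⟶ V) (h : W ⟶ U) (A : AlgSheaf R U) :
    (restrict h).obj A ≅ (restrict g).obj ((restrict f).obj A) :=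
  (Cat.Hom.toNatIso ((algStack R).mapComp' f.op.toLoc g.op.toLoc h.op.toLoc
    (by rw [← Quiver.Hom.comp_toLoc]; congr 1))).app A

/-- Restriction of the sections of `A|_V` to sections of `A|_W`. -/
def secMap (f : V ⟶ U) (k : W ⟶ V) (h : W ⟶ U) :
    ((restrict f).obj A).Γ →+* ((restrict h).obj A).Γ :=
  (A.ring.obj.map (Over.homMk k : (Over.map h).obj (Over.mk (𝟙 W)) ⟶
    (Over.map f).obj (Over.mk (𝟙 V))).op).hom

/-- Sections of an algebra over `U` on an open subset `W` of `U`. -/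
abbrev sect (A : AlgSheaf R U) (h : W ≤ U) : Type u := ((restrict (homOfLE h)).obj A).Γ

/-- Restriction of sections from `W` to `W'`. -/
def sres (A : AlgSheaf R U) {W' : Opens X} (h : W ≤ U) (h' : W' ≤ W) :
    A.sect h →+* A.sect (h'.trans h) :=
  A.secMap (homOfLE h) (homOfLE h') (homOfLE (h'.trans h))

lemma sres_self (h : W ≤ U) (h' : W ≤ W) (a : A.sect h) : A.sres h h' a = a :=
  A.ring_map_self _ a

lemma sres_sres {W' W'' : Opens X} (h : W ≤ U) (h' : W' ≤ W) (h'' : W'' ≤ W') (a : A.sect h) :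
    A.sres (h'.trans h) h'' (A.sres h h' a) = A.sres h (h''.trans h') a :=
  A.ring_map_map _ _ _ a

/-- Sections of an algebra glue. -/
lemma glue (h : W ≤ U) (C : Cov W) (s : ∀ V (hV : C.mem V), A.sect ((C.le hV).trans h))
    (hs : ∀ V V' (h' : V' ≤ V) (hV : C.mem V),
      A.sres ((C.le hV).trans h) h' (s V hV) = s V' (C.down h' hV)) :
    ∃! t : A.sect h, ∀ V (hV : C.mem V), A.sres h (C.le hV) t = s V hV := by
  have H : Presieve.IsSheaf ((Opens.grothendieckTopology X).over U)
      (A.ring.obj ⋙ CategoryTheory.forget RingCat) := by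
    rw [← isSheaf_iff_isSheaf_of_type]
    exact (Presheaf.isSheaf_iff_isSheaf_forget _ _ (CategoryTheory.forget RingCat)).1 A.ring.property
  have hC := (Opens.grothendieckTopology X).overEquiv_symm_mem_over
    ((Over.map (homOfLE h)).obj (Over.mk (𝟙 W))) C.sieve C.sieve_mem
  let fam : Presieve.FamilyOfElements (A.ring.obj ⋙ CategoryTheory.forget RingCat)
      ((Sieve.overEquiv ((Over.map (homOfLE h)).obj (Over.mk (𝟙 W)))).symm C.sieve).arrows :=
    fun T f hf => s T.left hf
  have hfam : fam.Compatible := by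
    rw [Presieve.compatible_iff_sieveCompatible]
    intro T T' f g hf
    exact (hs T.left T'.left g.left.le hf).symm
  obtain ⟨t, ht, ht'⟩ := H _ hC fam hfam
  refine ⟨t, fun V hV => ?_, fun t₁ ht₁ => ?_⟩
  · exact ht (Y := (Over.map (homOfLE ((C.le hV).trans h))).obj (Over.mk (𝟙 V)))
      (Over.homMk (homOfLE (C.le hV))) hV
  · exact ht' t₁ (fun T f hf => ht₁ T.left hf)

lemma Γmap_compIso_inv (f : V ⟶ U) (k : W ⟶ V) (h : W ⟶ U) (a : ((restrict f).obj A).Γ) :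
    Γmap (compIso f k h A).inv (((restrict f).obj A).Γres k a) = A.secMap f k h a := by
  obtain rfl : h = k ≫ f := Subsingleton.elim _ _
  have e : (compIso f k (k ≫ f) A).inv = (restrictComp R f k).inv.app A :=
    congrArg (fun k => k.inv.toNatTrans.app A)
      ((algStack R).mapComp'_eq_mapComp f.op.toLoc k.op.toLoc)
  rw [e]
  exact A.ring_map_map _ _ _ a

lemma Γmap_compIso_hom (f : V ⟶ U) (k : W ⟶ V) (h : W ⟶ U) (a : ((restrict f).obj A).Γ) :
    Γmap (compIso f k h A).hom (A.secMap f k h a) = ((restrict f).obj A).Γres k a := by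
  rw [← Γmap_compIso_inv, ← Γmap_comp, Iso.inv_hom_id, Γmap_id]

end AlgSheaf

section sections

open Pseudofunctor.LocallyDiscreteOpToCat

variable {R : RingSheaf X} {P : Prestack X} (Φ : P ⟶ algStack R)

/-- The isomorphism `Φ(q|_V) ≅ Φ(q)|_V`. -/
def algResIso {U V : Opens X} (f : V ⟶ U) (q : P.fib U) :
    algOf Φ ((P.res f).obj q) ≅ (AlgSheaf.restrict f).obj (algOf Φ q) :=
  resIso Φ f q

/-- The homomorphism of algebras `Φ(g)`. -/
def algMor {V : Opens X} {q q' : P.fib V} (g : q ⟶ q') : algOf Φ q ⟶ algOf Φ q' := (onFib Φ V).map g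

lemma algMor_id {V : Opens X} (q : P.fib V) : algMor Φ (𝟙 q) = 𝟙 _ := (onFib Φ V).map_id q

lemma algMor_comp {V : Opens X} {q q' q'' : P.fib V} (g : q ⟶ q') (g' : q' ⟶ q'') :
    algMor Φ (g ≫ g') = algMor Φ g ≫ algMor Φ g' := (onFib Φ V).map_comp g g'

lemma Γmap_algMor {V : Opens X} {q q' : P.fib V} (g : q ⟶ q') (a : algSec Φ q) :
    AlgSheaf.Γmap (algMor Φ g) a = algMap Φ g a := rfl

/-- The homomorphism of algebras attached to a morphism `q|_V ⟶ q'|_V`. -/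
def algHom {U U' V : Opens X} {q : P.fib U} {q' : P.fib U'} (f : V ⟶ U) (f' : V ⟶ U')
    (g : (P.res f).obj q ⟶ (P.res f').obj q') :
    (AlgSheaf.restrict f).obj (algOf Φ q) ⟶ (AlgSheaf.restrict f').obj (algOf Φ q') :=
  (algResIso Φ f q).inv ≫ algMor Φ g ≫ (algResIso Φ f' q').hom

lemma algHom_id {U V : Opens X} {q : P.fib U} (f : V ⟶ U) :
    algHom Φ f f (𝟙 ((P.res f).obj q)) = 𝟙 _ := by
  rw [algHom, algMor_id, Category.id_comp, Iso.inv_hom_id]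

lemma algHom_comp {U U' U'' V : Opens X} {q : P.fib U} {q' : P.fib U'} {q'' : P.fib U''}
    (f : V ⟶ U) (f' : V ⟶ U') (f'' : V ⟶ U'') (g : (P.res f).obj q ⟶ (P.res f').obj q')
    (g' : (P.res f').obj q' ⟶ (P.res f'').obj q'') :
    algHom Φ f f'' (g ≫ g') = algHom Φ f f' g ≫ algHom Φ f' f'' g' := by
  simp only [algHom, algMor_comp, Category.assoc, Iso.hom_inv_id_assoc]

/-- Restriction of `algHom`. -/
lemma algHom_pullHom {U U' V W : Opens X} {q : P.fib U} {q' : P.fib U'} (f : V ⟶ U) (f' : V ⟶ U')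
    (g : (P.res f).obj q ⟶ (P.res f').obj q') (k : W ⟶ V) (h : W ⟶ U) (h' : W ⟶ U') :
    algHom Φ h h' (pullHom g k h h' rfl rfl) =
      (AlgSheaf.compIso f k h (algOf Φ q)).hom ≫ (AlgSheaf.restrict k).map (algHom Φ f f' g) ≫
        (AlgSheaf.compIso f' k h' (algOf Φ q')).inv :=
  onHom_pullHom Φ f f' g k h h'

/-- The action of `g` on sections over `V` is compatible with restriction to `W`. -/
lemma Γmap_algHom_pullHom {U U' V W : Opens X} {q : P.fib U} {q' : P.fib U'} (f : V ⟶ U)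
    (f' : V ⟶ U') (g : (P.res f).obj q ⟶ (P.res f').obj q') (k : W ⟶ V) (h : W ⟶ U) (h' : W ⟶ U')
    (a : ((AlgSheaf.restrict f).obj (algOf Φ q)).Γ) :
    AlgSheaf.Γmap (algHom Φ h h' (pullHom g k h h' rfl rfl)) ((algOf Φ q).secMap f k h a) =
      (algOf Φ q').secMap f' k h' (AlgSheaf.Γmap (algHom Φ f f' g) a) := by
  rw [algHom_pullHom, AlgSheaf.Γmap_comp, AlgSheaf.Γmap_comp, AlgSheaf.Γmap_compIso_hom,
    AlgSheaf.Γmap_restrict, AlgSheaf.Γmap_compIso_inv]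

end sections

namespace AlgebroidData

open Pseudofunctor.LocallyDiscreteOpToCat

variable {R : RingSheaf X} (D : AlgebroidData R)

/-- The section over `V` of `Φ(q)` attached to an endomorphism of `q|_V`. -/
def liftSec {U V : Opens X} {q : D.P.fib U} (f : V ⟶ U)
    (φ : (D.P.res f).obj q ⟶ (D.P.res f).obj q) : ((AlgSheaf.restrict f).obj (algOf D.Φ q)).Γ :=
  AlgSheaf.Γmap (algResIso D.Φ f q).hom (D.lift ((D.P.res f).obj q) φ : algSec D.Φ _)

lemma liftSec_id {U V : Opens X} {q : D.P.fib U} (f : V ⟶ U) :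
    D.liftSec f (𝟙 ((D.P.res f).obj q)) = 1 := by
  have : D.lift ((D.P.res f).obj q) (𝟙 _) = 1 := (D.lift _).map_one
  rw [liftSec, this, Units.val_one, map_one]

lemma liftSec_comp {U V : Opens X} {q : D.P.fib U} (f : V ⟶ U)
    (φ ψ : (D.P.res f).obj q ⟶ (D.P.res f).obj q) :
    D.liftSec f (φ ≫ ψ) = D.liftSec f ψ * D.liftSec f φ := by
  have : D.lift ((D.P.res f).obj q) (φ ≫ ψ) = D.lift _ ψ * D.lift _ φ := (D.lift _).map_mul ψ φ
  rw [liftSec, this, Units.val_mul, map_mul]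
  rfl

lemma algHom_mul_liftSec {U V : Opens X} {q : D.P.fib U} (f : V ⟶ U)
    (φ : (D.P.res f).obj q ⟶ (D.P.res f).obj q) (a : ((AlgSheaf.restrict f).obj (algOf D.Φ q)).Γ) :
    AlgSheaf.Γmap (algHom D.Φ f f φ) a * D.liftSec f φ = D.liftSec f φ * a := by
  have h := D.map_eq_conj _ φ (AlgSheaf.Γmap (algResIso D.Φ f q).inv a)
  have h₁ : AlgSheaf.Γmap (algHom D.Φ f f φ) a = AlgSheaf.Γmap (algResIso D.Φ f q).hom
    (algMap D.Φ φ (AlgSheaf.Γmap (algResIso D.Φ f q).inv a)) := rfl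
  have h₂ : AlgSheaf.Γmap (algResIso D.Φ f q).hom (AlgSheaf.Γmap (algResIso D.Φ f q).inv a) = a := by
    rw [← AlgSheaf.Γmap_comp, Iso.inv_hom_id, AlgSheaf.Γmap_id]
  rw [h₁, h, liftSec, ← map_mul, Units.inv_mul_cancel_right, map_mul, h₂]

lemma liftSec_conj {U U' V : Opens X} {q : D.P.fib U} {q' : D.P.fib U'} (f : V ⟶ U) (f' : V ⟶ U')
    (g : (D.P.res f).obj q ≅ (D.P.res f').obj q') (φ : (D.P.res f).obj q ⟶ (D.P.res f).obj q) :
    D.liftSec f' (g.inv ≫ φ ≫ g.hom) = AlgSheaf.Γmap (algHom D.Φ f f' g.hom) (D.liftSec f φ) := by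
  have h₁ : AlgSheaf.Γmap (algHom D.Φ f f' g.hom) (D.liftSec f φ) =
    AlgSheaf.Γmap (algResIso D.Φ f' q').hom (algMap D.Φ g.hom (AlgSheaf.Γmap (algResIso D.Φ f q).inv
      (AlgSheaf.Γmap (algResIso D.Φ f q).hom (D.lift ((D.P.res f).obj q) φ : algSec D.Φ _)))) := rfl
  rw [h₁, ← AlgSheaf.Γmap_comp, Iso.hom_inv_id, AlgSheaf.Γmap_id, ← D.lift_conj]
  rfl

lemma liftSec_pullHom {U V W : Opens X} {q : D.P.fib U} (f : V ⟶ U)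
    (φ : (D.P.res f).obj q ⟶ (D.P.res f).obj q) (k : W ⟶ V) (h : W ⟶ U) :
    D.liftSec h (pullHom φ k h h rfl rfl) = (algOf D.Φ q).secMap f k h (D.liftSec f φ) := by
  let a : (D.P.res h).obj q ≅ (D.P.res k).obj ((D.P.res f).obj q) :=
    (Cat.Hom.toNatIso (D.P.mapComp' f.op.toLoc k.op.toLoc h.op.toLoc
      (by rw [← Quiver.Hom.comp_toLoc]; congr 1))).app q
  let A := algOf D.Φ q
  -- the square relating the two ways of restricting `Φ(q)` to `W`
  have e₁ : (algResIso D.Φ h q).hom ≫ (AlgSheaf.compIso f k h A).hom =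
      algMor D.Φ a.hom ≫ (algResIso D.Φ k ((D.P.res f).obj q)).hom ≫
        (AlgSheaf.restrict k).map (algResIso D.Φ f q).hom := resIso_comp' D.Φ f k h q
  have e₀ : algMor D.Φ a.inv ≫ algMor D.Φ a.hom = 𝟙 _ := by
    rw [← algMor_comp, Iso.inv_hom_id, algMor_id]
  have e₂ : (algResIso D.Φ k ((D.P.res f).obj q)).inv ≫ algMor D.Φ a.inv ≫
      (algResIso D.Φ h q).hom = (AlgSheaf.restrict k).map (algResIso D.Φ f q).hom ≫
        (AlgSheaf.compIso f k h A).inv := by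
    rw [← cancel_mono (AlgSheaf.compIso f k h A).hom, Category.assoc, Category.assoc, e₁,
      Iso.inv_comp_eq, reassoc_of% e₀, Category.assoc, Iso.inv_hom_id, Category.comp_id]
  have e₃ : (D.lift ((D.P.res h).obj q) (pullHom φ k h h rfl rfl) : algSec D.Φ _) =
      algMap D.Φ a.inv (AlgSheaf.Γmap (algResIso D.Φ k ((D.P.res f).obj q)).inv
        ((algOf D.Φ ((D.P.res f).obj q)).Γres k
          (D.lift ((D.P.res f).obj q) φ : algSec D.Φ _))) :=
    (D.lift_conj a.symm ((D.P.res k).map φ)).trans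
      (congrArg (algMap D.Φ a.inv) (D.lift_res k ((D.P.res f).obj q) φ))
  rw [liftSec, e₃, ← Γmap_algMor, ← AlgSheaf.Γmap_comp, ← AlgSheaf.Γmap_comp, e₂,
    AlgSheaf.Γmap_comp, AlgSheaf.Γmap_restrict, AlgSheaf.Γmap_compIso_inv]
  rfl

end AlgebroidData

namespace AlgebroidData

open StrictPrestack

variable {R : RingSheaf X} (D : AlgebroidData R)

/-- The strict prestack of the gerbe, with the algebras and liftings of the algebroid data. -/
def strictData : D.P.strict.AlgData R where
  S y := (algOf D.Φ y.ob.2).sect y.le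
  ring y := inferInstance
  res {W W'} h {y hy} := (algOf D.Φ y.2).sres hy h
  res_self {W} h {y hy} a := (algOf D.Φ y.2).sres_self hy h a
  res_res {W W' W''} h h' {y hy} a := (algOf D.Φ y.2).sres_sres hy h h' a
  glue {W y} hy C s hs := (algOf D.Φ y.2).glue hy C s hs
  str {W} y := ((AlgSheaf.restrict (homOfLE y.le)).obj (algOf D.Φ y.ob.2)).Γstr
  str_res {W W'} h {y hy} r := (algOf D.Φ y.2).str_res
    (Over.homMk (homOfLE h) : (Over.map (homOfLE (h.trans hy))).obj (Over.mk (𝟙 W')) ⟶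
    (Over.map (homOfLE hy)).obj (Over.mk (𝟙 W))) r
  central {W} y r a := (algOf D.Φ y.ob.2).central ((Over.map (homOfLE y.le)).obj (Over.mk (𝟙 W))) r a
  act {W x y} g := AlgSheaf.Γmap (algHom D.Φ (homOfLE x.le) (homOfLE y.le) g)
  act_id {W x} a := by
    refine (congrArg (fun k => AlgSheaf.Γmap k a) (algHom_id D.Φ (homOfLE x.le))).trans ?_
    exact AlgSheaf.Γmap_id _ _
  act_comp {W x y z} f g a :=
    congrArg (fun k => AlgSheaf.Γmap k a)
      (algHom_comp D.Φ (homOfLE x.le) (homOfLE y.le) (homOfLE z.le) f g)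
  act_res {W W'} h {x y hx hy} g a :=
    (Γmap_algHom_pullHom D.Φ (homOfLE hx) (homOfLE hy) g (homOfLE h) _ _ a).symm
  act_str {W x y} g r := AlgSheaf.Γmap_str _ _
  L {W x} φ := D.liftSec (homOfLE x.le) φ
  L_id {W} x := D.liftSec_id (homOfLE x.le)
  L_comp {W x} φ ψ := D.liftSec_comp (homOfLE x.le) φ ψ
  L_res {W W'} h {x hx} φ := (D.liftSec_pullHom (homOfLE hx) φ (homOfLE h) _).symm
  act_mul_L {W x} φ a := D.algHom_mul_liftSec (homOfLE x.le) φ a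
  L_conj {W x y} g φ := D.liftSec_conj (homOfLE x.le) (homOfLE y.le)
    { hom := g.hom, inv := g.inv, hom_inv_id := g.hom_inv_id, inv_hom_id := g.inv_hom_id } φ

instance strict_isGroupoid (W : Opens X) : IsGroupoid (At D.P.strict.dom W) where
  all_isIso {x y} g := by
    have h := D.isGerbe.isIso W ((D.P.res (homOfLE x.le)).obj x.ob.2)
      ((D.P.res (homOfLE y.le)).obj y.ob.2) g
    obtain ⟨g', h₁, h₂⟩ := h.out
    exact ⟨g', h₁, h₂⟩

lemma strict_locConn : D.P.strict.LocConn := by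
  intro W x y hx hy p hp
  obtain ⟨V, f, hpV, ⟨e⟩⟩ := D.isGerbe.locallyConnected W ((D.P.res (homOfLE hx)).obj x.2)
    ((D.P.res (homOfLE hy)).obj y.2) p hp
  exact ⟨V, f.le, hpV, ⟨D.P.strict.res f.le (D.P.pres.can (homOfLE hx) x.2).inv ≫
    D.P.pres.conj f f e.hom ≫ D.P.strict.res f.le (D.P.pres.can (homOfLE hy) y.2).hom⟩⟩

/-- A section over `U` of `Φ(p)`, as a section over `U` for the algebroid data over the strict
prestack. -/
def toS {U : Opens X} (p : D.P.fib U) :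
    algSec D.Φ p ≃+* D.strictData.S (⟨D.P.pres.ι p, D.P.pres.le p⟩ : At D.P.strict.dom U) :=
  RingEquiv.refl _

lemma toS_eq {U : Opens X} (p : D.P.fib U) (a : algSec D.Φ p) :
    D.toS p a = (algOf D.Φ p).Γres (𝟙 U) a :=
  ((algOf D.Φ p).ring_map_self _ a).symm

lemma act_emb {U : Opens X} {p q : D.P.fib U} (g : p ⟶ q) (a : algSec D.Φ p) :
    D.strictData.act (D.P.pres.emb g) (D.toS p a) = D.toS q (algMap D.Φ g a) := by
  rw [toS_eq, toS_eq]
  refine Eq.trans ?_ (AlgSheaf.Γmap_restrict (algMor D.Φ g) (𝟙 U) a)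
  have e : algHom D.Φ (𝟙 U) (𝟙 U) ((D.P.res (𝟙 U)).map g) =
      (AlgSheaf.restrict (𝟙 U)).map (algMor D.Φ g) :=
    (Iso.inv_comp_eq _).2 (resIso_naturality D.Φ (𝟙 U) g)
  exact congrArg (fun k => AlgSheaf.Γmap k ((algOf D.Φ p).Γres (𝟙 U) a)) e

lemma L_emb {U : Opens X} {p : D.P.fib U} (φ : p ⟶ p) :
    D.strictData.L (D.P.pres.emb φ) = D.toS p (D.lift p φ : algSec D.Φ p) := by
  rw [toS_eq]
  refine (congrArg (AlgSheaf.Γmap (algResIso D.Φ (𝟙 U) p).hom) (D.lift_res (𝟙 U) p φ)).trans ?_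
  have e : AlgSheaf.Γmap ((algResIso D.Φ (𝟙 U) p).inv ≫ (algResIso D.Φ (𝟙 U) p).hom)
      ((algOf D.Φ p).Γres (𝟙 U) (D.lift p φ : algSec D.Φ p)) =
      (algOf D.Φ p).Γres (𝟙 U) (D.lift p φ : algSec D.Φ p) := by
    rw [Iso.inv_hom_id, AlgSheaf.Γmap_id]
  exact e

lemma Γmap_mapIdApp_inv {U : Opens X} (A : AlgSheaf R U) (a : A.Γ) :
    AlgSheaf.Γmap (B := (AlgSheaf.restrict (𝟙 U)).obj A)
      ((algStack R).mapIdApp (U := U) A).inv a = A.Γres (𝟙 U) a := by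
  refine Eq.trans ?_ (A.ring_map_self _ a).symm
  exact A.ring_map_self _ a

/-- The restriction `algRes` of sections, in terms of the algebroid data over the strict
prestack. -/
lemma act_can_inv {U V : Opens X} (f : V ⟶ U) (p : D.P.fib U) (a : algSec D.Φ p) :
    D.strictData.act (D.P.pres.can f p).inv (D.strictData.res f.le (D.toS p a)) =
      D.toS ((D.P.res f).obj p) (algRes D.Φ f p a) := by
  let q := (D.P.res f).obj p
  have e₁ : (algResIso D.Φ (𝟙 V) q).hom ≫ ((algStack R).mapIdApp (U := V) (algOf D.Φ q)).hom =
    algMor D.Φ (D.P.mapIdApp q).hom := resIso_id D.Φ q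
  have e₀ : algMor D.Φ (D.P.mapIdApp q).inv ≫ algMor D.Φ (D.P.mapIdApp q).hom = 𝟙 _ := by
    rw [← algMor_comp, Iso.inv_hom_id, algMor_id]
  let m : (AlgSheaf.restrict (𝟙 V)).obj (algOf D.Φ q) ≅ algOf D.Φ q :=
    (algStack R).mapIdApp (U := V) (algOf D.Φ q)
  replace e₁ : (algResIso D.Φ (𝟙 V) q).hom ≫ m.hom = algMor D.Φ (D.P.mapIdApp q).hom := e₁
  have e₂ : algMor D.Φ (D.P.mapIdApp q).inv ≫ (algResIso D.Φ (𝟙 V) q).hom = m.inv := by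
    rw [← cancel_mono m.hom, Category.assoc, e₁, e₀, Iso.inv_hom_id]
  refine Eq.trans ?_ (D.toS_eq _ _).symm
  change AlgSheaf.Γmap (algMor D.Φ (D.P.mapIdApp q).inv ≫ (algResIso D.Φ (𝟙 V) q).hom)
    (AlgSheaf.Γmap (algResIso D.Φ f p).inv ((algOf D.Φ p).Γres f a)) = _
  rw [e₂]
  exact Γmap_mapIdApp_inv _ _

end AlgebroidData

namespace StrictPrestack

variable {R : RingSheaf X} {E : StrictPrestack X} (D : E.AlgData R)
  [∀ W, IsGroupoid (At E.dom W)] (hc : E.LocConn)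

/-- The map `g ↦ [1, g]`. -/
def AlgData.toTwist : E.Map (D.twist hc) where
  ob x := x
  le _ := le_rfl
  map {W x y hx hy} f := AlgData.Tw.cls D 1 f
  map_id {W x} hx := rfl
  map_comp {W x y z hx hy hz} f g :=
    ((AlgData.Tw.comp_cls hc 1 g 1 f).trans (by rw [map_one, mul_one])).symm
  map_res {W W'} h {x y hx hy} f := ((AlgData.Tw.restrict_cls h _ _).trans (by rw [map_one])).symm

end StrictPrestack

/-- Conjugation by isomorphisms equal to identities.
Stated in an abstract category, so as to apply to morphisms whose types agree only after
unfolding. -/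
lemma inv_comp_comp_hom_of_eq_id {C : Type*} [Category* C] {a b : C} {i : a ≅ a} {j : b ≅ b}
    (hi : i.hom = 𝟙 a) (hj : j.hom = 𝟙 b) (s : a ⟶ b) : i.inv ≫ s ≫ j.hom = s := by
  rw [hj, Category.comp_id, Iso.inv_comp_eq, hi, Category.id_comp]

namespace AlgebroidData

open StrictPrestack AlgData

variable {R : RingSheaf X} (D : AlgebroidData R)

/-! ### The prestack attached to algebroid data -/

/-- The strict prestack of twisted morphisms attached to algebroid data. -/
abbrev twisted : StrictPrestack X := D.strictData.twist D.strict_locConn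

/-- The map `g ↦ [1, g]`, for the gerbe of the algebroid data. -/
abbrev toTwisted : D.P.strict.Map D.twisted := D.strictData.toTwist D.strict_locConn

/-- The objects and the restrictions of the gerbe, in the strict prestack of twisted morphisms. -/
def cleavage : Cleavage D.twisted where
  B U := D.P.fib U
  ι {U} p := D.P.pres.ι (U := U) p
  le {U} p := D.P.pres.le (U := U) p
  r {U V} h p := (D.P.res (homOfLE h)).obj p
  c {U V} h p := D.toTwisted.mapIso (D.P.pres.can (homOfLE h) p)

/-- The `R`-linear prestack of twisted morphisms. -/
def twistedPrestack : LinearPrestack R := D.cleavage.linearPrestack R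

lemma twistedPrestack_isSeparated : D.twistedPrestack.carrier.IsSeparated :=
  D.cleavage.pres.isSeparated (AlgData.twist_isSep _ _)

/-- The functor of prestacks `g ↦ [1, g]`. -/
def J₀ : D.P ⟶ D.twistedPrestack.carrier :=
  mkTrans D.P.pres D.cleavage.pres D.toTwisted (fun {U} p => p) (fun {U} p => Iso.refl _)

/-- The morphism `[a, g]`. -/
def cls {U : Opens X} {p' p : D.P.fib U} (a : algSec D.Φ p) (g : p' ⟶ p) :
    D.strictData.Tw (D.P.pres.ι p') (D.P.pres.ι p) U (D.P.pres.le p') (D.P.pres.le p) :=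
  Tw.cls D.strictData (D.toS p a) (D.P.pres.emb g)

lemma J₀_map {U : Opens X} {p' p : D.P.fib U} (g : p' ⟶ p) :
    (onFib D.J₀ U).map g = D.cls 1 g := by
  refine (emb_mkTransMap D.P.pres D.cleavage.pres D.toTwisted (fun {U} p => p)
    (fun {U} p => Iso.refl _) g).trans ?_
  refine (Category.id_comp _).trans ((Category.comp_id _).trans ?_)
  exact congrArg (fun a => Tw.cls D.strictData a (D.P.pres.emb g)) (map_one (D.toS p)).symm

/-- The functor `J₀` is strictly compatible with the restrictions of objects. -/
lemma resIso_J₀_hom {U V : Opens X} (f : V ⟶ U) (p : D.P.fib U) :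
    (resIso D.J₀ f p).hom = 𝟙 ((D.twistedPrestack.carrier.res f).obj p) := by
  refine (emb_mkTransIso D.P.pres D.cleavage.pres D.toTwisted (fun {U} p => p)
    (fun {U} p => Iso.refl _) f p).trans ?_
  refine (Category.id_comp _).trans ?_
  refine (congrArg (fun k => _ ≫ k ≫ _) (D.twisted.res_id f.le _)).trans ?_
  refine (congrArg (fun k => _ ≫ k) (Category.id_comp _)).trans ?_
  exact (D.cleavage.c f.le p).hom_inv_id

lemma resHom_cls {U V : Opens X} (f : V ⟶ U) {p' p : D.P.fib U} (a : algSec D.Φ p) (g : p' ⟶ p) :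
    D.cleavage.resHom f.le (b := p') (b' := p) (D.cls a g) =
      D.cls (algRes D.Φ f p a) ((D.P.res f).map g) := by
  have e₁ := D.P.pres.emb_res f g
  rw [← Iso.eq_comp_inv, Category.assoc] at e₁
  refine (congrArg (fun k => Tw.comp D.strict_locConn (Tw.cls D.strictData 1 (D.P.pres.can f p').hom)
    (Tw.comp D.strict_locConn k (Tw.cls D.strictData 1 (D.P.pres.can f p).inv)))
    (Tw.restrict_cls f.le (D.toS p a) (D.P.pres.emb g))).trans ?_
  rw [Tw.comp_cls, Tw.comp_cls, map_one, mul_one, one_mul, ← e₁]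
  exact congrArg (fun b => Tw.cls D.strictData b (D.P.pres.emb ((D.P.res f).map g)))
    (D.act_can_inv f p a)

lemma cls_eq_iff {U : Opens X} {p' p : D.P.fib U} (a b : algSec D.Φ p) (g h : p' ⟶ p) :
    D.cls a g = D.cls b h ↔ Relation.EqvGen (D.Rel p' p) (a, g) (b, h) := by
  have key (c d : algSec D.Φ p) (k : p' ⟶ p) (φ : p ⟶ p) :
      D.cls c k = D.cls d (k ≫ φ) ↔ c = d * (D.lift p φ : algSec D.Φ p) := by
    refine (Tw.cls_eq_iff _ _ _ _).trans ?_
    rw [D.P.pres.emb_comp, IsIso.inv_hom_id_assoc, D.L_emb]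
    exact Iff.rfl
  constructor
  · intro e
    have := D.isGerbe.isIso U p' p g
    have e₁ : h = g ≫ inv g ≫ h := (IsIso.hom_inv_id_assoc g h).symm
    have r := Rel.mk (D := D) b g (inv g ≫ h)
    rw [← e₁] at r
    rw [e₁, key] at e
    rw [e]
    exact .symm _ _ (.rel _ _ r)
  · intro e
    have : ∀ s t, Relation.EqvGen (D.Rel p' p) s t → D.cls s.1 s.2 = D.cls t.1 t.2 := by
      intro s t e
      induction e with
      | rel s t h =>
        obtain ⟨c, k, φ⟩ := h
        exact ((key _ _ _ _).2 rfl).symm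
      | refl s => rfl
      | symm s t _ h => exact h.symm
      | trans s t r _ _ h h' => exact h.trans h'
    exact this _ _ e

lemma eq_cls {U : Opens X} {p' p : D.P.fib U}
    (s : D.strictData.Tw (D.P.pres.ι p') (D.P.pres.ι p) U (D.P.pres.le p') (D.P.pres.le p))
    (g : p' ⟶ p) :
    s = D.cls ((D.toS p).symm (s.val U le_rfl (D.P.pres.emb g))) g :=
  s.eq_cls (D.P.pres.emb g)

lemma comp_cls {U : Opens X} {p'' p' p : D.P.fib U} (a : algSec D.Φ p) (g : p' ⟶ p)
    (a' : algSec D.Φ p') (g' : p'' ⟶ p') :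
    Tw.comp D.strict_locConn (D.cls a' g') (D.cls a g) = D.cls (a * algMap D.Φ g a') (g' ≫ g) := by
  refine (Tw.comp_cls _ _ _ _ _).trans ?_
  rw [D.act_emb, ← D.P.pres.emb_comp, ← map_mul]
  rfl

/-- The linear prestack of twisted morphisms has the required description. -/
def description : D.Description D.twistedPrestack where
  J₀ := D.J₀
  bijective_obj U := Function.bijective_id
  cls {U p' p} a g := D.cls a g
  J₀_map {U p' p} g := D.J₀_map g
  cls_eq_iff {U p' p} a b g h := D.cls_eq_iff a b g h
  locally_cls {U p' p} s x hx := by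
    obtain ⟨V, f, hV, ⟨e⟩⟩ := D.isGerbe.locallyConnected U p' p x hx
    let t := D.cleavage.resHom f.le (b := p') (b' := p) s
    refine ⟨V, f, (D.toS ((D.P.res f).obj p)).symm (Tw.val t V le_rfl (D.P.pres.emb e.hom)), e.hom,
      hV, ?_⟩
    refine Eq.trans ?_ (inv_comp_comp_hom_of_eq_id (D.resIso_J₀_hom f p') (D.resIso_J₀_hom f p) _).symm
    exact D.eq_cls t e.hom
  res_cls {U V} f {p' p} a g :=
    (D.resHom_cls f a g).trans
      (inv_comp_comp_hom_of_eq_id (D.resIso_J₀_hom f p') (D.resIso_J₀_hom f p) _).symm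
  cls_comp {U p'' p' p} a g a' g' := D.comp_cls a g a' g'
  smul_cls {U p' p} r a g := by
    refine (Tw.smul_cls r (D.toS p a) (D.P.pres.emb g)).trans ?_
    exact congrArg (fun b => Tw.cls D.strictData b (D.P.pres.emb g)) (map_mul (D.toS p) _ _).symm
  cls_add {U p' p} a g a' g' := by
    refine (Tw.cls_add_cls (D.toS p a) (D.toS p a') (D.P.pres.emb g.hom) (D.P.pres.emb g')).trans ?_
    have e : inv (D.P.pres.emb g.hom) ≫ D.P.pres.emb g' = D.P.pres.emb (g.inv ≫ g') := by
      rw [D.P.pres.emb_comp, IsIso.inv_comp_eq, ← Category.assoc, ← D.P.pres.emb_comp,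
        g.hom_inv_id, D.P.pres.emb_id, Category.id_comp]
    rw [e, D.L_emb, ← map_mul, ← map_add]
    rfl

end AlgebroidData

/-! ### The stack associated with a separated linear prestack -/

open StrictPrestack

namespace Cleavage

/-- The cleavage given by all the objects of a strict prestack. -/
def total (E : StrictPrestack X) : Cleavage E where
  B U := At E.dom U
  ι {U} b := b.ob
  le {U} b := b.le
  r {U V} h b := ⟨b.ob, h.trans b.le⟩
  c {U V} h b := Iso.refl _

lemma total_effective {E : StrictPrestack X} (hE : E.Effective) : (total E).pres.Effective := by
  intro J U V hV cov x t t_res t_self t_comp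
  obtain ⟨y, hy, s, hs⟩ := hE hV cov (fun i => At.ob (x i)) (fun i => At.le (x i)) t t_res t_self
    t_comp
  exact ⟨(⟨y, hy⟩ : At E.dom U), s, hs⟩

lemma total_isStackOn {E : StrictPrestack X} (hE : E.IsSep) (hE' : E.Effective) :
    (total E).prestack.IsStackOn :=
  (total E).pres.isStackOn hE (total_effective hE')

lemma total_pullHom {E : StrictPrestack X} {U V W : Opens X} (b b' : At E.dom U) (f : V ⟶ U)
    (g : W ⟶ V) (h : W ⟶ U)
    (φ : (⟨b.ob, f.le.trans b.le⟩ : At E.dom V) ⟶ ⟨b'.ob, f.le.trans b'.le⟩) :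
    Pseudofunctor.LocallyDiscreteOpToCat.pullHom (F := (total E).prestack) (M₁ := b) (M₂ := b')
      (f₁ := f) (f₂ := f) φ g h h rfl rfl = E.res g.le φ := by
  have e := (total E).pres.conj_pullHom (x := b) (y := b') f f φ g h h
  refine ((Category.id_comp _).trans (Category.comp_id _)).symm.trans (e.trans ?_)
  exact congrArg (fun k => E.res g.le k) ((Category.id_comp _).trans (Category.comp_id _))

lemma total_resHom {E : StrictPrestack X} {U V : Opens X} (h : V ≤ U) (b b' : At E.dom U)
    (φ : b ⟶ b') : (total E).resHom h (b := b) (b' := b') φ = E.res h φ :=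
  (Category.id_comp _).trans (Category.comp_id _)

variable {E : StrictPrestack X} (K : Cleavage E) (hE : E.IsSep)

/-- The functor from a separated prestack to its associated stack. -/
def toStack : K.prestack ⟶ (total (stackify hE)).prestack :=
  mkTrans K.pres (total (stackify hE)).pres (toStackify hE)
    (fun {U} p => (⟨(toStackify hE).ob (K.ι (U := U) p), (K.le (U := U) p).trans
      ((toStackify hE).le _)⟩ : At (stackify hE).dom U)) (fun {U} p => Iso.refl _)

lemma toStack_map {U : Opens X} {b b' : K.B U}
    (g : (⟨K.ι b, K.le b⟩ : At E.dom U) ⟶ ⟨K.ι b', K.le b'⟩) :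
    (onFib (K.toStack hE) U).map (X := b) (Y := b') g = (toStackify hE).map g :=
  (emb_mkTransMap K.pres (total (stackify hE)).pres (toStackify hE)
    (fun {U} p => (⟨(toStackify hE).ob (K.ι (U := U) p), (K.le (U := U) p).trans
      ((toStackify hE).le _)⟩ : At (stackify hE).dom U)) (fun {U} p => Iso.refl _) (x := b) (y := b')
    g).trans ((Category.id_comp _).trans (Category.comp_id _))

/-- Every object of the strict prestack is isomorphic to an object of the cleavage. -/
def EssSurj : Prop :=
  ∀ ⦃W : Opens X⦄ ⦃x : E.Ob⦄ (hx : W ≤ E.dom x),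
    ∃ b : K.B W, Nonempty ((⟨x, hx⟩ : At E.dom W) ≅ ⟨K.ι b, K.le b⟩)

lemma toStack_isAssociatedStack (hK : K.EssSurj) : IsAssociatedStack (K.toStack hE) := by
  refine isAssociatedStack_of_locallySurjective
    (total_isStackOn (stackify_isSep hE) (stackify_effective hE)) (fun U => ⟨fun {b b'} g => ?_⟩)
    (fun U => ⟨fun {b b' f g} h => ?_⟩) (fun U a x hx => ?_)
  · obtain ⟨k, hk⟩ := (toStackify_fullyFaithful hE (W := U) (K.le (U := U) b)
      (K.le (U := U) b')).2 g
    exact ⟨k, (K.toStack_map hE (b := b) (b' := b') k).trans hk⟩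
  · exact (toStackify_fullyFaithful hE (W := U) (K.le (U := U) b) (K.le (U := U) b')).1
      ((K.toStack_map hE (b := b) (b' := b') f).symm.trans
        (h.trans (K.toStack_map hE (b := b) (b' := b') g)))
  · let a' : At (stackify hE).dom U := a
    obtain ⟨k, hk⟩ := Desc.exists_mem a'.le x hx
    let V : Opens X := U ⊓ Desc.V a'.ob k
    have hV : V ≤ Desc.V a'.ob k := inf_le_right
    obtain ⟨b, ⟨e⟩⟩ := hK (hV.trans (Desc.le a'.ob k))
    exact ⟨V, homOfLE inf_le_left, b, ⟨hx, hk⟩,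
      ⟨(total (stackify hE)).fibIso (stackifyIso hE a'.ob k hV ≪≫ (toStackify hE).mapIso e)⟩⟩

end Cleavage

namespace StrictPrestack

/-- Any two objects are locally isomorphic. -/
def LocIso (E : StrictPrestack X) : Prop :=
  ∀ ⦃W : Opens X⦄ ⦃x y : E.Ob⦄ (hx : W ≤ E.dom x) (hy : W ≤ E.dom y), ∀ p ∈ W,
    ∃ (V : Opens X) (hV : V ≤ W), p ∈ V ∧
      Nonempty ((⟨x, hV.trans hx⟩ : At E.dom V) ≅ ⟨y, hV.trans hy⟩)

variable {E : StrictPrestack X} (hE : E.IsSep)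

lemma LocIso.stackify (h : E.LocIso) : (stackify hE).LocIso := by
  intro W a b ha hb p hp
  obtain ⟨k, hk⟩ := Desc.exists_mem ha p hp
  obtain ⟨l, hl⟩ := Desc.exists_mem hb p hp
  let W' : Opens X := W ⊓ (Desc.V a k ⊓ Desc.V b l)
  have hka : W' ≤ Desc.V a k := inf_le_right.trans inf_le_left
  have hlb : W' ≤ Desc.V b l := inf_le_right.trans inf_le_right
  obtain ⟨V, hV, hpV, ⟨e⟩⟩ := h (hka.trans (Desc.le a k)) (hlb.trans (Desc.le b l)) p ⟨hp, hk, hl⟩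
  exact ⟨V, hV.trans inf_le_left, hpV, ⟨stackifyIso hE a k (hV.trans hka) ≪≫
    (toStackify hE).mapIso e ≪≫ (stackifyIso hE b l (hV.trans hlb)).symm⟩⟩

lemma LocIso.total_locallyConnected (h : E.LocIso) :
    (Cleavage.total E).prestack.LocallyConnected := by
  intro U (a : At E.dom U) (b : At E.dom U) x hx
  obtain ⟨V, hV, hxV, ⟨e⟩⟩ := h a.le b.le x hx
  exact ⟨V, homOfLE hV, hxV, ⟨(Cleavage.total E).fibIso e⟩⟩

section linear

variable {R : RingSheaf X} [E.Additive] [IsLin R E]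

lemma toStackify_map_add {W : Opens X} {x y : E.Ob} {hx : W ≤ E.dom x} {hy : W ≤ E.dom y}
    (f g : (⟨x, hx⟩ : At E.dom W) ⟶ ⟨y, hy⟩) :
    (toStackify hE).map (f + g) = (toStackify hE).map f + (toStackify hE).map g :=
  Desc.Hom.ext (by
    funext i j V hV hi hj
    exact Additive.res_add hV f g)

lemma toStackify_map_smul {W : Opens X} {x y : E.Ob} {hx : W ≤ E.dom x} {hy : W ≤ E.dom y}
    (r : sec R W) (f : (⟨x, hx⟩ : At E.dom W) ⟶ ⟨y, hy⟩) :
    (toStackify hE).map (r • f) = r • (toStackify hE).map f :=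
  Desc.Hom.ext (by
    funext i j V hV hi hj
    exact IsLin.res_smul hV r f)

end linear

end StrictPrestack

variable {R : RingSheaf X}

/-- The functor from a separated linear prestack to its associated stack is linear. -/
lemma Cleavage.toStack_isLinear {E : StrictPrestack X} [E.Additive] [IsLin R E] (K : Cleavage E)
    (hE : E.IsSep) : LinearPrestack.IsLinear (A := K.linearPrestack R)
      (B := (Cleavage.total (stackify hE)).linearPrestack R) (K.toStack hE) where
  map_add U p q s t := by
    let H := (⟨(toStackify hE).ob (K.ι (U := U) p), (K.le (U := U) p).trans
      ((toStackify hE).le _)⟩ : At (stackify hE).dom U) ⟶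
      ⟨(toStackify hE).ob (K.ι (U := U) q), (K.le (U := U) q).trans ((toStackify hE).le _)⟩
    refine (K.toStack_map hE (b := p) (b' := q) (s + t)).trans
      ((toStackify_map_add hE (x := K.ι (U := U) p) (y := K.ι (U := U) q) s t).trans ?_)
    exact (congrArg₂ (fun k l : H => k + l) (K.toStack_map hE (b := p) (b' := q) s)
      (K.toStack_map hE (b := p) (b' := q) t)).symm
  map_smul U p q r s := by
    let H := (⟨(toStackify hE).ob (K.ι (U := U) p), (K.le (U := U) p).trans
      ((toStackify hE).le _)⟩ : At (stackify hE).dom U) ⟶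
      ⟨(toStackify hE).ob (K.ι (U := U) q), (K.le (U := U) q).trans ((toStackify hE).le _)⟩
    refine (K.toStack_map hE (b := p) (b' := q) (r • s)).trans
      ((toStackify_map_smul hE (x := K.ι (U := U) p) (y := K.ι (U := U) q) r s).trans ?_)
    exact (congrArg (fun k : H => r • k) (K.toStack_map hE (b := p) (b' := q) s)).symm

/-! ### Algebras of endomorphisms -/

namespace StrictPrestack.AlgData

variable {E : StrictPrestack X} (D : E.AlgData R) [∀ W, IsGroupoid (At E.dom W)] (hc : E.LocConn)

namespace Tw

variable {D} {x y : E.Ob} {W : Opens X} {hx : W ≤ E.dom x} {hy : W ≤ E.dom y}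

lemma cls_add (a b : D.S (⟨y, hy⟩ : At E.dom W)) (g : (⟨x, hx⟩ : At E.dom W) ⟶ ⟨y, hy⟩) :
    cls D (a + b) g = cls D a g + cls D b g := by
  rw [cls_add_cls, IsIso.inv_hom_id, D.L_id, mul_one]

lemma cls_injective (g : (⟨x, hx⟩ : At E.dom W) ⟶ ⟨y, hy⟩) :
    Function.Injective fun a => cls D a g := fun a b h => by
  have := (cls_eq_iff _ _ _ _).1 h
  rwa [IsIso.inv_hom_id, D.L_id, mul_one] at this

end Tw

lemma twist_locIso : (D.twist hc).LocIso := by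
  intro W x y hx hy p hp
  obtain ⟨V, hV, hpV, ⟨e⟩⟩ := hc hx hy p hp
  exact ⟨V, hV, hpV, ⟨(D.toTwist hc).mapIso (asIso e)⟩⟩

/-- The endomorphism `[a, 1]`, in the associated stack. -/
def toEnd {W : Opens X} {x : E.Ob} (hx : W ≤ E.dom x) (a : D.S (⟨x, hx⟩ : At E.dom W)) :
    End (⟨(toStackify (D.twist_isSep hc)).ob x, hx.trans ((toStackify (D.twist_isSep hc)).le x)⟩ :
      At (stackify (D.twist_isSep hc)).dom W) :=
  (toStackify (D.twist_isSep hc)).map (E := D.twist hc) (x := x) (y := x) (hx := hx) (hy := hx)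
    (Tw.cls D a (𝟙 (⟨x, hx⟩ : At E.dom W)))

lemma res_toEnd {W W' : Opens X} (h : W' ≤ W) {x : E.Ob} (hx : W ≤ E.dom x)
    (a : D.S (⟨x, hx⟩ : At E.dom W)) :
    (stackify (D.twist_isSep hc)).res h (D.toEnd hc hx a) =
      D.toEnd hc (h.trans hx) (D.res h a) := by
  refine ((toStackify (D.twist_isSep hc)).map_res h _).symm.trans ?_
  refine congrArg (fun k => (toStackify (D.twist_isSep hc)).map k) ?_
  refine (Tw.restrict_cls h _ _).trans ?_
  rw [E.res_id]

lemma toEnd_str {W : Opens X} {x : E.Ob} (hx : W ≤ E.dom x) (r : sec R W) :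
    D.toEnd hc hx (D.str _ r) = r • 𝟙 (⟨(toStackify (D.twist_isSep hc)).ob x,
      hx.trans ((toStackify (D.twist_isSep hc)).le x)⟩ :
      At (stackify (D.twist_isSep hc)).dom W) := by
  refine Eq.trans ?_ ((toStackify_map_smul (D.twist_isSep hc) r _).trans
    (congrArg (fun k => r • k) ((toStackify (D.twist_isSep hc)).map_id hx)))
  refine congrArg (fun k => (toStackify (D.twist_isSep hc)).map k) ?_
  refine Eq.trans ?_ (Tw.smul_cls r 1 (𝟙 (⟨x, hx⟩ : At E.dom W))).symm
  rw [mul_one]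

/-- The algebra attached to an object is that of the endomorphisms of this object in the associated
stack. -/
def endEquiv {W : Opens X} {x : E.Ob} (hx : W ≤ E.dom x) :
    D.S (⟨x, hx⟩ : At E.dom W) ≃+* End (⟨(toStackify (D.twist_isSep hc)).ob x,
      hx.trans ((toStackify (D.twist_isSep hc)).le x)⟩ :
      At (stackify (D.twist_isSep hc)).dom W) :=
  RingEquiv.ofBijective
    (RingHom.mk' { toFun := D.toEnd hc hx
                   map_one' := (toStackify (D.twist_isSep hc)).map_id hx
                   map_mul' := fun a b => by
                    refine Eq.trans ?_ ((toStackify (D.twist_isSep hc)).map_comp _ _)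
                    refine congrArg (fun k => (toStackify (D.twist_isSep hc)).map k) ?_
                    refine Eq.trans ?_ (Tw.comp_cls hc a (𝟙 (⟨x, hx⟩ : At E.dom W)) b (𝟙 _)).symm
                    rw [D.act_id, Category.id_comp] }
      (fun a b => by
        refine Eq.trans ?_ (toStackify_map_add (D.twist_isSep hc) _ _)
        refine congrArg (fun k => (toStackify (D.twist_isSep hc)).map k) ?_
        exact Tw.cls_add a b _))
    ((toStackify_fullyFaithful (D.twist_isSep hc) hx hx).comp
      ⟨fun a b h => Tw.cls_injective _ h,
        fun s => ⟨_, (Tw.eq_cls s (𝟙 (⟨x, hx⟩ : At E.dom W))).symm⟩⟩)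

end StrictPrestack.AlgData

namespace AlgebroidData

open AlgData

variable (D : AlgebroidData R)

/-- The stack associated with the prestack of twisted morphisms. -/
def stack : LinearPrestack R :=
  (Cleavage.total (stackify (AlgData.twist_isSep D.strictData D.strict_locConn))).linearPrestack R

/-- The functor from the prestack of twisted morphisms to its associated stack. -/
def toStack : D.twistedPrestack.carrier ⟶ D.stack.carrier :=
  D.cleavage.toStack (AlgData.twist_isSep D.strictData D.strict_locConn)

lemma toStack_isAssociatedStack : IsAssociatedStack D.toStack :=
  D.cleavage.toStack_isAssociatedStack _ fun W x hx =>
    ⟨(D.P.res (homOfLE hx)).obj x.2, ⟨(D.cleavage.c hx x.2).symm⟩⟩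

lemma stack_isAlgebroid : D.stack.IsAlgebroid where
  isStack := D.toStack_isAssociatedStack.isStack
  locallyNonempty x := by
    obtain ⟨U, hU, ⟨p⟩⟩ := D.isGerbe.locallyNonempty x
    exact ⟨U, hU, ⟨(onFib D.toStack U).obj p⟩⟩
  locallyConnected :=
    ((AlgData.twist_locIso D.strictData D.strict_locConn).stackify _).total_locallyConnected

/-- The object `J(p)`. -/
abbrev stackObj {U : Opens X} (p : D.P.fib U) :
    At (stackify (AlgData.twist_isSep D.strictData D.strict_locConn)).dom U :=
  ⟨(toStackify (AlgData.twist_isSep D.strictData D.strict_locConn)).ob (D.P.pres.ι p),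
    (D.P.pres.le p).trans ((toStackify (AlgData.twist_isSep D.strictData D.strict_locConn)).le
      (D.P.pres.ι p))⟩

/-- The endomorphisms of `J(p)` over an open subset of `U`, for `p` an object over `U`. -/
def endIso {U : Opens X} (p : D.P.fib U) :
    (algOf D.Φ p).ring.obj ≅ (D.stack.endAlg D.stack_isAlgebroid.isStack.toIsPrestack
      ((onFib (D.J₀ ≫ D.toStack) U).obj p)).ring.obj :=
  NatIso.ofComponents (fun T => RingEquiv.toRingCatIso (show _ ≃+* _ from
      D.strictData.endEquiv D.strict_locConn (x := D.P.pres.ι p) T.unop.hom.le))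
    (fun {T T'} k => by
      ext a
      exact (D.strictData.res_toEnd D.strict_locConn (x := D.P.pres.ι p) k.unop.left.le
        T.unop.hom.le a).symm.trans
        (Cleavage.total_pullHom (D.stackObj p) (D.stackObj p) T.unop.hom k.unop.left T'.unop.hom
          (D.strictData.toEnd D.strict_locConn (x := D.P.pres.ι p) T.unop.hom.le a)).symm)

/-- The algebra `Φ(p)` is that of the endomorphisms of `J(p)`. -/
def algIso {U : Opens X} (p : D.P.fib U) :
    algOf D.Φ p ≅ D.stack.endAlg D.stack_isAlgebroid.isStack.toIsPrestack
      ((onFib (D.J₀ ≫ D.toStack) U).obj p) :=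
  AlgSheaf.isoMk ((fullyFaithfulSheafToPresheaf _ _).preimageIso (D.endIso p))
    (fun T r => D.strictData.toEnd_str D.strict_locConn (x := D.P.pres.ι p) T.hom.le r)

lemma Γmap_algIso_hom {U : Opens X} (p : D.P.fib U) (a : algSec D.Φ p) :
    AlgSheaf.Γmap (D.algIso p).hom a =
      D.stack.endSec D.stack_isAlgebroid.isStack.toIsPrestack
        ((onFib D.toStack U).map (D.description.cls a (𝟙 p))) := by
  have h : D.description.cls a (𝟙 p) = Tw.cls D.strictData (D.toS p a) (𝟙 _) :=
    congrArg (fun k => Tw.cls D.strictData (D.toS p a) k) (D.P.pres.emb_id p)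
  symm
  refine (Cleavage.total_resHom le_rfl _ _ _).trans ?_
  refine (StrictPrestack.res_self _ _ _).trans ?_
  refine (congrArg (fun k => (onFib D.toStack U).map k) h).trans ?_
  exact D.cleavage.toStack_map _ (b := p) (b' := p) _

end AlgebroidData

end AlgebroidStacks

end

theorem mainTheorem9 {X : Type u} [TopologicalSpace X] (R : RingSheaf X) (D : AlgebroidData R) :
    ∃ (A₀ : LinearPrestack R) (desc : D.Description A₀),
      A₀.carrier.IsSeparated ∧
      ∃ (A : LinearPrestack R) (i : A₀.carrier ⟶ A.carrier) (hA : A.IsAlgebroid),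
        IsAssociatedStack i ∧ LinearPrestack.IsLinear i ∧
        ∀ (U : Opens X) (p : D.P.fib U),
          ∃ e : algOf D.Φ p ≅
              A.endAlg hA.isStack.toIsPrestack ((onFib (desc.J₀ ≫ i) U).obj p),
            ∀ a : algSec D.Φ p,
              AlgSheaf.Γmap e.hom a =
                A.endSec hA.isStack.toIsPrestack ((onFib i U).map (desc.cls a (𝟙 p))) := by
  refine ⟨D.twistedPrestack, D.description, D.twistedPrestack_isSeparated, D.stack, D.toStack,
    D.stack_isAlgebroid, D.toStack_isAssociatedStack,
    D.cleavage.toStack_isLinear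
      (StrictPrestack.AlgData.twist_isSep D.strictData D.strict_locConn), fun U p => ?_⟩
  exact ⟨D.algIso p, fun a => D.Γmap_algIso_hom p a⟩
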